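/- Let $k$ be a field and let $\psi\colon A\to B$ be a morphism of $\mathbb Z$-graded dg algebras over $k$ (differentials of degree $+1$, $d(ab)=d(a)b+(-1)^{|a|}a\,d(b)$) such that the homomorphism of graded algebras $\varphi=H^*\psi\colon R=H^*A\to T=H^*B$ is a flat epimorphism of rings, i.e. an epimorphism in the category of rings such that $T$ is flat both as a left and as a right $R$-module. Notation. For a graded $k$-algebra $\Lambda$ let $\mathbb B(\Lambda)$ be the bar resolution, $\mathbb B(\Lambda)_n=\Lambda^{\otimes(n+2)}$ with $d(\lambda_0,\dots,\lambda_{n+1})=\sum_{i=0}^{n}(-1)^i(\lambda_0,\dots,\lambda_i\lambda_{i+1},\dots,\lambda_{n+1})$, and let $HH^{s,t}(\Lambda)=H^s(\operatorname{Hom}^t_{\Lambda^e}(\mathbb B(\Lambda),\Lambda))$, where a map $f$ of graded bimodules is $\Lambda^e$-linear of degree $t$ if it raises degrees by $t$ and $f(\mu m\mu')=(-1)^{t|\mu|}\mu f(m)\mu'$. The bigraded algebra structure on $HH^{*,*}(\Lambda)$ is induced by $$(\zeta\cup\xi)(\lambda_0,\dots,\lambda_{m+n+1})=(-1)^{j(|\lambda_0|+\dots+|\lambda_m|)}\,\zeta(\lambda_0,\dots,\lambda_m,1)\,\xi(1,\lambda_{m+1},\dots,\lambda_{m+n+1})$$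 for $\zeta$ of bidegree $(m,i)$ and $\xi$ of bidegree $(n,j)$; the unit is the class of the multiplication map $\Lambda\otimes\Lambda\to\Lambda$. Let $$\eta\colon T\otimes_R\mathbb B(R)\otimes_R T\to\mathbb B(T),\qquad \eta\bigl(s\otimes(r_0,\dots,r_{n+1})\otimes t\bigr)=(s\varphi(r_0),\varphi(r_1),\dots,\varphi(r_n),\varphi(r_{n+1})t),$$ let $\eta^*\colon HH^{n,l}(T)\to H^n(\operatorname{Hom}^l_{T^e}(T\otimes_R\mathbb B(R)\otimes_R T,T))$ be the map $[f]\mapsto[f\circ\eta]$, and for $\zeta\in\operatorname{Hom}^l_{R^e}(\mathbb B(R)_n,R)$ let $T\otimes_R\zeta\otimes_R T$ be the map $s\otimes x\otimes t\mapsto(-1)^{l|s|}s\,\varphi(\zeta(x))\,t$. The canonical class of a dg algebra $A$ is defined as follows. Choose a $k$-linear map $f_1\colon H^*A\to A$ of degree $0$ whose value at each class is a cocycle representing it, and a $k$-linear map $f_2\colon H^*A\otimes H^*A\to A$ of degree $-1$ with $d f_2(x,y)=f_1(xy)-f_1(x)f_1(y)$. Then $$\Phi(x,y,z)=(-1)^{|x|}f_1(x)f_2(y,z)-f_2(x,y)f_1(z)-f_2(xy,z)+f_2(x,yz)$$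 is a cocycle; let $m_3(x,y,z)\in H^*A$ be its class. The map $(x_0,\dots,x_4)\mapsto(-1)^{|x_0|}x_0\,m_3(x_1,x_2,x_3)\,x_4$ is a Hochschild cocycle, and $\mu_A\in HH^{3,-1}(H^*A)$ denotes its class. Claim. The map $\eta^*\colon HH^{n,l}(T)\to H^n(\operatorname{Hom}^l_{T^e}(T\otimes_R\mathbb B(R)\otimes_R T,T))$ is bijective for all $n\ge 0$ and $l\in\mathbb Z$; the maps $$\Gamma=(\eta^*)^{-1}\circ[\zeta\mapsto T\otimes_R\zeta\otimes_R T]\colon HH^{*,*}(H^*A)\to HH^{*,*}(H^*B)$$ that are therefore defined form a homomorphism of bigraded $k$-algebras (linear, unital, and compatible with the cup product); and $$\Gamma(\mu_A)=\mu_B$$ for all choices of the maps $f_1,f_2$ for $A$ and for $B$ in the construction of $\mu_A$ and $\mu_B$. -/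

import Mathlib

open scoped TensorProduct DirectSum

universe u v w

noncomputable section

namespace DGHoch

section Sign

variable {k : Type u} [Field k] {Λ : Type v} [Ring Λ] [Algebra k Λ]
variable (𝒜 : ℤ → Submodule k Λ) [GradedAlgebra 𝒜]

/-- The Koszul sign operator `a ↦ (-1)^(t * |a|) • a` of a graded algebra, extended linearly
from homogeneous elements. -/
def signTwist (t : ℤ) : Λ →ₗ[k] Λ :=
  DirectSum.toModule k ℤ Λ (fun i => ((t * i).negOnePow : ℤ) • (𝒜 i).subtype) ∘ₗ
    (DirectSum.decomposeLinearEquiv 𝒜).toLinearMap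

theorem signTwist_of_mem (t : ℤ) {i : ℤ} {a : Λ} (ha : a ∈ 𝒜 i) :
    signTwist 𝒜 t a = ((t * i).negOnePow : ℤ) • a := by
  have h := DirectSum.decomposeLinearEquiv_apply_coe (R := k) 𝒜 i ⟨a, ha⟩
  simp only at h
  rw [signTwist, LinearMap.comp_apply, LinearEquiv.coe_coe, h, DirectSum.toModule_lof]
  rfl

/-- Two linear maps that agree on homogeneous elements are equal. -/
theorem ext_homogeneous {M : Type*} [AddCommGroup M] [Module k M] {f g : Λ →ₗ[k] M}
    (h : ∀ i, ∀ a ∈ 𝒜 i, f a = g a) : f = g := by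
  ext a
  induction a using DirectSum.Decomposition.inductionOn 𝒜 with
  | zero => simp
  | homogeneous m => exact h _ _ m.2
  | add a b ha hb => simp [ha, hb]

theorem signTwist_mem (t : ℤ) {i : ℤ} {a : Λ} (ha : a ∈ 𝒜 i) : signTwist 𝒜 t a ∈ 𝒜 i := by
  rw [signTwist_of_mem 𝒜 t ha]
  exact (𝒜 i).smul_of_tower_mem _ ha

theorem signTwist_one (t : ℤ) : signTwist 𝒜 t 1 = 1 := by
  rw [signTwist_of_mem 𝒜 t (SetLike.GradedOne.one_mem (A := 𝒜))]
  simp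

theorem signTwist_mul (t : ℤ) (a b : Λ) :
    signTwist 𝒜 t (a * b) = signTwist 𝒜 t a * signTwist 𝒜 t b := by
  have : (LinearMap.mul k Λ).compr₂ (signTwist 𝒜 t) =
      (LinearMap.mul k Λ).compl₁₂ (signTwist 𝒜 t) (signTwist 𝒜 t) := by
    refine ext_homogeneous 𝒜 fun i a ha => ext_homogeneous 𝒜 fun j b hb => ?_
    simp only [LinearMap.compr₂_apply, LinearMap.mul_apply', LinearMap.compl₁₂_apply]
    rw [signTwist_of_mem 𝒜 t ha, signTwist_of_mem 𝒜 t hb,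
      signTwist_of_mem 𝒜 t (SetLike.GradedMul.mul_mem ha hb), mul_add, Int.negOnePow_add,
      smul_mul_smul_comm, Units.val_mul]
  exact LinearMap.congr_fun₂ this a b

theorem signTwist_add (s t : ℤ) (a : Λ) :
    signTwist 𝒜 (s + t) a = signTwist 𝒜 s (signTwist 𝒜 t a) := by
  have : signTwist 𝒜 (s + t) = signTwist 𝒜 s ∘ₗ signTwist 𝒜 t := by
    refine ext_homogeneous 𝒜 fun i a ha => ?_
    rw [LinearMap.comp_apply, signTwist_of_mem 𝒜 s (signTwist_mem 𝒜 t ha),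
      signTwist_of_mem 𝒜 t ha, signTwist_of_mem 𝒜 _ ha, add_mul, Int.negOnePow_add, smul_smul]
    simp
  exact LinearMap.congr_fun this a

theorem signTwist_neg (t : ℤ) (a : Λ) : signTwist 𝒜 (-t) a = signTwist 𝒜 t a := by
  have : signTwist 𝒜 (-t) = signTwist 𝒜 t := by
    refine ext_homogeneous 𝒜 fun i a ha => ?_
    rw [signTwist_of_mem 𝒜 _ ha, signTwist_of_mem 𝒜 _ ha, neg_mul, Int.negOnePow_neg]
  exact LinearMap.congr_fun this a

theorem signTwist_zero (a : Λ) : signTwist 𝒜 0 a = a := by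
  have : signTwist 𝒜 0 = LinearMap.id := by
    refine ext_homogeneous 𝒜 fun i a ha => ?_
    rw [signTwist_of_mem 𝒜 _ ha]
    simp
  exact LinearMap.congr_fun this a

/-- A linear map which is homogeneous of degree `s` commutes with the sign operator up to the
sign `(-1)^(t * s)`. -/
theorem signTwist_map {Γ : Type*} [Ring Γ] [Algebra k Γ] (ℬ : ℤ → Submodule k Γ)
    [GradedAlgebra ℬ] (t s : ℤ) (f : Λ →ₗ[k] Γ) (hf : ∀ i, ∀ a ∈ 𝒜 i, f a ∈ ℬ (i + s)) (a : Λ) :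
    signTwist ℬ t (f a) = ((t * s).negOnePow : ℤ) • f (signTwist 𝒜 t a) := by
  have : signTwist ℬ t ∘ₗ f = ((t * s).negOnePow : ℤ) • (f ∘ₗ signTwist 𝒜 t) := by
    refine ext_homogeneous 𝒜 fun i a ha => ?_
    rw [LinearMap.comp_apply, signTwist_of_mem ℬ t (hf i a ha), LinearMap.smul_apply,
      LinearMap.comp_apply, signTwist_of_mem 𝒜 t ha, map_zsmul, smul_smul, mul_add,
      Int.negOnePow_add, mul_comm]
    simp
  exact LinearMap.congr_fun this a

theorem signTwist_gradedHom {Γ : Type*} [Ring Γ] [Algebra k Γ] {ℬ : ℤ → Submodule k Γ}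
    [GradedAlgebra ℬ] (t : ℤ) (φ : 𝒜 →ₐᵍ[k] ℬ) (a : Λ) :
    signTwist ℬ t (φ a) = φ (signTwist 𝒜 t a) := by
  have := signTwist_map 𝒜 ℬ t 0 φ.toAlgHom.toLinearMap
    (fun i a ha => by rw [add_zero]; exact φ.map_mem ha) a
  simpa using this

end Sign

section DGA

variable {k : Type u} [Field k] {A : Type v} [Ring A] [Algebra k A]

/-- The structure of a differential graded algebra over `k` on a `ℤ`-graded `k`-algebra: a
`k`-linear differential of degree `+1` with square zero which satisfies the Leibniz rule. -/
structure DGStructure (𝒜 : ℤ → Submodule k A) [GradedAlgebra 𝒜] where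
  /-- The differential. -/
  d : A →ₗ[k] A
  d_mem : ∀ i, ∀ a ∈ 𝒜 i, d a ∈ 𝒜 (i + 1)
  d_d : ∀ a, d (d a) = 0
  leibniz : ∀ n, ∀ a ∈ 𝒜 n, ∀ b, d (a * b) = d a * b + (n.negOnePow : ℤ) • (a * d b)

namespace DGStructure

variable {𝒜 : ℤ → Submodule k A} [GradedAlgebra 𝒜] (D : DGStructure 𝒜)

theorem d_mul (a b : A) : D.d (a * b) = D.d a * b + signTwist 𝒜 (-1) a * D.d b := by
  have : (LinearMap.mul k A).compr₂ D.d = (LinearMap.mul k A).compl₁₂ D.d LinearMap.id +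
      (LinearMap.mul k A).compl₁₂ (signTwist 𝒜 (-1)) D.d := by
    refine ext_homogeneous 𝒜 fun i a ha => ?_
    ext b
    simp only [LinearMap.compr₂_apply, LinearMap.mul_apply', LinearMap.compl₁₂_apply,
      LinearMap.add_apply, LinearMap.id_apply]
    rw [D.leibniz i a ha, signTwist_of_mem 𝒜 _ ha, smul_mul_assoc, neg_one_mul,
      Int.negOnePow_neg]
  exact LinearMap.congr_fun₂ this a b

theorem d_one : D.d 1 = 0 := by
  have := D.d_mul 1 1
  rw [signTwist_one] at this
  simpa using this

/-- The subalgebra of cocycles. -/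
def cycles : Subalgebra k A where
  carrier := {a | D.d a = 0}
  mul_mem' {a b} ha hb := by
    simp only [Set.mem_ofPred_eq] at *
    rw [D.d_mul, ha, hb]; simp
  add_mem' {a b} ha hb := by
    simp only [Set.mem_ofPred_eq] at *
    rw [map_add, ha, hb, add_zero]
  algebraMap_mem' r := by
    simp only [Set.mem_ofPred_eq]
    rw [Algebra.algebraMap_eq_smul_one, map_smul, D.d_one, smul_zero]

theorem mem_cycles {a : A} : a ∈ D.cycles ↔ D.d a = 0 := Iff.rfl

theorem signTwist_cycle {a : A} (t : ℤ) (ha : D.d a = 0) : D.d (signTwist 𝒜 t a) = 0 := by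
  have h := signTwist_map 𝒜 𝒜 t 1 D.d D.d_mem a
  rw [ha, map_zero] at h
  rcases Int.units_eq_one_or (t * 1).negOnePow with h' | h' <;> rw [h'] at h <;> simpa using h.symm

/-- The two-sided ideal of coboundaries in the algebra of cocycles. -/
def boundaries : Ideal D.cycles where
  carrier := {z | ∃ a, D.d a = z}
  add_mem' := by
    rintro _ _ ⟨a, ha⟩ ⟨b, hb⟩
    exact ⟨a + b, by simp [ha, hb]⟩
  zero_mem' := ⟨0, by simp⟩
  smul_mem' := by
    rintro ⟨c, hc⟩ _ ⟨a, ha⟩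
    refine ⟨signTwist 𝒜 1 c * a, ?_⟩
    rw [D.d_mul, D.signTwist_cycle 1 hc, ← signTwist_add, ha]
    simp [signTwist_zero]

theorem mem_boundaries {z : D.cycles} : z ∈ D.boundaries ↔ ∃ a, D.d a = z := Iff.rfl

instance : D.boundaries.IsTwoSided where
  mul_mem_of_left := by
    rintro _ ⟨c, hc⟩ ⟨a, ha⟩
    exact ⟨a * c, by rw [D.d_mul, (hc : D.d c = 0), ha]; simp⟩

/-- The cohomology algebra `H^*A = ker d / im d`. -/
abbrev Cohomology : Type v := D.cycles ⧸ D.boundaries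

/-- The quotient map from cocycles to cohomology. -/
def toCohomology : D.cycles →ₐ[k] D.Cohomology := Ideal.Quotient.mkₐ k D.boundaries

theorem toCohomology_surjective : Function.Surjective D.toCohomology :=
  Ideal.Quotient.mkₐ_surjective k D.boundaries

theorem toCohomology_eq_zero {z : D.cycles} : D.toCohomology z = 0 ↔ ∃ a, D.d a = z :=
  Ideal.Quotient.eq_zero_iff_mem

/-- The degree `i` part of the cohomology: the classes of the cocycles of degree `i`. -/
def cohGrading (i : ℤ) : Submodule k D.Cohomology :=
  ((𝒜 i).comap D.cycles.val.toLinearMap).map D.toCohomology.toLinearMap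

theorem mem_cohGrading {i : ℤ} {x : D.Cohomology} :
    x ∈ D.cohGrading i ↔ ∃ z : D.cycles, (z : A) ∈ 𝒜 i ∧ D.toCohomology z = x := Iff.rfl

instance : SetLike.GradedMonoid D.cohGrading where
  one_mem := ⟨1, SetLike.GradedOne.one_mem (A := 𝒜), map_one D.toCohomology⟩
  mul_mem := by
    rintro i j _ _ ⟨a, ha, rfl⟩ ⟨b, hb, rfl⟩
    exact ⟨a * b, SetLike.GradedMul.mul_mem (A := 𝒜) ha hb, map_mul D.toCohomology a b⟩

theorem decompose_d (a : A) (i : ℤ) :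
    (DirectSum.decompose 𝒜 (D.d a) (i + 1) : A) = D.d (DirectSum.decompose 𝒜 a i : A) := by
  induction a using DirectSum.Decomposition.inductionOn 𝒜 with
  | zero => simp
  | @homogeneous j m =>
    by_cases h : j = i
    · subst h
      rw [DirectSum.decompose_of_mem_same 𝒜 (D.d_mem _ _ m.2),
        DirectSum.decompose_of_mem_same 𝒜 m.2]
    · rw [DirectSum.decompose_of_mem_ne 𝒜 (D.d_mem _ _ m.2) (by omega),
        DirectSum.decompose_of_mem_ne 𝒜 m.2 h, map_zero]
  | add a b ha hb => simp [ha, hb]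

theorem cohGrading_isInternal : DirectSum.IsInternal D.cohGrading := by
  classical
  constructor
  · rw [injective_iff_map_eq_zero]
    intro x hx
    have hrep : ∀ i, ∃ z : D.cycles, (z : A) ∈ 𝒜 i ∧ D.toCohomology z = x i :=
      fun i => D.mem_cohGrading.1 (x i).2
    choose z hz hzx using hrep
    rw [DirectSum.coeAddMonoidHom_eq_dfinsuppSum, DFinsupp.sum] at hx
    have h1 : D.toCohomology (∑ i ∈ x.support, z i) = 0 := by
      rw [map_sum, ← hx]
      exact Finset.sum_congr rfl fun i _ => hzx i
    obtain ⟨b, hb⟩ := D.toCohomology_eq_zero.1 h1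
    ext j
    by_contra hj
    have hjs : j ∈ x.support := by
      rw [DFinsupp.mem_support_iff]
      intro h0
      exact hj (by rw [h0]; rfl)
    have h2 : (DirectSum.decompose 𝒜 (D.d b) (j - 1 + 1) : A) = z j := by
      rw [hb, sub_add_cancel, AddSubmonoidClass.coe_finsetSum, DirectSum.decompose_sum]
      rw [DFinsupp.finsetSum_apply, AddSubmonoidClass.coe_finsetSum,
        Finset.sum_eq_single_of_mem j hjs]
      · exact DirectSum.decompose_of_mem_same 𝒜 (hz j)
      · intro i _ hij
        exact DirectSum.decompose_of_mem_ne 𝒜 (hz i) hij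
    rw [D.decompose_d] at h2
    apply hj
    rw [← hzx j]
    simpa using D.toCohomology_eq_zero.2 ⟨_, h2⟩
  · intro x
    obtain ⟨z, rfl⟩ := D.toCohomology_surjective x
    have hc : ∀ i, D.d (DirectSum.decompose 𝒜 (z : A) i : A) = 0 := fun i => by
      rw [← D.decompose_d, (z.2 : D.d z = 0)]; simp
    refine ⟨∑ i ∈ (DirectSum.decompose 𝒜 (z : A)).support, DirectSum.of (fun i => D.cohGrading i) i
      ⟨D.toCohomology ⟨_, hc i⟩, ⟨_, (DirectSum.decompose 𝒜 (z : A) i).2, rfl⟩⟩, ?_⟩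
    rw [map_sum]
    simp only [DirectSum.coeAddMonoidHom_of]
    rw [← map_sum]
    congr 1
    ext
    rw [AddSubmonoidClass.coe_finsetSum]
    exact DirectSum.sum_support_decompose 𝒜 (z : A)

instance : DirectSum.Decomposition D.cohGrading := D.cohGrading_isInternal.chooseDecomposition

instance : GradedAlgebra D.cohGrading where

end DGStructure

variable {𝒜 : ℤ → Submodule k A} [GradedAlgebra 𝒜]
variable {B : Type w} [Ring B] [Algebra k B] {ℬ : ℤ → Submodule k B} [GradedAlgebra ℬ]

/-- A morphism of dg algebras: a homomorphism of graded algebras (of degree zero) which commutes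
with the differentials. -/
structure DGHom (DA : DGStructure 𝒜) (DB : DGStructure ℬ) where
  /-- The underlying homomorphism of graded algebras. -/
  toGradedAlgHom : 𝒜 →ₐᵍ[k] ℬ
  map_d : ∀ a, toGradedAlgHom (DA.d a) = DB.d (toGradedAlgHom a)

namespace DGHom

variable {DA : DGStructure 𝒜} {DB : DGStructure ℬ} (ψ : DGHom DA DB)

/-- The map induced on cocycles. -/
def mapCycles : DA.cycles →ₐ[k] DB.cycles :=
  (ψ.toGradedAlgHom.toAlgHom.comp DA.cycles.val).codRestrict DB.cycles fun z => by
    change DB.d (ψ.toGradedAlgHom z) = 0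
    rw [← ψ.map_d, (z.2 : DA.d z = 0), map_zero]

/-- The underlying algebra homomorphism of the map induced in cohomology. -/
def mapCohomologyAlgHom : DA.Cohomology →ₐ[k] DB.Cohomology :=
  Ideal.quotientMapₐ DB.boundaries ψ.mapCycles <| by
    rintro _ ⟨a, ha⟩
    refine ⟨ψ.toGradedAlgHom a, ?_⟩
    rw [← ψ.map_d, ha]
    rfl

/-- The homomorphism of graded algebras `H^*ψ : H^*A → H^*B`, `[z] ↦ [ψ z]`. -/
def mapCohomology : DA.cohGrading →ₐᵍ[k] DB.cohGrading where
  toAlgHom := ψ.mapCohomologyAlgHom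
  map_mem := by
    rintro i _ ⟨z, hz, rfl⟩
    exact ⟨ψ.mapCycles z, ψ.toGradedAlgHom.map_mem hz, rfl⟩

end DGHom

end DGA

section Subquotient

variable {k : Type u} [Field k] {V : Type v} [AddCommGroup V] [Module k V]

/-- The subquotient `Z / (B ∩ Z)` of a vector space; it is `Z / B` if `B ⊆ Z`. -/
def Subquotient (Z B : Submodule k V) : Type v := Z ⧸ B.submoduleOf Z

variable {Z B : Submodule k V}

instance : AddCommGroup (Subquotient Z B) :=
  inferInstanceAs (AddCommGroup (Z ⧸ B.submoduleOf Z))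

instance : Module k (Subquotient Z B) := inferInstanceAs (Module k (Z ⧸ B.submoduleOf Z))

namespace Subquotient

/-- The class in `Z / B` of an element of `Z`. -/
def mk (Z B : Submodule k V) : Z →ₗ[k] Subquotient Z B := (B.submoduleOf Z).mkQ

theorem mk_surjective : Function.Surjective (mk Z B) := (B.submoduleOf Z).mkQ_surjective

theorem mk_eq_zero {z : Z} : mk Z B z = 0 ↔ (z : V) ∈ B :=
  Submodule.Quotient.mk_eq_zero (B.submoduleOf Z)

/-- A linear map on `Z` which vanishes on `B ∩ Z` factors through `Z / B`. -/
def lift {M : Type*} [AddCommGroup M] [Module k M] (f : Z →ₗ[k] M)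
    (hf : ∀ z : Z, (z : V) ∈ B → f z = 0) : Subquotient Z B →ₗ[k] M :=
  (B.submoduleOf Z).liftQ f hf

theorem lift_mk {M : Type*} [AddCommGroup M] [Module k M] (f : Z →ₗ[k] M)
    (hf : ∀ z : Z, (z : V) ∈ B → f z = 0) (z : Z) : lift f hf (mk Z B z) = f z := rfl

end Subquotient

end Subquotient

section Complexes

variable {k : Type u} [Field k] {Λ : Type v} [Ring Λ] [Algebra k Λ]

/-- A chain complex `⋯ → X 1 → X 0` of graded `(Λ, Λ)`-bimodules over a graded algebra `Λ`. The
submodule `gr n i` consists of the elements of `X n` of (internal) degree `i`, and `left n a x`,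
`right n a x` are the products `a x` and `x a`. -/
structure BimoduleComplex (𝒜 : ℤ → Submodule k Λ) [GradedAlgebra 𝒜] where
  /-- The terms of the complex. -/
  X : ℕ → Type w
  [addCommGroup : ∀ n, AddCommGroup (X n)]
  [module : ∀ n, Module k (X n)]
  /-- The internal grading. -/
  gr : ∀ n, ℤ → Submodule k (X n)
  /-- The left multiplication. -/
  left : ∀ n, Λ →ₗ[k] Module.End k (X n)
  /-- The right multiplication. -/
  right : ∀ n, Λ →ₗ[k] Module.End k (X n)
  left_one : ∀ n x, left n 1 x = x
  left_mul : ∀ n a b x, left n (a * b) x = left n a (left n b x)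
  right_one : ∀ n x, right n 1 x = x
  right_mul : ∀ n a b x, right n (a * b) x = right n b (right n a x)
  left_right : ∀ n a b x, left n a (right n b x) = right n b (left n a x)
  left_mem : ∀ n i j, ∀ a ∈ 𝒜 i, ∀ x ∈ gr n j, left n a x ∈ gr n (i + j)
  right_mem : ∀ n i j, ∀ a ∈ 𝒜 i, ∀ x ∈ gr n j, right n a x ∈ gr n (j + i)
  /-- The differential, a homomorphism of bimodules of internal degree zero. -/
  d : ∀ n, X (n + 1) →ₗ[k] X n
  d_left : ∀ n a x, d n (left (n + 1) a x) = left n a (d n x)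
  d_right : ∀ n a x, d n (right (n + 1) a x) = right n a (d n x)
  d_mem : ∀ n i, ∀ x ∈ gr (n + 1) i, d n x ∈ gr n i
  d_d : ∀ n x, d n (d (n + 1) x) = 0

attribute [instance] BimoduleComplex.addCommGroup BimoduleComplex.module

namespace BimoduleComplex

variable {𝒜 : ℤ → Submodule k Λ} [GradedAlgebra 𝒜] (P : BimoduleComplex.{u, v, w} 𝒜)

/-- The space `Hom^t_{Λ^e}(X n, Λ)` of bimodule homomorphisms of degree `t`. With graded bimodules
regarded as graded right modules over `Λ^e = Λ^op ⊗ Λ` through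
`m (μ ⊗ μ') = (-1)^(|μ||m|) μ m μ'`, a `Λ^e`-linear map `f` of degree `t` is a map with
`f (μ m μ') = (-1)^(t|μ|) μ (f m) μ'`. -/
def Coch (t : ℤ) (n : ℕ) : Submodule k (P.X n →ₗ[k] Λ) where
  carrier := {f | (∀ i, ∀ x ∈ P.gr n i, f x ∈ 𝒜 (i + t)) ∧
    (∀ a x, f (P.left n a x) = signTwist 𝒜 t a * f x) ∧
    (∀ a x, f (P.right n a x) = f x * a)}
  add_mem' := by
    rintro f g ⟨hf, hf', hf''⟩ ⟨hg, hg', hg''⟩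
    refine ⟨fun i x hx => add_mem (hf i x hx) (hg i x hx), fun a x => ?_, fun a x => ?_⟩
    · simp [hf', hg', mul_add]
    · simp [hf'', hg'', add_mul]
  zero_mem' := ⟨fun i x _ => zero_mem _, by simp, by simp⟩
  smul_mem' := by
    rintro c f ⟨hf, hf', hf''⟩
    refine ⟨fun i x hx => Submodule.smul_mem _ c (hf i x hx), fun a x => ?_, fun a x => ?_⟩
    · simp [hf']
    · simp [hf'']

variable {P} in
theorem mem_Coch {t : ℤ} {n : ℕ} {f : P.X n →ₗ[k] Λ} : f ∈ P.Coch t n ↔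
    (∀ i, ∀ x ∈ P.gr n i, f x ∈ 𝒜 (i + t)) ∧
    (∀ a x, f (P.left n a x) = signTwist 𝒜 t a * f x) ∧
    (∀ a x, f (P.right n a x) = f x * a) := Iff.rfl

/-- The differential `f ↦ f ∘ d` of the complex `Hom^t_{Λ^e}(X, Λ)`. -/
def δ (t : ℤ) (n : ℕ) : P.Coch t n →ₗ[k] P.Coch t (n + 1) :=
  (LinearMap.lcomp k Λ (P.d n)).restrict <| by
    rintro f ⟨hf, hf', hf''⟩
    refine ⟨fun i x hx => hf i _ (P.d_mem n i x hx), fun a x => ?_, fun a x => ?_⟩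
    · simp [P.d_left, hf']
    · simp [P.d_right, hf'']

@[simp] theorem coe_δ (t : ℤ) (n : ℕ) (f : P.Coch t n) :
    (P.δ t n f : P.X (n + 1) →ₗ[k] Λ) = (f : P.X n →ₗ[k] Λ) ∘ₗ P.d n := rfl

/-- The cocycles of `Hom^t_{Λ^e}(X, Λ)`. -/
def cocycles (t : ℤ) (n : ℕ) : Submodule k (P.X n →ₗ[k] Λ) :=
  P.Coch t n ⊓ (LinearMap.lcomp k Λ (P.d n)).ker

variable {P} in
theorem mem_cocycles {t : ℤ} {n : ℕ} {f : P.X n →ₗ[k] Λ} :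
    f ∈ P.cocycles t n ↔ f ∈ P.Coch t n ∧ f ∘ₗ P.d n = 0 := Iff.rfl

/-- The coboundaries of `Hom^t_{Λ^e}(X, Λ)`. -/
def coboundaries (t : ℤ) : ∀ n : ℕ, Submodule k (P.X n →ₗ[k] Λ)
  | 0 => ⊥
  | n + 1 => (P.Coch t n).map (LinearMap.lcomp k Λ (P.d n))

/-- The cohomology `H^n(Hom^t_{Λ^e}(X, Λ))`. -/
abbrev Coh (n : ℕ) (t : ℤ) : Type (max v w) :=
  Subquotient (P.cocycles t n) (P.coboundaries t n)

/-- The cohomology class of a cocycle. -/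
def cls (n : ℕ) (t : ℤ) : P.cocycles t n →ₗ[k] P.Coh n t := Subquotient.mk _ _

section Maps

variable {P}
variable {Γ : Type*} [Ring Γ] [Algebra k Γ] {ℬ : ℤ → Submodule k Γ} [GradedAlgebra ℬ]
  {Q : BimoduleComplex ℬ} {t : ℤ}
  (F : ∀ n, P.Coch t n →ₗ[k] Q.Coch t n)
  (hF : ∀ n f, F (n + 1) (P.δ t n f) = Q.δ t n (F n f))

/-- The map induced on cocycles by a family of maps that commute with the differentials. -/
def cocycleMap (n : ℕ) : P.cocycles t n →ₗ[k] Q.cocycles t n where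
  toFun f := ⟨F n ⟨f, f.2.1⟩, (F n ⟨f, f.2.1⟩).2, by
    have h : P.δ t n ⟨f, f.2.1⟩ = 0 := Subtype.ext f.2.2
    have h' := hF n ⟨f, f.2.1⟩
    rw [h, map_zero] at h'
    exact (congrArg Subtype.val h').symm⟩
  map_add' f g := by
    have h := congrArg Subtype.val (map_add (F n) ⟨f, f.2.1⟩ ⟨g, g.2.1⟩)
    exact Subtype.ext h
  map_smul' c f := by
    have h := congrArg Subtype.val (map_smul (F n) c ⟨f, f.2.1⟩)
    exact Subtype.ext h

/-- The map induced in cohomology by a family of maps that commute with the differentials. -/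
def cohMap (n : ℕ) : P.Coh n t →ₗ[k] Q.Coh n t :=
  Subquotient.lift (Q.cls n t ∘ₗ cocycleMap F hF n) <| by
    rintro ⟨f, hf⟩ h
    refine Subquotient.mk_eq_zero.2 ?_
    cases n with
    | zero =>
      have : f = 0 := h
      subst this
      exact congrArg Subtype.val (map_zero (F 0))
    | succ n =>
      obtain ⟨g, hg, rfl⟩ : ∃ g ∈ P.Coch t n, g ∘ₗ P.d n = f := h
      exact ⟨F n ⟨g, hg⟩, (F n ⟨g, hg⟩).2, congrArg Subtype.val (hF n ⟨g, hg⟩).symm⟩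

theorem cohMap_cls (n : ℕ) (f : P.cocycles t n) :
    cohMap F hF n (P.cls n t f) = Q.cls n t (cocycleMap F hF n f) := rfl

end Maps

end BimoduleComplex

end Complexes

section Bar

variable (k : Type u) [Field k] (Λ : Type v) [Ring Λ] [Algebra k Λ]

/-- The `n`-th term `Λ^{⊗(n+2)}` of the bar resolution. -/
abbrev BarTerm (n : ℕ) : Type (max u v) := PiTensorProduct k (fun _ : Fin (n + 2) => Λ)

variable {k Λ}

/-- The tuple `(x_0, …, x_i x_{i+1}, …, x_n)`. -/
def contract {n : ℕ} (i : ℕ) (x : Fin (n + 1) → Λ) : Fin n → Λ := fun p =>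
  if (p : ℕ) < i then x p.castSucc
  else if (p : ℕ) = i then x p.castSucc * x p.succ
  else x p.succ

variable (k) in
theorem contract_update {n : ℕ} (i : Fin n) (x : Fin (n + 1) → Λ) (q : Fin (n + 1)) :
    ∃ (q' : Fin n) (L : Λ →ₗ[k] Λ), ∀ a,
      contract i (Function.update x q a) = Function.update (contract i x) q' (L a) := by
  obtain ⟨i, hi⟩ := i
  obtain ⟨q, hq⟩ := q
  rcases lt_trichotomy q i with h | h | h
  · refine ⟨⟨q, by omega⟩, LinearMap.id, fun a => ?_⟩
    ext ⟨p, hp⟩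
    simp only [contract, Function.update_apply, Fin.ext_iff, Fin.val_castSucc, Fin.val_succ,
      LinearMap.id_apply]
    split_ifs <;> first | rfl | omega
  · subst h
    refine ⟨⟨q, hi⟩, LinearMap.mulRight k (x ⟨q + 1, by omega⟩), fun a => ?_⟩
    ext ⟨p, hp⟩
    simp only [contract, Function.update_apply, Fin.ext_iff, Fin.val_castSucc, Fin.val_succ,
      LinearMap.mulRight_apply]
    split_ifs <;> first | rfl | omega | (subst_vars; rfl)
  · by_cases h' : q = i + 1
    · subst h'
      refine ⟨⟨i, hi⟩, LinearMap.mulLeft k (x ⟨i, by omega⟩), fun a => ?_⟩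
      ext ⟨p, hp⟩
      simp only [contract, Function.update_apply, Fin.ext_iff, Fin.val_castSucc, Fin.val_succ,
        LinearMap.mulLeft_apply]
      split_ifs <;> first | rfl | omega | (subst_vars; rfl)
    · refine ⟨⟨q - 1, by omega⟩, LinearMap.id, fun a => ?_⟩
      ext ⟨p, hp⟩
      simp only [contract, Function.update_apply, Fin.ext_iff, Fin.val_castSucc, Fin.val_succ,
        LinearMap.id_apply]
      split_ifs <;> first | rfl | omega

variable (k Λ) in
/-- The multilinear map `x ↦ x_0 ⊗ ⋯ ⊗ x_i x_{i+1} ⊗ ⋯ ⊗ x_{n+2}`. -/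
def contractTensor (n : ℕ) (i : Fin (n + 2)) :
    MultilinearMap k (fun _ : Fin (n + 3) => Λ) (BarTerm k Λ n) :=
  MultilinearMap.mk' (fun x => PiTensorProduct.tprod k (contract i x))
    (fun x q a b => by
      obtain ⟨q', L, h⟩ := contract_update k i x q
      rw [h, h, h, map_add, MultilinearMap.map_update_add])
    (fun x q c a => by
      obtain ⟨q', L, h⟩ := contract_update k i x q
      rw [h, h, map_smul, MultilinearMap.map_update_smul])

variable (k Λ) in
/-- The differential of the bar resolution,
`(x_0, …, x_{n+2}) ↦ ∑ i, (-1)^i (x_0, …, x_i x_{i+1}, …, x_{n+2})`. -/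
def barD (n : ℕ) : BarTerm k Λ (n + 1) →ₗ[k] BarTerm k Λ n :=
  ∑ i : Fin (n + 2), (-1 : k) ^ (i : ℕ) • PiTensorProduct.lift (contractTensor k Λ n i)

theorem barD_tprod (n : ℕ) (x : Fin (n + 3) → Λ) : barD k Λ n (PiTensorProduct.tprod k x) =
    ∑ i ∈ Finset.range (n + 2), (-1 : k) ^ i • PiTensorProduct.tprod k (contract i x) := by
  rw [← Fin.sum_univ_eq_sum_range (fun i : ℕ => (-1 : k) ^ i • PiTensorProduct.tprod k
    (contract (n := n + 2) i x)), barD, LinearMap.sum_apply]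
  refine Finset.sum_congr rfl fun i _ => ?_
  rw [LinearMap.smul_apply, PiTensorProduct.lift.tprod]
  rfl

variable (k Λ) in
/-- Left multiplication on the bar resolution, `a (x_0, …, x_{n+1}) = (a x_0, …, x_{n+1})`. -/
def barLeft (n : ℕ) : Λ →ₗ[k] Module.End k (BarTerm k Λ n) :=
  (PiTensorProduct.mapMultilinear k (fun _ : Fin (n + 2) => Λ) (fun _ => Λ)).toLinearMap
    (fun _ => LinearMap.id) 0 ∘ₗ LinearMap.mul k Λ

variable (k Λ) in
/-- Right multiplication on the bar resolution, `(x_0, …, x_{n+1}) a = (x_0, …, x_{n+1} a)`. -/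
def barRight (n : ℕ) : Λ →ₗ[k] Module.End k (BarTerm k Λ n) :=
  (PiTensorProduct.mapMultilinear k (fun _ : Fin (n + 2) => Λ) (fun _ => Λ)).toLinearMap
    (fun _ => LinearMap.id) (Fin.last (n + 1)) ∘ₗ (LinearMap.mul k Λ).flip

theorem barLeft_tprod (n : ℕ) (a : Λ) (x : Fin (n + 2) → Λ) :
    barLeft k Λ n a (PiTensorProduct.tprod k x) =
      PiTensorProduct.tprod k (Function.update x 0 (a * x 0)) := by
  rw [barLeft, LinearMap.comp_apply, MultilinearMap.toLinearMap_apply,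
    PiTensorProduct.mapMultilinear_apply, PiTensorProduct.map_tprod]
  congr 1
  ext p
  by_cases h : p = 0
  · subst h; simp
  · simp [h]

theorem barRight_tprod (n : ℕ) (a : Λ) (x : Fin (n + 2) → Λ) :
    barRight k Λ n a (PiTensorProduct.tprod k x) =
      PiTensorProduct.tprod k
        (Function.update x (Fin.last (n + 1)) (x (Fin.last (n + 1)) * a)) := by
  rw [barRight, LinearMap.comp_apply, MultilinearMap.toLinearMap_apply,
    PiTensorProduct.mapMultilinear_apply, PiTensorProduct.map_tprod]
  congr 1
  ext p
  by_cases h : p = Fin.last (n + 1)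
  · subst h; simp
  · simp [h]

/-- The elements of degree `i` in `Λ^{⊗(n+2)}`: the span of the tensors of homogeneous elements
whose degrees add up to `i`. -/
def barGrading (𝒜 : ℤ → Submodule k Λ) (n : ℕ) (i : ℤ) : Submodule k (BarTerm k Λ n) :=
  Submodule.span k {z | ∃ (e : Fin (n + 2) → ℤ) (x : Fin (n + 2) → Λ),
    (∀ p, x p ∈ 𝒜 (e p)) ∧ ∑ p, e p = i ∧ PiTensorProduct.tprod k x = z}

/-- To check a linear condition on an element of degree `i` of the bar resolution, it suffices
to consider tensors of homogeneous elements. -/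
theorem barGrading_map {𝒜 : ℤ → Submodule k Λ} {n : ℕ} {i : ℤ} {M : Type*} [AddCommGroup M]
    [Module k M] (f : BarTerm k Λ n →ₗ[k] M) (N : Submodule k M)
    (h : ∀ (e : Fin (n + 2) → ℤ) (x : Fin (n + 2) → Λ), (∀ p, x p ∈ 𝒜 (e p)) → ∑ p, e p = i →
      f (PiTensorProduct.tprod k x) ∈ N) : ∀ z ∈ barGrading 𝒜 n i, f z ∈ N := by
  have : barGrading 𝒜 n i ≤ N.comap f := by
    rw [barGrading, Submodule.span_le]
    rintro _ ⟨e, x, hx, he, rfl⟩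
    exact h e x hx he
  exact this

theorem tprod_mem_barGrading {𝒜 : ℤ → Submodule k Λ} {n : ℕ} {i : ℤ} {e : Fin (n + 2) → ℤ}
    {x : Fin (n + 2) → Λ} (hx : ∀ p, x p ∈ 𝒜 (e p)) (he : ∑ p, e p = i) :
    PiTensorProduct.tprod k x ∈ barGrading 𝒜 n i :=
  Submodule.subset_span ⟨e, x, hx, he, rfl⟩

theorem contract_left {n : ℕ} (i : ℕ) (a : Λ) (x : Fin (n + 3) → Λ) :
    contract i (Function.update x 0 (a * x 0)) =
      Function.update (contract i x) 0 (a * contract i x 0) := by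
  ext ⟨p, hp⟩
  simp only [contract, Function.update_apply, Fin.ext_iff, Fin.val_castSucc, Fin.val_succ,
    Fin.val_zero]
  rcases Nat.eq_zero_or_pos p with rfl | h
  · by_cases h0 : i = 0
    · subst h0; simp [mul_assoc]
    · have : 0 < i := by omega
      simp [this]
  · simp [h.ne']

theorem contract_right {n : ℕ} (i : ℕ) (hi : i < n + 2) (a : Λ) (x : Fin (n + 3) → Λ) :
    contract i (Function.update x (Fin.last (n + 2)) (x (Fin.last (n + 2)) * a)) =
      Function.update (contract i x) (Fin.last (n + 1))
        (contract i x (Fin.last (n + 1)) * a) := by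
  ext ⟨p, hp⟩
  simp only [contract, Function.update_apply, Fin.ext_iff, Fin.val_castSucc, Fin.val_succ,
    Fin.val_last]
  by_cases h : p = n + 1
  · subst h
    have h1 : ¬ (n + 1 < i) := by omega
    simp only [h1, if_false, Fin.succ_last]
    by_cases h2 : i = n + 1
    · subst h2
      simp only [if_true, if_neg (show n + 1 ≠ n + 2 by omega)]
      exact (mul_assoc _ _ _).symm
    · simp [Ne.symm h2]
  · have h3 : p ≠ n + 2 := by omega
    simp [h, h3]

theorem contract_contract {n : ℕ} {i j : ℕ} (h : i ≤ j) (x : Fin (n + 2) → Λ) :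
    contract j (contract i x) = contract i (contract (j + 1) x) := by
  ext ⟨p, hp⟩
  simp only [contract, Fin.val_castSucc, Fin.val_succ]
  split_ifs <;> first | rfl | omega | simp [mul_assoc]

theorem sum_range_eq_zero {M : Type*} [AddCommGroup M] [Module k M] (N : ℕ) (F : ℕ → ℕ → M)
    (hF : ∀ i j, i ≤ j → F i j = F (j + 1) i) :
    ∑ i ∈ Finset.range (N + 1), ∑ j ∈ Finset.range N, (-1 : k) ^ i • (-1 : k) ^ j • F i j = 0 := by
  rw [← Finset.sum_product']
  refine Finset.sum_involution
    (fun p _ => if p.1 ≤ p.2 then (p.2 + 1, p.1) else (p.2, p.1 - 1)) ?_ ?_ ?_ ?_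
  · rintro ⟨i, j⟩ -
    simp only
    split_ifs with h
    · rw [hF i j h, smul_smul, smul_smul, ← add_smul]
      simp [pow_succ, mul_comm]
    · obtain ⟨i, rfl⟩ : ∃ i', i = i' + 1 := ⟨i - 1, by omega⟩
      rw [← hF j i (by omega)]
      simp only [Nat.add_sub_cancel]
      rw [smul_smul, smul_smul, ← add_smul]
      simp [pow_succ, mul_comm]
  · rintro ⟨i, j⟩ - -
    simp only
    split_ifs <;> simp [Prod.ext_iff] <;> omega
  · rintro ⟨i, j⟩ h
    simp only [Finset.mem_product, Finset.mem_range] at *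
    split_ifs <;> simp <;> omega
  · rintro ⟨i, j⟩ -
    simp only
    split_ifs <;> simp_all <;> omega

theorem contract_mem {𝒜 : ℤ → Submodule k Λ} [GradedAlgebra 𝒜] {n : ℕ} (i : ℕ) (hi : i < n)
    {e : Fin (n + 1) → ℤ} {x : Fin (n + 1) → Λ} (hx : ∀ p, x p ∈ 𝒜 (e p)) :
    ∃ e' : Fin n → ℤ, (∀ p, contract i x p ∈ 𝒜 (e' p)) ∧ ∑ p, e' p = ∑ p, e p := by
  refine ⟨fun p => (if (p : ℕ) ≤ i then e p.castSucc else 0) +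
    (if i ≤ (p : ℕ) then e p.succ else 0), fun p => ?_, ?_⟩
  · simp only [contract]
    split_ifs <;> first | omega | skip
    · exact SetLike.GradedMul.mul_mem (hx p.castSucc) (hx p.succ)
    · simpa using hx p.castSucc
    · simpa using hx p.succ
  · rw [Finset.sum_add_distrib]
    have h1 := Fin.sum_univ_castSucc (fun p : Fin (n + 1) => if (p : ℕ) ≤ i then e p else 0)
    have h2 := Fin.sum_univ_succ (fun p : Fin (n + 1) => if i < (p : ℕ) then e p else 0)
    simp only [Fin.val_castSucc, Fin.val_last, Fin.val_zero, Fin.val_succ, Nat.lt_succ_iff,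
      not_lt_zero, if_false, zero_add, if_neg (not_le.2 hi), add_zero] at h1 h2
    rw [← h1, ← h2, ← Finset.sum_add_distrib]
    refine Finset.sum_congr rfl fun p _ => ?_
    split_ifs <;> omega

/-- The graded bar resolution of a graded algebra. -/
def bar (𝒜 : ℤ → Submodule k Λ) [GradedAlgebra 𝒜] : BimoduleComplex.{u, v, max u v} 𝒜 where
  X n := BarTerm k Λ n
  gr n i := barGrading 𝒜 n i
  left n := barLeft k Λ n
  right n := barRight k Λ n
  d n := barD k Λ n
  left_one n x := by
    suffices barLeft k Λ n 1 = LinearMap.id from LinearMap.congr_fun this x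
    ext x
    simp [barLeft_tprod]
  left_mul n a b x := by
    suffices barLeft k Λ n (a * b) = barLeft k Λ n a ∘ₗ barLeft k Λ n b from
      LinearMap.congr_fun this x
    ext x
    simp [barLeft_tprod, mul_assoc]
  right_one n x := by
    suffices barRight k Λ n 1 = LinearMap.id from LinearMap.congr_fun this x
    ext x
    simp [barRight_tprod]
  right_mul n a b x := by
    suffices barRight k Λ n (a * b) = barRight k Λ n b ∘ₗ barRight k Λ n a from
      LinearMap.congr_fun this x
    ext x
    simp [barRight_tprod, mul_assoc]
  left_right n a b x := by
    suffices barLeft k Λ n a ∘ₗ barRight k Λ n b = barRight k Λ n b ∘ₗ barLeft k Λ n a from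
      LinearMap.congr_fun this x
    ext x
    have h : (0 : Fin (n + 2)) ≠ Fin.last (n + 1) := (Fin.last_pos).ne
    simp only [LinearMap.compMultilinearMap_apply, LinearMap.comp_apply, barLeft_tprod,
      barRight_tprod, Function.update_of_ne h, Function.update_of_ne h.symm]
    rw [Function.update_comm h]
  left_mem n i j a ha := by
    refine barGrading_map (barLeft k Λ n a) _ fun e x hx he => ?_
    rw [barLeft_tprod]
    refine tprod_mem_barGrading (e := Function.update e 0 (i + e 0)) (fun p => ?_) ?_
    · by_cases h : p = 0
      · subst h; simpa using SetLike.GradedMul.mul_mem ha (hx 0)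
      · simpa [h] using hx p
    · rw [Fin.sum_univ_succ] at he ⊢
      simp [← he, add_assoc]
  right_mem n i j a ha := by
    refine barGrading_map (barRight k Λ n a) _ fun e x hx he => ?_
    rw [barRight_tprod]
    refine tprod_mem_barGrading
      (e := Function.update e (Fin.last (n + 1)) (e (Fin.last (n + 1)) + i)) (fun p => ?_) ?_
    · by_cases h : p = Fin.last (n + 1)
      · subst h; simpa using SetLike.GradedMul.mul_mem (hx (Fin.last (n + 1))) ha
      · simpa [h] using hx p
    · rw [Fin.sum_univ_castSucc] at he ⊢
      simp [← he, add_assoc]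
  d_left n a x := by
    suffices barD k Λ n ∘ₗ barLeft k Λ (n + 1) a = barLeft k Λ n a ∘ₗ barD k Λ n from
      LinearMap.congr_fun this x
    ext x
    simp only [LinearMap.compMultilinearMap_apply, LinearMap.comp_apply, barLeft_tprod,
      barD_tprod, map_sum, map_smul]
    exact Finset.sum_congr rfl fun i _ => by rw [contract_left]
  d_right n a x := by
    suffices barD k Λ n ∘ₗ barRight k Λ (n + 1) a = barRight k Λ n a ∘ₗ barD k Λ n from
      LinearMap.congr_fun this x
    ext x
    simp only [LinearMap.compMultilinearMap_apply, LinearMap.comp_apply, barRight_tprod,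
      barD_tprod, map_sum, map_smul]
    exact Finset.sum_congr rfl fun i hi => by rw [contract_right i (Finset.mem_range.1 hi)]
  d_mem n i := by
    refine barGrading_map (barD k Λ n) _ fun e x hx he => ?_
    rw [barD_tprod]
    refine sum_mem fun j hj => Submodule.smul_mem _ _ ?_
    obtain ⟨e', hx', he'⟩ := contract_mem j (Finset.mem_range.1 hj) hx
    exact tprod_mem_barGrading hx' (he'.trans he)
  d_d n x := by
    suffices barD k Λ n ∘ₗ barD k Λ (n + 1) = 0 from LinearMap.congr_fun this x
    ext x
    simp only [LinearMap.compMultilinearMap_apply, LinearMap.comp_apply, barD_tprod, map_sum,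
      map_smul, LinearMap.zero_apply]
    simp only [Finset.smul_sum]
    exact sum_range_eq_zero (n + 2)
      (fun i j => PiTensorProduct.tprod k (contract (n := n + 2) j (contract i x)))
      fun i j h => by rw [contract_contract h]

/-- The bigraded Hochschild cohomology `HH^{s,t}(Λ) = H^s(Hom^t_{Λ^e}(𝔹(Λ), Λ))` of a graded
algebra over a field. -/
abbrev HH (𝒜 : ℤ → Submodule k Λ) [GradedAlgebra 𝒜] (s : ℕ) (t : ℤ) : Type (max u v) :=
  (bar 𝒜).Coh s t

end Bar

section Cup

variable {k : Type u} [Field k] {Λ : Type v} [Ring Λ] [Algebra k Λ]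
variable (𝒜 : ℤ → Submodule k Λ) [GradedAlgebra 𝒜]

/-- The tuple `(±x_0, …, ±x_m, 1)` formed from the first entries of `x_0, …, x_{N+1}`; the signs
multiply to `(-1)^(j * (|x_0| + ⋯ + |x_m|))`. -/
def firstBlock (j : ℤ) {N : ℕ} (m : ℕ) (hm : m ≤ N) (x : Fin (N + 2) → Λ) : Fin (m + 2) → Λ :=
  fun p => if h : (p : ℕ) ≤ m then signTwist 𝒜 j (x ⟨p, by omega⟩) else 1

/-- The tuple `(1, x_{m+1}, …, x_{m+n+1})` formed from the last entries of `x_0, …, x_{N+1}`. -/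
def lastBlock {N : ℕ} (m n : ℕ) (h : m + n = N) (x : Fin (N + 2) → Λ) : Fin (n + 2) → Λ :=
  fun p => if (p : ℕ) = 0 then 1 else x ⟨m + p, by omega⟩

theorem firstBlock_update_le (j : ℤ) {N : ℕ} (m : ℕ) (hm : m ≤ N) (x : Fin (N + 2) → Λ)
    (q : Fin (N + 2)) (hq : (q : ℕ) ≤ m) (a : Λ) :
    firstBlock 𝒜 j m hm (Function.update x q a) =
      Function.update (firstBlock 𝒜 j m hm x) ⟨q, by omega⟩ (signTwist 𝒜 j a) := by
  ext ⟨p, hp⟩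
  simp only [firstBlock, Function.update_apply, Fin.ext_iff]
  split_ifs <;> first | rfl | omega

theorem firstBlock_update_gt (j : ℤ) {N : ℕ} (m : ℕ) (hm : m ≤ N) (x : Fin (N + 2) → Λ)
    (q : Fin (N + 2)) (hq : m < (q : ℕ)) (a : Λ) :
    firstBlock 𝒜 j m hm (Function.update x q a) = firstBlock 𝒜 j m hm x := by
  ext ⟨p, hp⟩
  simp only [firstBlock, Function.update_apply, Fin.ext_iff]
  split_ifs <;> first | rfl | omega

theorem lastBlock_update_le {N : ℕ} (m n : ℕ) (h : m + n = N) (x : Fin (N + 2) → Λ)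
    (q : Fin (N + 2)) (hq : (q : ℕ) ≤ m) (a : Λ) :
    lastBlock m n h (Function.update x q a) = lastBlock m n h x := by
  ext ⟨p, hp⟩
  simp only [lastBlock, Function.update_apply, Fin.ext_iff]
  split_ifs <;> first | rfl | omega

theorem lastBlock_update_gt {N : ℕ} (m n : ℕ) (h : m + n = N) (x : Fin (N + 2) → Λ)
    (q : Fin (N + 2)) (hq : m < (q : ℕ)) (a : Λ) :
    lastBlock m n h (Function.update x q a) =
      Function.update (lastBlock m n h x) ⟨q - m, by omega⟩ a := by
  ext ⟨p, hp⟩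
  simp only [lastBlock, Function.update_apply, Fin.ext_iff]
  split_ifs <;> first | rfl | omega

/-- The multilinear map underlying the cup product of two cochains. -/
def cupMultilinear (j : ℤ) {m n N : ℕ} (h : m + n = N) (f : BarTerm k Λ m →ₗ[k] Λ)
    (g : BarTerm k Λ n →ₗ[k] Λ) : MultilinearMap k (fun _ : Fin (N + 2) => Λ) Λ :=
  MultilinearMap.mk'
    (fun x => f (PiTensorProduct.tprod k (firstBlock 𝒜 j m (by omega) x)) *
      g (PiTensorProduct.tprod k (lastBlock m n h x)))
    (fun x q a b => by
      rcases le_or_gt (q : ℕ) m with hq | hq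
      · simp only [firstBlock_update_le 𝒜 j m _ x q hq, lastBlock_update_le m n h x q hq,
          map_add, MultilinearMap.map_update_add, add_mul]
      · simp only [firstBlock_update_gt 𝒜 j m _ x q hq, lastBlock_update_gt m n h x q hq,
          map_add, MultilinearMap.map_update_add, mul_add])
    (fun x q c a => by
      rcases le_or_gt (q : ℕ) m with hq | hq
      · simp only [firstBlock_update_le 𝒜 j m _ x q hq, lastBlock_update_le m n h x q hq,
          map_smul, MultilinearMap.map_update_smul, smul_mul_assoc]
      · simp only [firstBlock_update_gt 𝒜 j m _ x q hq, lastBlock_update_gt m n h x q hq,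
          map_smul, MultilinearMap.map_update_smul, mul_smul_comm])

/-- The cup product of a cochain `f` of bidegree `(m, i)` and a cochain `g` of bidegree `(n, j)`,
`(f ∪ g)(x_0, …, x_{m+n+1}) =
  (-1)^(j * (|x_0| + ⋯ + |x_m|)) f(x_0, …, x_m, 1) g(1, x_{m+1}, …, x_{m+n+1})`. -/
def cupCochain (j : ℤ) {m n N : ℕ} (h : m + n = N) :
    (BarTerm k Λ m →ₗ[k] Λ) →ₗ[k] (BarTerm k Λ n →ₗ[k] Λ) →ₗ[k] (BarTerm k Λ N →ₗ[k] Λ) :=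
  LinearMap.mk₂ k (fun f g => PiTensorProduct.lift (cupMultilinear 𝒜 j h f g))
    (fun f f' g => by ext x; simp [cupMultilinear, add_mul])
    (fun c f g => by ext x; simp [cupMultilinear])
    (fun f g g' => by ext x; simp [cupMultilinear, mul_add])
    (fun c f g => by ext x; simp [cupMultilinear])

theorem cupCochain_tprod (j : ℤ) {m n N : ℕ} (h : m + n = N) (f : BarTerm k Λ m →ₗ[k] Λ)
    (g : BarTerm k Λ n →ₗ[k] Λ) (x : Fin (N + 2) → Λ) :
    cupCochain 𝒜 j h f g (PiTensorProduct.tprod k x) =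
      f (PiTensorProduct.tprod k (firstBlock 𝒜 j m (by omega) x)) *
      g (PiTensorProduct.tprod k (lastBlock m n h x)) := by
  rw [cupCochain, LinearMap.mk₂_apply, PiTensorProduct.lift.tprod]
  rfl

theorem cupCochain_mem {i j : ℤ} {m n N : ℕ} (h : m + n = N) {f : BarTerm k Λ m →ₗ[k] Λ}
    (hf : f ∈ (bar 𝒜).Coch i m) {g : BarTerm k Λ n →ₗ[k] Λ} (hg : g ∈ (bar 𝒜).Coch j n) :
    cupCochain 𝒜 j h f g ∈ (bar 𝒜).Coch (i + j) N := by
  obtain ⟨hf1, hf2, -⟩ := hf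
  obtain ⟨hg1, -, hg3⟩ := hg
  refine ⟨fun s => ?_, fun a x => ?_, fun a x => ?_⟩
  · refine barGrading_map (cupCochain 𝒜 j h f g) _ fun e x hx he => ?_
    rw [cupCochain_tprod]
    have h1 : PiTensorProduct.tprod k (firstBlock 𝒜 j m (by omega) x) ∈
        barGrading 𝒜 m (∑ p : Fin (m + 2), if hp : (p : ℕ) ≤ m then e ⟨p, by omega⟩ else 0) := by
      refine tprod_mem_barGrading (fun p => ?_) rfl
      rw [firstBlock]
      split_ifs with hp
      · exact signTwist_mem 𝒜 j (hx _)
      · exact SetLike.GradedOne.one_mem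
    have h2 : PiTensorProduct.tprod k (lastBlock m n h x) ∈
        barGrading 𝒜 n (∑ p : Fin (n + 2), if (p : ℕ) = 0 then 0 else e ⟨m + p, by omega⟩) := by
      refine tprod_mem_barGrading (fun p => ?_) rfl
      rw [lastBlock]
      split_ifs with hp
      · exact SetLike.GradedOne.one_mem
      · exact hx _
    have h3 := SetLike.GradedMul.mul_mem (hf1 _ _ h1) (hg1 _ _ h2)
    suffices h7 : s + (i + j) =
        (∑ p : Fin (m + 2), if hp : (p : ℕ) ≤ m then e ⟨p, by omega⟩ else 0) + i +
        ((∑ p : Fin (n + 2), if (p : ℕ) = 0 then 0 else e ⟨m + p, by omega⟩) + j) by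
      rw [h7]; exact h3
    subst h
    rw [← he, Fin.sum_univ_castSucc (n := m + 1), Fin.sum_univ_succ (n := n + 1)]
    have h4 : ∑ p : Fin (m + n + 2), e p =
        (∑ p : Fin (m + 1), e ⟨p, by omega⟩) + ∑ p : Fin (n + 1), e ⟨m + 1 + p, by omega⟩ := by
      rw [← Equiv.sum_comp (finCongr (show (m + 1) + (n + 1) = m + n + 2 by omega)),
        Fin.sum_univ_add]
      rfl
    have h5 : ∀ p : Fin (m + 1), (p : ℕ) ≤ m := fun p => by omega
    simp only [Fin.val_castSucc, h5, dif_pos, Fin.val_last, Fin.val_succ, Fin.val_zero, if_true,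
      Nat.add_eq_zero_iff, one_ne_zero, and_false, if_false, zero_add]
    rw [dif_neg (by omega), h4]
    have h6 : ∀ p : Fin (n + 1), m + 1 + (p : ℕ) = m + ((p : ℕ) + 1) := fun p => by omega
    simp only [h6]
    ring
  · suffices cupCochain 𝒜 j h f g ∘ₗ barLeft k Λ N a =
        LinearMap.mulLeft k (signTwist 𝒜 (i + j) a) ∘ₗ cupCochain 𝒜 j h f g from
      LinearMap.congr_fun this x
    ext x
    simp only [LinearMap.compMultilinearMap_apply, LinearMap.comp_apply, barLeft_tprod,
      cupCochain_tprod, LinearMap.mulLeft_apply]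
    rw [firstBlock_update_le 𝒜 j m _ x 0 (by simp), lastBlock_update_le m n h x 0 (by simp),
      signTwist_mul, ← mul_assoc, signTwist_add]
    congr 1
    refine Eq.trans (congrArg f ?_) (hf2 _ _)
    exact (barLeft_tprod _ _ _).symm
  · suffices cupCochain 𝒜 j h f g ∘ₗ barRight k Λ N a =
        LinearMap.mulRight k a ∘ₗ cupCochain 𝒜 j h f g from
      LinearMap.congr_fun this x
    ext x
    simp only [LinearMap.compMultilinearMap_apply, LinearMap.comp_apply, barRight_tprod,
      cupCochain_tprod, LinearMap.mulRight_apply]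
    rw [firstBlock_update_gt 𝒜 j m _ x _ (by simp; omega),
      lastBlock_update_gt m n h x _ (by simp; omega), mul_assoc]
    congr 1
    refine Eq.trans (congrArg g ?_) (hg3 _ _)
    refine Eq.trans ?_ (barRight_tprod _ _ _).symm
    congr 1
    have h1 : (⟨(Fin.last (N + 1) : ℕ) - m, by simp; omega⟩ : Fin (n + 2)) = Fin.last (n + 1) := by
      ext; simp; omega
    rw [h1]
    congr 2
    rw [lastBlock, if_neg (by simp)]
    congr 1
    ext; simp; omega

theorem cupCochain_d {i j : ℤ} {m n N : ℕ} (h : m + n = N) {f : BarTerm k Λ m →ₗ[k] Λ}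
    (hf : f ∈ (bar 𝒜).Coch i m) {g : BarTerm k Λ n →ₗ[k] Λ} (hg : g ∈ (bar 𝒜).Coch j n) :
    cupCochain 𝒜 j h f g ∘ₗ barD k Λ N =
      cupCochain 𝒜 j (show m + 1 + n = N + 1 by omega) (f ∘ₗ barD k Λ m) g +
      (-1 : k) ^ m • cupCochain 𝒜 j (show m + (n + 1) = N + 1 by omega) f (g ∘ₗ barD k Λ n) := by
  obtain ⟨-, -, hf3⟩ := hf
  obtain ⟨-, hg2, -⟩ := hg
  ext x
  simp only [LinearMap.compMultilinearMap_apply, LinearMap.comp_apply, LinearMap.add_apply,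
    LinearMap.smul_apply, barD_tprod, cupCochain_tprod, map_sum, map_smul]
  have hfirst : ∀ t ∈ Finset.range (m + 1), firstBlock 𝒜 j m (by omega) (contract t x) =
      contract t (firstBlock 𝒜 j (m + 1) (by omega) x) := by
    intro t ht
    rw [Finset.mem_range] at ht
    ext ⟨p, hp⟩
    simp only [firstBlock, contract, Fin.val_castSucc, Fin.val_succ]
    split_ifs <;> first | omega | skip
    all_goals first | rfl | (rw [signTwist_mul]; rfl)
  have hlast : ∀ t ∈ Finset.range (m + 1), lastBlock m n h (contract t x) =
      lastBlock (m + 1) n (by omega) x := by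
    intro t ht
    rw [Finset.mem_range] at ht
    ext ⟨p, hp⟩
    simp only [lastBlock, contract]
    split_ifs <;> first | omega | skip
    all_goals first | rfl | exact congrArg x (Fin.ext (by simp; omega))
  have hfirst' : ∀ t ∈ Finset.range (n + 1), firstBlock 𝒜 j m (by omega)
      (contract (m + 1 + t) x) = firstBlock 𝒜 j m (by omega) x := by
    intro t ht
    ext ⟨p, hp⟩
    simp only [firstBlock, contract]
    split_ifs <;> first | omega | contradiction | rfl
  have hlast' : ∀ t ∈ Finset.range (n + 1), lastBlock m n h (contract (m + 1 + t) x) =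
      contract (t + 1) (lastBlock m (n + 1) (by omega) x) := by
    intro t ht
    ext ⟨p, hp⟩
    simp only [lastBlock, contract, Fin.val_castSucc, Fin.val_succ]
    split_ifs <;> first | omega | contradiction | rfl
  have hmid1 : contract (m + 1) (firstBlock 𝒜 j (m + 1) (by omega : m + 1 ≤ N + 1) x) =
      Function.update (firstBlock 𝒜 j m (by omega : m ≤ N + 1) x) (Fin.last (m + 1))
        (firstBlock 𝒜 j m (by omega : m ≤ N + 1) x (Fin.last (m + 1)) *
          signTwist 𝒜 j (x ⟨m + 1, by omega⟩)) := by
    ext ⟨p, hp⟩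
    simp only [firstBlock, contract, Fin.val_castSucc, Fin.val_succ, Function.update_apply,
      Fin.ext_iff, Fin.val_last]
    split_ifs <;> first | omega | skip
    all_goals first | rfl | (subst_vars; simp)
  have hmid2 : contract 0 (lastBlock m (n + 1) (by omega : m + (n + 1) = N + 1) x) =
      Function.update (lastBlock (m + 1) n (by omega : m + 1 + n = N + 1) x) 0
        (x ⟨m + 1, by omega⟩ * lastBlock (m + 1) n (by omega : m + 1 + n = N + 1) x 0) := by
    ext ⟨p, hp⟩
    simp only [lastBlock, contract, Fin.val_castSucc, Fin.val_succ, Function.update_apply,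
      Fin.ext_iff, Fin.val_zero]
    split_ifs <;> first | omega | skip
    all_goals first | contradiction | (subst_vars; simp) | exact congrArg x (Fin.ext (by simp; omega))
  have hA : f (PiTensorProduct.tprod k (contract (m + 1)
        (firstBlock 𝒜 j (m + 1) (by omega : m + 1 ≤ N + 1) x))) =
      f (PiTensorProduct.tprod k (firstBlock 𝒜 j m (by omega : m ≤ N + 1) x)) *
        signTwist 𝒜 j (x ⟨m + 1, by omega⟩) := by
    rw [hmid1, ← barRight_tprod]
    exact hf3 _ _
  have hB : g (PiTensorProduct.tprod k (contract 0
        (lastBlock m (n + 1) (by omega : m + (n + 1) = N + 1) x))) =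
      signTwist 𝒜 j (x ⟨m + 1, by omega⟩) *
        g (PiTensorProduct.tprod k (lastBlock (m + 1) n (by omega : m + 1 + n = N + 1) x)) := by
    rw [hmid2, ← barLeft_tprod]
    exact hg2 _ _
  have hN : ∀ F : ℕ → Λ, ∑ t ∈ Finset.range (N + 2), F t =
      ∑ t ∈ Finset.range (m + 1), F t + ∑ t ∈ Finset.range (n + 1), F (m + 1 + t) := fun F => by
    rw [← Finset.sum_range_add, show N + 2 = (m + 1) + (n + 1) by omega]
  rw [hN, Finset.sum_range_succ _ (m + 1), Finset.sum_range_succ' _ (n + 1),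
    hA, hB]
  rw [Finset.sum_congr rfl fun t ht => by rw [hfirst t ht, hlast t ht],
    Finset.sum_congr (s₁ := Finset.range (n + 1)) rfl fun t ht => by rw [hfirst' t ht, hlast' t ht]]
  rw [add_mul, mul_add, Finset.sum_mul, Finset.mul_sum, smul_add, Finset.smul_sum]
  simp only [smul_mul_assoc, mul_smul_comm, smul_smul, pow_zero, one_smul, mul_assoc]
  have hpow : ∀ t : ℕ, (-1 : k) ^ m * (-1) ^ (t + 1) = (-1) ^ (m + 1 + t) := fun t => by ring
  simp only [hpow, pow_succ (-1 : k) m]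
  simp only [mul_neg, mul_one, neg_smul]
  abel

end Cup

section CupCohomology

variable {k : Type u} [Field k] {Λ : Type v} [Ring Λ] [Algebra k Λ]
variable (𝒜 : ℤ → Submodule k Λ) [GradedAlgebra 𝒜]

variable {𝒜} in
theorem cupCochain_d_zero {i j : ℤ} {m n N : ℕ} (h : m + n = N) {f : BarTerm k Λ m →ₗ[k] Λ}
    (hf : f ∈ (bar 𝒜).Coch i m) (hf0 : f ∘ₗ barD k Λ m = 0) {g : BarTerm k Λ n →ₗ[k] Λ}
    (hg : g ∈ (bar 𝒜).Coch j n) (hg0 : g ∘ₗ barD k Λ n = 0) :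
    cupCochain 𝒜 j h f g ∘ₗ barD k Λ N = 0 := by
  rw [cupCochain_d 𝒜 h hf hg, hf0, hg0, map_zero, map_zero, LinearMap.zero_apply, smul_zero,
    add_zero]

variable {𝒜} in
theorem cupCochain_d_left {i j : ℤ} {m n N : ℕ} (h : m + n = N) {f : BarTerm k Λ m →ₗ[k] Λ}
    (hf : f ∈ (bar 𝒜).Coch i m) {g : BarTerm k Λ n →ₗ[k] Λ}
    (hg : g ∈ (bar 𝒜).Coch j n) (hg0 : g ∘ₗ barD k Λ n = 0) :
    cupCochain 𝒜 j h f g ∘ₗ barD k Λ N =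
      cupCochain 𝒜 j (show m + 1 + n = N + 1 by omega) (f ∘ₗ barD k Λ m) g := by
  rw [cupCochain_d 𝒜 h hf hg, hg0, map_zero, smul_zero, add_zero]

variable {𝒜} in
theorem cupCochain_d_right {i j : ℤ} {m n N : ℕ} (h : m + n = N) {f : BarTerm k Λ m →ₗ[k] Λ}
    (hf : f ∈ (bar 𝒜).Coch i m) (hf0 : f ∘ₗ barD k Λ m = 0) {g : BarTerm k Λ n →ₗ[k] Λ}
    (hg : g ∈ (bar 𝒜).Coch j n) :
    ((-1 : k) ^ m • cupCochain 𝒜 j h f g) ∘ₗ barD k Λ N =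
      cupCochain 𝒜 j (show m + (n + 1) = N + 1 by omega) f (g ∘ₗ barD k Λ n) := by
  rw [LinearMap.smul_comp, cupCochain_d 𝒜 h hf hg, hf0, map_zero, LinearMap.zero_apply, zero_add,
    smul_smul, ← mul_pow]
  simp

/-- The cup product of cocycles. -/
def cupCocycles (i j : ℤ) {m n N : ℕ} (h : m + n = N) :
    (bar 𝒜).cocycles i m →ₗ[k] (bar 𝒜).cocycles j n →ₗ[k] (bar 𝒜).cocycles (i + j) N :=
  LinearMap.mk₂ k
    (fun f g => ⟨cupCochain 𝒜 j h f.1 g.1, cupCochain_mem 𝒜 h f.2.1 g.2.1,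
      cupCochain_d_zero h f.2.1 f.2.2 g.2.1 g.2.2⟩)
    (fun f f' g => Subtype.ext (LinearMap.map_add₂ (cupCochain 𝒜 j h) f.1 f'.1 g.1))
    (fun c f g => Subtype.ext (LinearMap.map_smul₂ (cupCochain 𝒜 j h) c f.1 g.1))
    (fun f g g' => Subtype.ext (map_add (cupCochain 𝒜 j h f.1) g.1 g'.1))
    (fun c f g => Subtype.ext (map_smul (cupCochain 𝒜 j h f.1) c g.1))

theorem cupCocycles_coe (i j : ℤ) {m n N : ℕ} (h : m + n = N) (f : (bar 𝒜).cocycles i m)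
    (g : (bar 𝒜).cocycles j n) : (cupCocycles 𝒜 i j h f g).1 = cupCochain 𝒜 j h f.1 g.1 := rfl

theorem cupCocycles_left (i j : ℤ) {m n N : ℕ} (h : m + n = N) (f : (bar 𝒜).cocycles i m)
    (hf : f.1 ∈ (bar 𝒜).coboundaries i m) (g : (bar 𝒜).cocycles j n) :
    (cupCocycles 𝒜 i j h f g).1 ∈ (bar 𝒜).coboundaries (i + j) N := by
  obtain ⟨f, hf'⟩ := f
  cases m with
  | zero =>
    have h0 : (⟨f, hf'⟩ : (bar 𝒜).cocycles i 0) = 0 := Subtype.ext hf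
    rw [h0, LinearMap.map_zero₂]
    exact Submodule.zero_mem _
  | succ m =>
    obtain ⟨N, rfl⟩ : ∃ N', N = N' + 1 := ⟨m + n, by omega⟩
    obtain ⟨f', hf'', rfl⟩ : ∃ f' ∈ (bar 𝒜).Coch i m, f' ∘ₗ (bar 𝒜).d m = f := hf
    have hN : m + n = N := by omega
    exact ⟨cupCochain 𝒜 j hN f' g.1, cupCochain_mem 𝒜 hN hf'' g.2.1,
      cupCochain_d_left hN hf'' g.2.1 g.2.2⟩

theorem cupCocycles_right (i j : ℤ) {m n N : ℕ} (h : m + n = N) (f : (bar 𝒜).cocycles i m)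
    (g : (bar 𝒜).cocycles j n) (hg : g.1 ∈ (bar 𝒜).coboundaries j n) :
    (cupCocycles 𝒜 i j h f g).1 ∈ (bar 𝒜).coboundaries (i + j) N := by
  obtain ⟨g, hg'⟩ := g
  cases n with
  | zero =>
    have h0 : (⟨g, hg'⟩ : (bar 𝒜).cocycles j 0) = 0 := Subtype.ext hg
    rw [h0, map_zero]
    exact Submodule.zero_mem _
  | succ n =>
    obtain ⟨N, rfl⟩ : ∃ N', N = N' + 1 := ⟨m + n, by omega⟩
    obtain ⟨g', hg'', rfl⟩ : ∃ g' ∈ (bar 𝒜).Coch j n, g' ∘ₗ (bar 𝒜).d n = g := hg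
    have hN : m + n = N := by omega
    have hmem := cupCochain_mem 𝒜 hN f.2.1 hg''
    exact ⟨(-1 : k) ^ m • cupCochain 𝒜 j hN f.1 g', Submodule.smul_mem _ _ hmem,
      cupCochain_d_right hN f.2.1 f.2.2 hg''⟩

/-- The cup product of a cocycle and a cohomology class. -/
def cupRight {i j : ℤ} {m n : ℕ} (f : (bar 𝒜).cocycles i m) :
    HH 𝒜 n j →ₗ[k] HH 𝒜 (m + n) (i + j) :=
  Subquotient.lift ((bar 𝒜).cls (m + n) (i + j) ∘ₗ cupCocycles 𝒜 i j rfl f)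
    (fun g hg => Subquotient.mk_eq_zero.2 (cupCocycles_right 𝒜 i j rfl f g hg))

theorem cupRight_cls {i j : ℤ} {m n : ℕ} (f : (bar 𝒜).cocycles i m)
    (g : (bar 𝒜).cocycles j n) : cupRight 𝒜 f ((bar 𝒜).cls n j g) =
      (bar 𝒜).cls (m + n) (i + j) (cupCocycles 𝒜 i j rfl f g) := rfl

/-- The cup product on Hochschild cohomology. -/
def HH.cup {i j : ℤ} {m n : ℕ} : HH 𝒜 m i →ₗ[k] HH 𝒜 n j →ₗ[k] HH 𝒜 (m + n) (i + j) :=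
  Subquotient.lift
    { toFun := fun f => cupRight 𝒜 f
      map_add' := fun f f' => by
        refine LinearMap.ext fun y => ?_
        obtain ⟨g, rfl⟩ := Subquotient.mk_surjective y
        exact congrArg ((bar 𝒜).cls (m + n) (i + j))
          (LinearMap.map_add₂ (cupCocycles 𝒜 i j rfl) f f' g)
      map_smul' := fun c f => by
        refine LinearMap.ext fun y => ?_
        obtain ⟨g, rfl⟩ := Subquotient.mk_surjective y
        exact (congrArg ((bar 𝒜).cls (m + n) (i + j))
          (LinearMap.map_smul₂ (cupCocycles 𝒜 i j rfl) c f g)).trans (map_smul _ _ _) }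
    (fun f hf => by
      refine LinearMap.ext fun y => ?_
      obtain ⟨g, rfl⟩ := Subquotient.mk_surjective y
      exact Subquotient.mk_eq_zero.2 (cupCocycles_left 𝒜 i j rfl f hf g))

theorem HH.cup_cls {i j : ℤ} {m n : ℕ} (f : (bar 𝒜).cocycles i m) (g : (bar 𝒜).cocycles j n) :
    HH.cup 𝒜 ((bar 𝒜).cls m i f) ((bar 𝒜).cls n j g) =
      (bar 𝒜).cls (m + n) (i + j) (cupCocycles 𝒜 i j rfl f g) := rfl

/-- The multiplication `x_0 ⊗ x_1 ↦ x_0 x_1` as a Hochschild cochain. -/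
def mulCochain (k : Type u) [Field k] (Λ : Type v) [Ring Λ] [Algebra k Λ] :
    BarTerm k Λ 0 →ₗ[k] Λ :=
  PiTensorProduct.lift (MultilinearMap.mkPiAlgebraFin k 2 Λ)

theorem mulCochain_tprod (x : Fin 2 → Λ) :
    mulCochain k Λ (PiTensorProduct.tprod k x) = x 0 * x 1 := by
  simp [mulCochain, List.ofFn_succ]

theorem mulCochain_mem : mulCochain k Λ ∈ (bar 𝒜).cocycles 0 0 := by
  refine ⟨⟨fun i => ?_, fun a x => ?_, fun a x => ?_⟩, ?_⟩
  · refine barGrading_map (mulCochain k Λ) _ fun e x hx he => ?_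
    rw [mulCochain_tprod, add_zero, ← he, Fin.sum_univ_two]
    exact SetLike.GradedMul.mul_mem (hx 0) (hx 1)
  · suffices mulCochain k Λ ∘ₗ barLeft k Λ 0 a =
        LinearMap.mulLeft k (signTwist 𝒜 0 a) ∘ₗ mulCochain k Λ from LinearMap.congr_fun this x
    ext x
    simp only [LinearMap.compMultilinearMap_apply, LinearMap.comp_apply, barLeft_tprod,
      LinearMap.mulLeft_apply, signTwist_zero, mulCochain_tprod]
    simp [mul_assoc]
  · suffices mulCochain k Λ ∘ₗ barRight k Λ 0 a =
        LinearMap.mulRight k a ∘ₗ mulCochain k Λ from LinearMap.congr_fun this x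
    ext x
    simp only [LinearMap.compMultilinearMap_apply, LinearMap.comp_apply, barRight_tprod,
      LinearMap.mulRight_apply, mulCochain_tprod]
    have h : (Fin.last 1 : Fin 2) = 1 := rfl
    simp [h, mul_assoc]
  · suffices mulCochain k Λ ∘ₗ barD k Λ 0 = 0 from this
    ext x
    simp only [LinearMap.compMultilinearMap_apply, LinearMap.comp_apply, barD_tprod,
      map_sum, map_smul, mulCochain_tprod, LinearMap.zero_apply]
    simp [Finset.sum_range_succ, contract, mul_assoc]

/-- The unit of the algebra `HH^{*,*}`, the class of the multiplication map. -/
def HH.one : HH 𝒜 0 0 := (bar 𝒜).cls 0 0 ⟨mulCochain k Λ, mulCochain_mem 𝒜⟩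

end CupCohomology

section BaseChange

variable {k : Type u} [Field k] {R : Type v} [Ring R] [Algebra k R] {T : Type w} [Ring T]
  [Algebra k T] {ℛ : ℤ → Submodule k R} [GradedAlgebra ℛ] {𝒯 : ℤ → Submodule k T}
  [GradedAlgebra 𝒯] (φ : ℛ →ₐᵍ[k] 𝒯)

namespace BimoduleComplex

variable (P : BimoduleComplex.{u, v, max u v} ℛ)

/-- The relations `(s φ(a)) ⊗ x ⊗ t = s ⊗ a x ⊗ t` and `s ⊗ x a ⊗ t = s ⊗ x ⊗ φ(a) t` that define
`T ⊗_R X n ⊗_R T` as a quotient of `T ⊗ X n ⊗ T`. -/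
def balancing (n : ℕ) : Submodule k (T ⊗[k] (P.X n ⊗[k] T)) :=
  Submodule.span k
    ({z | ∃ s a x t, z = (s * φ a) ⊗ₜ[k] (x ⊗ₜ[k] t) - s ⊗ₜ[k] (P.left n a x ⊗ₜ[k] t)} ∪
     {z | ∃ s a x t, z = s ⊗ₜ[k] (P.right n a x ⊗ₜ[k] t) - s ⊗ₜ[k] (x ⊗ₜ[k] (φ a * t))})

/-- The tensor product `T ⊗_R X n ⊗_R T`. -/
def BCTerm (n : ℕ) : Type (max u v w) := (T ⊗[k] (P.X n ⊗[k] T)) ⧸ P.balancing φ n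

instance (n : ℕ) : AddCommGroup (P.BCTerm φ n) :=
  inferInstanceAs (AddCommGroup ((T ⊗[k] (P.X n ⊗[k] T)) ⧸ P.balancing φ n))

instance (n : ℕ) : Module k (P.BCTerm φ n) :=
  inferInstanceAs (Module k ((T ⊗[k] (P.X n ⊗[k] T)) ⧸ P.balancing φ n))

/-- The quotient map `T ⊗ X n ⊗ T → T ⊗_R X n ⊗_R T`. -/
def bcMk (n : ℕ) : T ⊗[k] (P.X n ⊗[k] T) →ₗ[k] P.BCTerm φ n := (P.balancing φ n).mkQ

/-- The element `s ⊗ x ⊗ t` of `T ⊗_R X n ⊗_R T`. -/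
def bcTmul (n : ℕ) (s : T) (x : P.X n) (t : T) : P.BCTerm φ n :=
  P.bcMk φ n (s ⊗ₜ[k] (x ⊗ₜ[k] t))

theorem bcTmul_left (n : ℕ) (s : T) (a : R) (x : P.X n) (t : T) :
    P.bcTmul φ n (s * φ a) x t = P.bcTmul φ n s (P.left n a x) t :=
  (Submodule.Quotient.eq _).2 (Submodule.subset_span (Or.inl ⟨s, a, x, t, rfl⟩))

theorem bcTmul_right (n : ℕ) (s : T) (a : R) (x : P.X n) (t : T) :
    P.bcTmul φ n s (P.right n a x) t = P.bcTmul φ n s x (φ a * t) :=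
  (Submodule.Quotient.eq _).2 (Submodule.subset_span (Or.inr ⟨s, a, x, t, rfl⟩))

variable {P φ}

/-- A linear map on `T ⊗ X n ⊗ T` which is balanced over `R` factors through
`T ⊗_R X n ⊗_R T`. -/
def bcLift {M : Type*} [AddCommGroup M] [Module k M] {n : ℕ}
    (f : T ⊗[k] (P.X n ⊗[k] T) →ₗ[k] M)
    (hl : ∀ s a x t, f ((s * φ a) ⊗ₜ[k] (x ⊗ₜ[k] t)) = f (s ⊗ₜ[k] (P.left n a x ⊗ₜ[k] t)))
    (hr : ∀ s a x t, f (s ⊗ₜ[k] (P.right n a x ⊗ₜ[k] t)) = f (s ⊗ₜ[k] (x ⊗ₜ[k] (φ a * t)))) :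
    P.BCTerm φ n →ₗ[k] M :=
  (P.balancing φ n).liftQ f <| by
    rw [balancing, Submodule.span_le]
    rintro _ (⟨s, a, x, t, rfl⟩ | ⟨s, a, x, t, rfl⟩)
    · exact LinearMap.mem_ker.2 (by rw [map_sub, hl, sub_self])
    · exact LinearMap.mem_ker.2 (by rw [map_sub, hr, sub_self])

theorem bcLift_tmul {M : Type*} [AddCommGroup M] [Module k M] {n : ℕ}
    (f : T ⊗[k] (P.X n ⊗[k] T) →ₗ[k] M)
    (hl : ∀ s a x t, f ((s * φ a) ⊗ₜ[k] (x ⊗ₜ[k] t)) = f (s ⊗ₜ[k] (P.left n a x ⊗ₜ[k] t)))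
    (hr : ∀ s a x t, f (s ⊗ₜ[k] (P.right n a x ⊗ₜ[k] t)) = f (s ⊗ₜ[k] (x ⊗ₜ[k] (φ a * t))))
    (s : T) (x : P.X n) (t : T) :
    bcLift (φ := φ) f hl hr (P.bcTmul φ n s x t) = f (s ⊗ₜ[k] (x ⊗ₜ[k] t)) := rfl

theorem bc_ext {M : Type*} [AddCommGroup M] [Module k M] {n : ℕ}
    {f g : P.BCTerm φ n →ₗ[k] M}
    (h : ∀ s x t, f (P.bcTmul φ n s x t) = g (P.bcTmul φ n s x t)) : f = g := by
  have : f ∘ₗ P.bcMk φ n = g ∘ₗ P.bcMk φ n := TensorProduct.ext_threefold' h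
  ext z
  obtain ⟨z, rfl⟩ := (P.balancing φ n).mkQ_surjective z
  exact LinearMap.congr_fun this z

variable (P φ)

/-- Left multiplication by `T`. -/
def bcLeft (n : ℕ) : T →ₗ[k] Module.End k (P.BCTerm φ n) where
  toFun b := bcLift (P.bcMk φ n ∘ₗ TensorProduct.map (LinearMap.mulLeft k b) LinearMap.id)
    (fun s a x t => by
      simp only [LinearMap.comp_apply, TensorProduct.map_tmul, LinearMap.mulLeft_apply,
        LinearMap.id_apply, ← mul_assoc]
      exact P.bcTmul_left φ n _ _ _ _)
    (fun s a x t => P.bcTmul_right φ n _ _ _ _)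
  map_add' b c := bc_ext fun s x t => by
    change P.bcMk φ n (((b + c) * s) ⊗ₜ[k] (x ⊗ₜ[k] t)) =
      P.bcMk φ n ((b * s) ⊗ₜ[k] (x ⊗ₜ[k] t)) + P.bcMk φ n ((c * s) ⊗ₜ[k] (x ⊗ₜ[k] t))
    rw [add_mul, TensorProduct.add_tmul, map_add]
  map_smul' b c := bc_ext fun s x t => by
    change P.bcMk φ n (((b • c) * s) ⊗ₜ[k] (x ⊗ₜ[k] t)) =
      b • P.bcMk φ n ((c * s) ⊗ₜ[k] (x ⊗ₜ[k] t))
    rw [smul_mul_assoc, ← TensorProduct.smul_tmul', map_smul]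

/-- Right multiplication by `T`. -/
def bcRight (n : ℕ) : T →ₗ[k] Module.End k (P.BCTerm φ n) where
  toFun b := bcLift (P.bcMk φ n ∘ₗ TensorProduct.map LinearMap.id
      (TensorProduct.map LinearMap.id (LinearMap.mulRight k b)))
    (fun s a x t => P.bcTmul_left φ n _ _ _ _)
    (fun s a x t => by
      simp only [LinearMap.comp_apply, TensorProduct.map_tmul, LinearMap.mulRight_apply,
        LinearMap.id_apply, mul_assoc]
      exact P.bcTmul_right φ n _ _ _ _)
  map_add' b c := bc_ext fun s x t => by
    change P.bcMk φ n (s ⊗ₜ[k] (x ⊗ₜ[k] (t * (b + c)))) =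
      P.bcMk φ n (s ⊗ₜ[k] (x ⊗ₜ[k] (t * b))) + P.bcMk φ n (s ⊗ₜ[k] (x ⊗ₜ[k] (t * c)))
    rw [mul_add, TensorProduct.tmul_add, TensorProduct.tmul_add, map_add]
  map_smul' b c := bc_ext fun s x t => by
    change P.bcMk φ n (s ⊗ₜ[k] (x ⊗ₜ[k] (t * b • c))) =
      b • P.bcMk φ n (s ⊗ₜ[k] (x ⊗ₜ[k] (t * c)))
    rw [mul_smul_comm, TensorProduct.tmul_smul, TensorProduct.tmul_smul, map_smul]

theorem bcLeft_tmul (n : ℕ) (b s : T) (x : P.X n) (t : T) :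
    P.bcLeft φ n b (P.bcTmul φ n s x t) = P.bcTmul φ n (b * s) x t := rfl

theorem bcRight_tmul (n : ℕ) (b s : T) (x : P.X n) (t : T) :
    P.bcRight φ n b (P.bcTmul φ n s x t) = P.bcTmul φ n s x (t * b) := rfl

/-- The differential `id ⊗ d ⊗ id`. -/
def bcD (n : ℕ) : P.BCTerm φ (n + 1) →ₗ[k] P.BCTerm φ n :=
  bcLift (P.bcMk φ n ∘ₗ TensorProduct.map LinearMap.id
      (TensorProduct.map (P.d n) LinearMap.id))
    (fun s a x t => by
      simp only [LinearMap.comp_apply, TensorProduct.map_tmul, LinearMap.id_apply, P.d_left]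
      exact P.bcTmul_left φ n _ _ _ _)
    (fun s a x t => by
      simp only [LinearMap.comp_apply, TensorProduct.map_tmul, LinearMap.id_apply, P.d_right]
      exact P.bcTmul_right φ n _ _ _ _)

theorem bcD_tmul (n : ℕ) (s : T) (x : P.X (n + 1)) (t : T) :
    P.bcD φ n (P.bcTmul φ (n + 1) s x t) = P.bcTmul φ n s (P.d n x) t := rfl

/-- The elements of degree `i` in `T ⊗_R X n ⊗_R T`. -/
def bcGrading (n : ℕ) (i : ℤ) : Submodule k (P.BCTerm φ n) :=
  Submodule.span k {z | ∃ (p q r : ℤ) (s : T) (x : P.X n) (t : T),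
    s ∈ 𝒯 p ∧ x ∈ P.gr n q ∧ t ∈ 𝒯 r ∧ p + q + r = i ∧ P.bcTmul φ n s x t = z}

theorem bcGrading_map {n : ℕ} {i : ℤ} {M : Type*} [AddCommGroup M] [Module k M]
    (f : P.BCTerm φ n →ₗ[k] M) (N : Submodule k M)
    (h : ∀ (p q r : ℤ), p + q + r = i → ∀ s ∈ 𝒯 p, ∀ x ∈ P.gr n q, ∀ t ∈ 𝒯 r,
      f (P.bcTmul φ n s x t) ∈ N) : ∀ z ∈ P.bcGrading φ n i, f z ∈ N := by
  have : P.bcGrading φ n i ≤ N.comap f := by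
    rw [bcGrading, Submodule.span_le]
    rintro _ ⟨p, q, r, s, x, t, hs, hx, ht, hi, rfl⟩
    exact h p q r hi s hs x hx t ht
  exact this

theorem bcTmul_mem {n : ℕ} {i p q r : ℤ} (hi : p + q + r = i) {s : T} (hs : s ∈ 𝒯 p) {x : P.X n}
    (hx : x ∈ P.gr n q) {t : T} (ht : t ∈ 𝒯 r) : P.bcTmul φ n s x t ∈ P.bcGrading φ n i :=
  Submodule.subset_span ⟨p, q, r, s, x, t, hs, hx, ht, hi, rfl⟩

/-- The complex `T ⊗_R X ⊗_R T` of graded `(T, T)`-bimodules obtained from a complex `X` of graded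
`(R, R)`-bimodules by extension of scalars along a homomorphism `φ : R → T` of graded algebras. -/
def baseChange : BimoduleComplex.{u, w, max u v w} 𝒯 where
  X n := P.BCTerm φ n
  gr n i := P.bcGrading φ n i
  left n := P.bcLeft φ n
  right n := P.bcRight φ n
  d n := P.bcD φ n
  left_one n z := by
    suffices P.bcLeft φ n 1 = LinearMap.id from LinearMap.congr_fun this z
    exact bc_ext fun s x t => by rw [bcLeft_tmul, one_mul]; rfl
  left_mul n a b z := by
    suffices P.bcLeft φ n (a * b) = P.bcLeft φ n a ∘ₗ P.bcLeft φ n b from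
      LinearMap.congr_fun this z
    exact bc_ext fun s x t => by
      rw [LinearMap.comp_apply, bcLeft_tmul, bcLeft_tmul, bcLeft_tmul, mul_assoc]
  right_one n z := by
    suffices P.bcRight φ n 1 = LinearMap.id from LinearMap.congr_fun this z
    exact bc_ext fun s x t => by rw [bcRight_tmul, mul_one]; rfl
  right_mul n a b z := by
    suffices P.bcRight φ n (a * b) = P.bcRight φ n b ∘ₗ P.bcRight φ n a from
      LinearMap.congr_fun this z
    exact bc_ext fun s x t => by
      rw [LinearMap.comp_apply, bcRight_tmul, bcRight_tmul, bcRight_tmul, mul_assoc]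
  left_right n a b z := by
    suffices P.bcLeft φ n a ∘ₗ P.bcRight φ n b = P.bcRight φ n b ∘ₗ P.bcLeft φ n a from
      LinearMap.congr_fun this z
    exact bc_ext fun s x t => rfl
  left_mem n i j b hb := by
    refine P.bcGrading_map φ (P.bcLeft φ n b) _ fun p q r h s hs x hx t ht => ?_
    rw [bcLeft_tmul]
    exact P.bcTmul_mem φ (by omega) (SetLike.GradedMul.mul_mem hb hs) hx ht
  right_mem n i j b hb := by
    refine P.bcGrading_map φ (P.bcRight φ n b) _ fun p q r h s hs x hx t ht => ?_
    rw [bcRight_tmul]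
    exact P.bcTmul_mem φ (by omega) hs hx (SetLike.GradedMul.mul_mem ht hb)
  d_left n a z := by
    suffices P.bcD φ n ∘ₗ P.bcLeft φ (n + 1) a = P.bcLeft φ n a ∘ₗ P.bcD φ n from
      LinearMap.congr_fun this z
    exact bc_ext fun s x t => rfl
  d_right n a z := by
    suffices P.bcD φ n ∘ₗ P.bcRight φ (n + 1) a = P.bcRight φ n a ∘ₗ P.bcD φ n from
      LinearMap.congr_fun this z
    exact bc_ext fun s x t => rfl
  d_mem n i := by
    refine P.bcGrading_map φ (P.bcD φ n) _ fun p q r h s hs x hx t ht => ?_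
    rw [bcD_tmul]
    exact P.bcTmul_mem φ h hs (P.d_mem n q x hx) ht
  d_d n z := by
    suffices P.bcD φ n ∘ₗ P.bcD φ (n + 1) = 0 from LinearMap.congr_fun this z
    refine bc_ext fun s x t => ?_
    rw [LinearMap.comp_apply, bcD_tmul, bcD_tmul, P.d_d]
    simp [bcTmul]

/-- The map `s ⊗ x ⊗ t ↦ (-1)^(l * |s|) s φ(ζ(x)) t` on `T ⊗_R X n ⊗_R T` defined by a cochain `ζ`
of degree `l`. -/
def bcCochain (l : ℤ) (n : ℕ) (ζ : P.Coch l n) : P.BCTerm φ n →ₗ[k] T :=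
  bcLift (LinearMap.mul' k T ∘ₗ TensorProduct.map (signTwist 𝒯 l) (LinearMap.mul' k T ∘ₗ
      TensorProduct.map (φ.toAlgHom.toLinearMap ∘ₗ ζ.1) LinearMap.id))
    (fun s a x t => by
      have h : φ (ζ.1 (P.left n a x)) = signTwist 𝒯 l (φ a) * φ (ζ.1 x) := by
        rw [ζ.2.2.1 a x, map_mul, signTwist_gradedHom]
      change signTwist 𝒯 l (s * φ a) * (φ (ζ.1 x) * t) =
        signTwist 𝒯 l s * (φ (ζ.1 (P.left n a x)) * t)
      rw [h, signTwist_mul, mul_assoc, mul_assoc])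
    (fun s a x t => by
      have h : φ (ζ.1 (P.right n a x)) = φ (ζ.1 x) * φ a := by rw [ζ.2.2.2 a x, map_mul]
      change signTwist 𝒯 l s * (φ (ζ.1 (P.right n a x)) * t) =
        signTwist 𝒯 l s * (φ (ζ.1 x) * (φ a * t))
      rw [h, mul_assoc])

theorem bcCochain_tmul (l : ℤ) (n : ℕ) (ζ : P.Coch l n) (s : T) (x : P.X n) (t : T) :
    P.bcCochain φ l n ζ (P.bcTmul φ n s x t) = signTwist 𝒯 l s * (φ (ζ.1 x) * t) := rfl

theorem bcCochain_mem (l : ℤ) (n : ℕ) (ζ : P.Coch l n) :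
    P.bcCochain φ l n ζ ∈ (P.baseChange φ).Coch l n := by
  refine ⟨fun i => ?_, fun a z => ?_, fun a z => ?_⟩
  · refine P.bcGrading_map φ (P.bcCochain φ l n ζ) _ fun p q r h s hs x hx t ht => ?_
    rw [bcCochain_tmul]
    have h1 : i + l = p + ((q + l) + r) := by omega
    rw [h1]
    exact SetLike.GradedMul.mul_mem (signTwist_mem 𝒯 l hs)
      (SetLike.GradedMul.mul_mem (φ.map_mem (ζ.2.1 q x hx)) ht)
  · suffices P.bcCochain φ l n ζ ∘ₗ P.bcLeft φ n a =
        LinearMap.mulLeft k (signTwist 𝒯 l a) ∘ₗ P.bcCochain φ l n ζ from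
      LinearMap.congr_fun this z
    refine bc_ext fun s x t => ?_
    rw [LinearMap.comp_apply, LinearMap.comp_apply, bcLeft_tmul, bcCochain_tmul, bcCochain_tmul,
      LinearMap.mulLeft_apply, signTwist_mul, mul_assoc]
  · suffices P.bcCochain φ l n ζ ∘ₗ P.bcRight φ n a =
        LinearMap.mulRight k a ∘ₗ P.bcCochain φ l n ζ from
      LinearMap.congr_fun this z
    refine bc_ext fun s x t => ?_
    rw [LinearMap.comp_apply, LinearMap.comp_apply, bcRight_tmul, bcCochain_tmul, bcCochain_tmul,
      LinearMap.mulRight_apply, mul_assoc, mul_assoc]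

/-- The map `Hom^l_{R^e}(X n, R) → Hom^l_{T^e}(T ⊗_R X n ⊗_R T, T)`, `ζ ↦ T ⊗_R ζ ⊗_R T`. -/
def bcCoch (l : ℤ) (n : ℕ) : P.Coch l n →ₗ[k] (P.baseChange φ).Coch l n where
  toFun ζ := ⟨P.bcCochain φ l n ζ, P.bcCochain_mem φ l n ζ⟩
  map_add' ζ ξ := Subtype.ext <| bc_ext fun s x t => by
    change signTwist 𝒯 l s * (φ (ζ.1 x + ξ.1 x) * t) =
      signTwist 𝒯 l s * (φ (ζ.1 x) * t) + signTwist 𝒯 l s * (φ (ξ.1 x) * t)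
    rw [map_add, add_mul, mul_add]
  map_smul' c ζ := Subtype.ext <| bc_ext fun s x t => by
    change signTwist 𝒯 l s * (φ (c • ζ.1 x) * t) = c • (signTwist 𝒯 l s * (φ (ζ.1 x) * t))
    rw [map_smul, smul_mul_assoc, mul_smul_comm]

/-- The map `H^n(Hom^l_{R^e}(X, R)) → H^n(Hom^l_{T^e}(T ⊗_R X ⊗_R T, T))` induced by
`ζ ↦ T ⊗_R ζ ⊗_R T`. -/
def bcStar (n : ℕ) (l : ℤ) : P.Coh n l →ₗ[k] (P.baseChange φ).Coh n l :=
  cohMap (fun n => P.bcCoch φ l n) (fun _ _ => Subtype.ext (bc_ext fun _ _ _ => rfl)) n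

end BimoduleComplex

/-- The map of bar resolutions induced by `φ`. -/
def barMap (n : ℕ) : BarTerm k R n →ₗ[k] BarTerm k T n :=
  PiTensorProduct.map fun _ => φ.toAlgHom.toLinearMap

theorem barMap_tprod (n : ℕ) (x : Fin (n + 2) → R) :
    barMap φ n (PiTensorProduct.tprod k x) = PiTensorProduct.tprod k fun p => φ (x p) :=
  PiTensorProduct.map_tprod _ _

theorem barMap_left (n : ℕ) (a : R) (x : BarTerm k R n) :
    barMap φ n (barLeft k R n a x) = barLeft k T n (φ a) (barMap φ n x) := by
  suffices barMap φ n ∘ₗ barLeft k R n a = barLeft k T n (φ a) ∘ₗ barMap φ n from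
    LinearMap.congr_fun this x
  ext x
  simp only [LinearMap.compMultilinearMap_apply, LinearMap.comp_apply, barLeft_tprod,
    barMap_tprod]
  congr 1
  ext p
  by_cases h : p = 0
  · subst h; simp
  · simp [h]

theorem barMap_right (n : ℕ) (a : R) (x : BarTerm k R n) :
    barMap φ n (barRight k R n a x) = barRight k T n (φ a) (barMap φ n x) := by
  suffices barMap φ n ∘ₗ barRight k R n a = barRight k T n (φ a) ∘ₗ barMap φ n from
    LinearMap.congr_fun this x
  ext x
  simp only [LinearMap.compMultilinearMap_apply, LinearMap.comp_apply, barRight_tprod,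
    barMap_tprod]
  congr 1
  ext p
  by_cases h : p = Fin.last (n + 1)
  · subst h; simp
  · simp [h]

theorem barMap_d (n : ℕ) (x : BarTerm k R (n + 1)) :
    barMap φ n (barD k R n x) = barD k T n (barMap φ (n + 1) x) := by
  suffices barMap φ n ∘ₗ barD k R n = barD k T n ∘ₗ barMap φ (n + 1) from
    LinearMap.congr_fun this x
  ext x
  simp only [LinearMap.compMultilinearMap_apply, LinearMap.comp_apply, barD_tprod,
    barMap_tprod, map_sum, map_smul]
  refine Finset.sum_congr rfl fun i _ => ?_
  congr 2
  ext p
  simp only [contract]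
  split_ifs <;> simp

theorem barMap_mem (n : ℕ) (i : ℤ) : ∀ x ∈ barGrading ℛ n i, barMap φ n x ∈ barGrading 𝒯 n i := by
  refine barGrading_map (barMap φ n) _ fun e x hx he => ?_
  rw [barMap_tprod]
  exact tprod_mem_barGrading (fun p => φ.map_mem (hx p)) he

/-- The map `η : T ⊗_R 𝔹(R)_n ⊗_R T → 𝔹(T)_n`,
`s ⊗ (x_0, …, x_{n+1}) ⊗ t ↦ (s φ(x_0), φ(x_1), …, φ(x_n), φ(x_{n+1}) t)`. -/
def eta (n : ℕ) : (bar ℛ).BCTerm φ n →ₗ[k] BarTerm k T n :=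
  BimoduleComplex.bcLift (TensorProduct.lift (barLeft k T n) ∘ₗ
      TensorProduct.map LinearMap.id (TensorProduct.lift ((barRight k T n).flip ∘ₗ barMap φ n)))
    (fun s a x t => by
      refine ((bar 𝒯).left_mul n s (φ a) _).trans ?_
      refine congrArg (barLeft k T n s) (((bar 𝒯).left_right n (φ a) t _).trans ?_)
      exact congrArg (barRight k T n t) (barMap_left φ n a x).symm)
    (fun s a x t => by
      refine congrArg (barLeft k T n s) (Eq.trans ?_ ((bar 𝒯).right_mul n (φ a) t _).symm)
      exact congrArg (barRight k T n t) (barMap_right φ n a x))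

theorem eta_tmul (n : ℕ) (s : T) (x : BarTerm k R n) (t : T) :
    eta φ n ((bar ℛ).bcTmul φ n s x t) = barLeft k T n s (barRight k T n t (barMap φ n x)) := rfl

theorem eta_left (n : ℕ) (b : T) (z : (bar ℛ).BCTerm φ n) :
    eta φ n ((bar ℛ).bcLeft φ n b z) = barLeft k T n b (eta φ n z) := by
  suffices eta φ n ∘ₗ (bar ℛ).bcLeft φ n b = barLeft k T n b ∘ₗ eta φ n from
    LinearMap.congr_fun this z
  exact BimoduleComplex.bc_ext fun s x t => (bar 𝒯).left_mul n b s _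

theorem eta_right (n : ℕ) (b : T) (z : (bar ℛ).BCTerm φ n) :
    eta φ n ((bar ℛ).bcRight φ n b z) = barRight k T n b (eta φ n z) := by
  suffices eta φ n ∘ₗ (bar ℛ).bcRight φ n b = barRight k T n b ∘ₗ eta φ n from
    LinearMap.congr_fun this z
  exact BimoduleComplex.bc_ext fun s x t =>
    (congrArg (barLeft k T n s) ((bar 𝒯).right_mul n t b _)).trans ((bar 𝒯).left_right n s b _)

theorem eta_d (n : ℕ) (z : (bar ℛ).BCTerm φ (n + 1)) :
    eta φ n ((bar ℛ).bcD φ n z) = barD k T n (eta φ (n + 1) z) := by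
  suffices eta φ n ∘ₗ (bar ℛ).bcD φ n = barD k T n ∘ₗ eta φ (n + 1) from
    LinearMap.congr_fun this z
  refine BimoduleComplex.bc_ext fun s x t => ?_
  refine (congrArg (fun y => barLeft k T n s (barRight k T n t y)) (barMap_d φ n x)).trans ?_
  exact (((bar 𝒯).d_left n s _).trans
    (congrArg (barLeft k T n s) ((bar 𝒯).d_right n t _))).symm

theorem eta_mem (n : ℕ) (i : ℤ) :
    ∀ z ∈ (bar ℛ).bcGrading φ n i, eta φ n z ∈ barGrading 𝒯 n i := by
  refine (bar ℛ).bcGrading_map φ (eta φ n) _ fun p q r h s hs x hx t ht => ?_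
  have h1 : p + (q + r) = i := by omega
  rw [← h1]
  exact (bar 𝒯).left_mem n p (q + r) s hs _
    ((bar 𝒯).right_mem n r q t ht _ (barMap_mem φ n q x hx))

/-- The map `Hom^l_{T^e}(𝔹(T)_n, T) → Hom^l_{T^e}(T ⊗_R 𝔹(R)_n ⊗_R T, T)`, `f ↦ f ∘ η`. -/
def etaCoch (l : ℤ) (n : ℕ) : (bar 𝒯).Coch l n →ₗ[k] ((bar ℛ).baseChange φ).Coch l n :=
  LinearMap.restrict (LinearMap.lcomp k T (eta φ n)) <| by
    rintro f ⟨hf, hf', hf''⟩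
    exact ⟨fun i z hz => hf i _ (eta_mem φ n i z hz),
      fun a z => (congrArg f (eta_left φ n a z)).trans (hf' a _),
      fun a z => (congrArg f (eta_right φ n a z)).trans (hf'' a _)⟩

/-- The map `η^* : HH^{n,l}(T) → H^n(Hom^l_{T^e}(T ⊗_R 𝔹(R) ⊗_R T, T))`. -/
def etaStar (n : ℕ) (l : ℤ) : HH 𝒯 n l →ₗ[k] ((bar ℛ).baseChange φ).Coh n l :=
  BimoduleComplex.cohMap (fun n => etaCoch φ l n)
    (fun n f => Subtype.ext (LinearMap.ext fun z =>
      (congrArg f.1 (eta_d φ n z)).symm)) n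

/-- The map `Γ = (η^*)⁻¹ ∘ (T ⊗_R - ⊗_R T) : HH^{n,l}(R) → HH^{n,l}(T)`, which is defined if all
the maps `η^*` are bijective. -/
def Gamma (hη : ∀ n l, Function.Bijective (etaStar φ n l)) (n : ℕ) (l : ℤ) :
    HH ℛ n l →ₗ[k] HH 𝒯 n l :=
  (LinearEquiv.ofBijective (etaStar φ n l) (hη n l)).symm.toLinearMap ∘ₗ (bar ℛ).bcStar φ n l

end BaseChange

section FlatEpi

/-- The relations `x r ⊗ y = x ⊗ r y`. -/
def ncBalancing (R : Type u) [Ring R] (X : Type v) [AddCommGroup X] [Module Rᵐᵒᵖ X]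
    (Y : Type w) [AddCommGroup Y] [Module R Y] : AddSubgroup (X ⊗[ℤ] Y) :=
  AddSubgroup.closure {z | ∃ (x : X) (r : R) (y : Y),
    z = (MulOpposite.op r • x) ⊗ₜ[ℤ] y - x ⊗ₜ[ℤ] (r • y)}

/-- The tensor product `X ⊗_R Y` of a right module and a left module over a (not necessarily
commutative) ring `R`. -/
abbrev NCTensor (R : Type u) [Ring R] (X : Type v) [AddCommGroup X] [Module Rᵐᵒᵖ X]
    (Y : Type w) [AddCommGroup Y] [Module R Y] : Type (max v w) :=
  (X ⊗[ℤ] Y) ⧸ ncBalancing R X Y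

/-- The map `f ⊗ g : X ⊗_R Y → X' ⊗_R Y'` induced by a map `f` of right modules and a map `g` of
left modules. -/
def NCTensor.map {R : Type*} [Ring R] {X X' : Type*} [AddCommGroup X] [Module Rᵐᵒᵖ X]
    [AddCommGroup X'] [Module Rᵐᵒᵖ X'] {Y Y' : Type*} [AddCommGroup Y] [Module R Y]
    [AddCommGroup Y'] [Module R Y'] (f : X →ₗ[Rᵐᵒᵖ] X') (g : Y →ₗ[R] Y') :
    NCTensor R X Y →+ NCTensor R X' Y' :=
  QuotientAddGroup.map _ _
    (TensorProduct.map f.toAddMonoidHom.toIntLinearMap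
      g.toAddMonoidHom.toIntLinearMap).toAddMonoidHom <| by
      rw [ncBalancing, AddSubgroup.closure_le]
      rintro _ ⟨x, r, y, rfl⟩
      refine AddSubgroup.subset_closure ⟨f x, r, g y, (map_sub _ _ _).trans ?_⟩
      change f (MulOpposite.op r • x) ⊗ₜ[ℤ] g y - f x ⊗ₜ[ℤ] g (r • y) = _
      rw [map_smul, map_smul]

/-- The right `R`-module `X` is flat: `X ⊗_R -` preserves injectivity of maps of left
`R`-modules. -/
def IsFlatRight (R : Type u) [Ring R] (X : Type v) [AddCommGroup X] [Module Rᵐᵒᵖ X] : Prop :=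
  ∀ (M N : Type u) [AddCommGroup M] [AddCommGroup N] [Module R M] [Module R N] (g : M →ₗ[R] N),
    Function.Injective g →
      Function.Injective (NCTensor.map (LinearMap.id : X →ₗ[Rᵐᵒᵖ] X) g)

/-- The left `R`-module `Y` is flat: `- ⊗_R Y` preserves injectivity of maps of right
`R`-modules. -/
def IsFlatLeft (R : Type u) [Ring R] (Y : Type v) [AddCommGroup Y] [Module R Y] : Prop :=
  ∀ (M N : Type u) [AddCommGroup M] [AddCommGroup N] [Module Rᵐᵒᵖ M] [Module Rᵐᵒᵖ N]
    (f : M →ₗ[Rᵐᵒᵖ] N), Function.Injective f →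
      Function.Injective (NCTensor.map f (LinearMap.id : Y →ₗ[R] Y))

/-- A flat epimorphism of rings: an epimorphism `φ : R → T` in the category of rings such that `T`
is flat as a right and as a left `R`-module. -/
def IsFlatEpi {R : Type u} [Ring R] {T : Type v} [Ring T] (φ : R →+* T) : Prop :=
  (∀ (S : Type v) [Ring S] (α β : T →+* S), α.comp φ = β.comp φ → α = β) ∧
  (letI : Module Rᵐᵒᵖ T := Module.compHom T (RingHom.op φ); IsFlatRight R T) ∧
  (letI : Module R T := Module.compHom T φ; IsFlatLeft R T)

end FlatEpi

section CanonicalClass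

variable {k : Type u} [Field k] {A : Type v} [Ring A] [Algebra k A]
variable {𝒜 : ℤ → Submodule k A} [GradedAlgebra 𝒜]

/-- The choices in the construction of the secondary multiplication on the cohomology `H^*A` of a
dg algebra: a linear map `f₁ : H^*A → A` of degree zero which selects a representing cocycle in
every cohomology class, and a linear map `f₂ : H^*A ⊗ H^*A → A` of degree `-1` with
`d f₂(x, y) = f₁(x y) - f₁(x) f₁(y)`. -/
structure SecondaryData (D : DGStructure 𝒜) where
  /-- The choice of representing cocycles. -/
  f₁ : D.Cohomology →ₗ[k] A
  f₁_mem : ∀ i, ∀ x ∈ D.cohGrading i, f₁ x ∈ 𝒜 i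
  d_f₁ : ∀ x, D.d (f₁ x) = 0
  toCohomology_f₁ : ∀ x, D.toCohomology ⟨f₁ x, d_f₁ x⟩ = x
  /-- The choice of homotopies. -/
  f₂ : D.Cohomology →ₗ[k] D.Cohomology →ₗ[k] A
  f₂_mem : ∀ i j, ∀ x ∈ D.cohGrading i, ∀ y ∈ D.cohGrading j, f₂ x y ∈ 𝒜 (i + j - 1)
  d_f₂ : ∀ x y, D.d (f₂ x y) = f₁ (x * y) - f₁ x * f₁ y

/-- A function of five variables which is linear in each of them, as a multilinear map. -/
def multilinearFive {V W : Type*} [AddCommGroup V] [Module k V] [AddCommGroup W] [Module k W]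
    (F : V → V → V → V → V → W)
    (a₀ : ∀ x x' y z w v, F (x + x') y z w v = F x y z w v + F x' y z w v)
    (a₁ : ∀ x y y' z w v, F x (y + y') z w v = F x y z w v + F x y' z w v)
    (a₂ : ∀ x y z z' w v, F x y (z + z') w v = F x y z w v + F x y z' w v)
    (a₃ : ∀ x y z w w' v, F x y z (w + w') v = F x y z w v + F x y z w' v)
    (a₄ : ∀ x y z w v v', F x y z w (v + v') = F x y z w v + F x y z w v')
    (s₀ : ∀ (c : k) x y z w v, F (c • x) y z w v = c • F x y z w v)
    (s₁ : ∀ (c : k) x y z w v, F x (c • y) z w v = c • F x y z w v)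
    (s₂ : ∀ (c : k) x y z w v, F x y (c • z) w v = c • F x y z w v)
    (s₃ : ∀ (c : k) x y z w v, F x y z (c • w) v = c • F x y z w v)
    (s₄ : ∀ (c : k) x y z w v, F x y z w (c • v) = c • F x y z w v) :
    MultilinearMap k (fun _ : Fin 5 => V) W :=
  MultilinearMap.mk' (fun x => F (x 0) (x 1) (x 2) (x 3) (x 4))
    (fun x q a b => by
      fin_cases q
      · exact a₀ _ _ _ _ _ _
      · exact a₁ _ _ _ _ _ _
      · exact a₂ _ _ _ _ _ _
      · exact a₃ _ _ _ _ _ _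
      · exact a₄ _ _ _ _ _ _)
    (fun x q c a => by
      fin_cases q
      · exact s₀ _ _ _ _ _ _
      · exact s₁ _ _ _ _ _ _
      · exact s₂ _ _ _ _ _ _
      · exact s₃ _ _ _ _ _ _
      · exact s₄ _ _ _ _ _ _)

namespace SecondaryData

theorem exists_ginv {V W : Type*} [AddCommGroup V] [Module k V] [AddCommGroup W] [Module k W]
    (f : V →ₗ[k] W) : ∃ g : W →ₗ[k] V, ∀ v, f (g (f v)) = f v := by
  obtain ⟨g, hg⟩ := LinearMap.exists_rightInverse_of_surjective f.rangeRestrict f.range_rangeRestrict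
  obtain ⟨g', hg'⟩ := LinearMap.exists_extend g
  refine ⟨g', fun v => ?_⟩
  have h1 : g' (f v) = g (f.rangeRestrict v) := LinearMap.congr_fun hg' (f.rangeRestrict v)
  have h2 := congrArg Subtype.val (LinearMap.congr_fun hg (f.rangeRestrict v))
  rw [h1]
  exact h2

theorem exists_glue {Λ : Type*} [Ring Λ] [Algebra k Λ] (𝒢 : ℤ → Submodule k Λ) [GradedAlgebra 𝒢]
    {M : Type*} [AddCommGroup M] [Module k M] (g : ℤ → Λ →ₗ[k] M) :
    ∃ h : Λ →ₗ[k] M, ∀ i, ∀ a ∈ 𝒢 i, h a = g i a := by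
  refine ⟨DirectSum.toModule k ℤ M (fun i => g i ∘ₗ (𝒢 i).subtype) ∘ₗ
    (DirectSum.decomposeLinearEquiv 𝒢).toLinearMap, fun i a ha => ?_⟩
  have h := DirectSum.decomposeLinearEquiv_apply_coe (R := k) 𝒢 i ⟨a, ha⟩
  simp only at h
  rw [LinearMap.comp_apply, LinearEquiv.coe_coe, h, DirectSum.toModule_lof]
  rfl

variable (D : DGStructure 𝒜)

theorem exists_section : ∃ g : D.Cohomology →ₗ[k] D.cycles,
    (∀ i, ∀ x ∈ D.cohGrading i, (g x : A) ∈ 𝒜 i) ∧ ∀ x, D.toCohomology (g x) = x := by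
  have h1 : ∀ i, ∃ g : D.Cohomology →ₗ[k] D.cycles,
      (∀ x, (g x : A) ∈ 𝒜 i) ∧ ∀ x ∈ D.cohGrading i, D.toCohomology (g x) = x := by
    intro i
    let Z : Submodule k D.cycles := (𝒜 i).comap D.cycles.val.toLinearMap
    obtain ⟨g, hg⟩ := exists_ginv (D.toCohomology.toLinearMap ∘ₗ Z.subtype)
    refine ⟨Z.subtype ∘ₗ g, fun x => (g x).2, ?_⟩
    rintro _ ⟨z, hz, rfl⟩
    exact hg ⟨z, hz⟩
  choose g hg hg' using h1
  obtain ⟨h, hh⟩ := exists_glue D.cohGrading g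
  refine ⟨h, fun i x hx => by rw [hh i x hx]; exact hg i x, fun x => ?_⟩
  have : D.toCohomology.toLinearMap ∘ₗ h = LinearMap.id :=
    ext_homogeneous D.cohGrading fun i x hx => by
      rw [LinearMap.comp_apply, hh i x hx]
      exact hg' i x hx
  exact LinearMap.congr_fun this x

theorem exists_homotopy : ∃ h : A →ₗ[k] A, (∀ i, ∀ a ∈ 𝒜 i, h a ∈ 𝒜 (i - 1)) ∧
    ∀ i, ∀ b ∈ 𝒜 i, (∃ a, D.d a = b) → D.d (h b) = b := by
  have h1 : ∀ i, ∃ g : A →ₗ[k] A, (∀ a, g a ∈ 𝒜 (i - 1)) ∧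
      ∀ b ∈ 𝒜 i, (∃ a, D.d a = b) → D.d (g b) = b := by
    intro i
    obtain ⟨g, hg⟩ := exists_ginv (D.d ∘ₗ (𝒜 (i - 1)).subtype)
    refine ⟨(𝒜 (i - 1)).subtype ∘ₗ g, fun a => (g a).2, ?_⟩
    rintro _ hb ⟨a, rfl⟩
    have h2 := D.decompose_d a (i - 1)
    rw [sub_add_cancel, DirectSum.decompose_of_mem_same 𝒜 hb] at h2
    rw [h2]
    exact hg _
  choose g hg hg' using h1
  obtain ⟨h, hh⟩ := exists_glue 𝒜 g
  refine ⟨h, fun i a ha => by rw [hh i a ha]; exact hg i a, fun i b hb hb' => ?_⟩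
  rw [hh i b hb]
  exact hg' i b hb hb'

/-- The choices can always be made. -/
theorem nonempty : Nonempty (SecondaryData D) := by
  obtain ⟨g, hg, hg'⟩ := exists_section D
  obtain ⟨h, hh, hh'⟩ := exists_homotopy D
  let f : D.Cohomology →ₗ[k] A := D.cycles.val.toLinearMap ∘ₗ g
  let e : D.Cohomology →ₗ[k] D.Cohomology →ₗ[k] A :=
    (LinearMap.mul k D.Cohomology).compr₂ f - (LinearMap.mul k A).compl₁₂ f f
  have he : ∀ x y, e x y = f (x * y) - f x * f y := fun x y => rfl
  have hmem : ∀ i j, ∀ x ∈ D.cohGrading i, ∀ y ∈ D.cohGrading j, e x y ∈ 𝒜 (i + j) := by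
    intro i j x hx y hy
    rw [he]
    exact sub_mem (hg _ _ (SetLike.GradedMul.mul_mem hx hy))
      (SetLike.GradedMul.mul_mem (hg _ _ hx) (hg _ _ hy))
  have hd : e.compr₂ (D.d ∘ₗ h) = e := by
    refine ext_homogeneous D.cohGrading fun i x hx => ext_homogeneous D.cohGrading fun j y hy => ?_
    refine hh' (i + j) _ (hmem i j x hx y hy) ?_
    have h1 : D.toCohomology (g (x * y) - g x * g y) = 0 := by
      rw [map_sub, map_mul D.toCohomology, hg', hg', hg', sub_self]
    exact D.toCohomology_eq_zero.1 h1
  exact ⟨{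
    f₁ := f
    f₁_mem := hg
    d_f₁ := fun x => (g x).2
    toCohomology_f₁ := hg'
    f₂ := e.compr₂ h
    f₂_mem := fun i j x hx y hy => hh _ _ (hmem i j x hx y hy)
    d_f₂ := fun x y => LinearMap.congr_fun₂ hd x y }⟩

variable {D}
variable (S : SecondaryData D)

/-- The cocycle
`Φ(x, y, z) = (-1)^|x| f₁(x) f₂(y, z) - f₂(x, y) f₁(z) - f₂(x y, z) + f₂(x, y z)` of `A`. -/
def Phi (x y z : D.Cohomology) : A :=
  S.f₁ (signTwist D.cohGrading (-1) x) * S.f₂ y z - S.f₂ x y * S.f₁ z -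
    S.f₂ (x * y) z + S.f₂ x (y * z)

theorem signTwist_f₁ (t : ℤ) (x : D.Cohomology) :
    signTwist 𝒜 t (S.f₁ x) = S.f₁ (signTwist D.cohGrading t x) := by
  have h := signTwist_map D.cohGrading 𝒜 t 0 S.f₁
    (fun i x hx => by rw [add_zero]; exact S.f₁_mem i x hx) x
  simpa using h

theorem signTwist_signTwist (x : D.Cohomology) :
    signTwist D.cohGrading (-1) (signTwist D.cohGrading (-1) x) = x := by
  have h := signTwist_add D.cohGrading 1 (-1) x
  rw [signTwist_neg D.cohGrading 1 (signTwist D.cohGrading (-1) x), ← h, add_neg_cancel,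
    signTwist_zero]

theorem d_Phi (x y z : D.Cohomology) : D.d (S.Phi x y z) = 0 := by
  rw [Phi, map_add, map_sub, map_sub, D.d_mul, D.d_mul, signTwist_f₁, signTwist_signTwist,
    S.d_f₁, S.d_f₁, S.d_f₂, S.d_f₂, S.d_f₂, S.d_f₂, mul_assoc]
  noncomm_ring

theorem Phi_mem {i j l : ℤ} {x y z : D.Cohomology} (hx : x ∈ D.cohGrading i)
    (hy : y ∈ D.cohGrading j) (hz : z ∈ D.cohGrading l) : S.Phi x y z ∈ 𝒜 (i + j + l - 1) := by
  have h1 : S.f₁ (signTwist D.cohGrading (-1) x) * S.f₂ y z ∈ 𝒜 (i + j + l - 1) := by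
    rw [show i + j + l - 1 = i + (j + l - 1) by ring]
    exact SetLike.GradedMul.mul_mem (S.f₁_mem _ _ (signTwist_mem _ _ hx)) (S.f₂_mem _ _ _ hy _ hz)
  have h2 : S.f₂ x y * S.f₁ z ∈ 𝒜 (i + j + l - 1) := by
    rw [show i + j + l - 1 = (i + j - 1) + l by ring]
    exact SetLike.GradedMul.mul_mem (S.f₂_mem _ _ _ hx _ hy) (S.f₁_mem _ _ hz)
  have h3 := S.f₂_mem _ _ _ (SetLike.GradedMul.mul_mem hx hy) _ hz
  have h4 := S.f₂_mem _ _ _ hx _ (SetLike.GradedMul.mul_mem hy hz)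
  rw [← add_assoc] at h4
  exact add_mem (sub_mem (sub_mem h1 h2) h3) h4

/-- The secondary multiplication `m₃(x, y, z)`, the cohomology class of `Φ(x, y, z)`. -/
def m₃ (x y z : D.Cohomology) : D.Cohomology := D.toCohomology ⟨S.Phi x y z, S.d_Phi x y z⟩

theorem m₃_mem {i j l : ℤ} {x y z : D.Cohomology} (hx : x ∈ D.cohGrading i)
    (hy : y ∈ D.cohGrading j) (hz : z ∈ D.cohGrading l) :
    S.m₃ x y z ∈ D.cohGrading (i + j + l - 1) :=
  ⟨⟨S.Phi x y z, S.d_Phi x y z⟩, S.Phi_mem hx hy hz, rfl⟩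

theorem m₃_add₁ (x x' y z : D.Cohomology) : S.m₃ (x + x') y z = S.m₃ x y z + S.m₃ x' y z := by
  rw [m₃, m₃, m₃, ← map_add]
  refine congrArg D.toCohomology (Subtype.ext ?_)
  simp only [Phi, map_add, add_mul, LinearMap.add_apply, AddMemClass.coe_add]
  abel

theorem m₃_add₂ (x y y' z : D.Cohomology) : S.m₃ x (y + y') z = S.m₃ x y z + S.m₃ x y' z := by
  rw [m₃, m₃, m₃, ← map_add]
  refine congrArg D.toCohomology (Subtype.ext ?_)
  simp only [Phi, map_add, add_mul, mul_add, LinearMap.add_apply, AddMemClass.coe_add]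
  abel

theorem m₃_add₃ (x y z z' : D.Cohomology) : S.m₃ x y (z + z') = S.m₃ x y z + S.m₃ x y z' := by
  rw [m₃, m₃, m₃, ← map_add]
  refine congrArg D.toCohomology (Subtype.ext ?_)
  simp only [Phi, map_add, mul_add, AddMemClass.coe_add]
  abel

theorem m₃_smul₁ (c : k) (x y z : D.Cohomology) : S.m₃ (c • x) y z = c • S.m₃ x y z := by
  rw [m₃, m₃, ← map_smul]
  refine congrArg D.toCohomology (Subtype.ext ?_)
  simp only [Phi, map_smul, smul_mul_assoc, LinearMap.smul_apply, SetLike.val_smul, smul_add,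
    smul_sub]

theorem m₃_smul₂ (c : k) (x y z : D.Cohomology) : S.m₃ x (c • y) z = c • S.m₃ x y z := by
  rw [m₃, m₃, ← map_smul]
  refine congrArg D.toCohomology (Subtype.ext ?_)
  simp only [Phi, map_smul, smul_mul_assoc, mul_smul_comm, LinearMap.smul_apply,
    SetLike.val_smul, smul_add, smul_sub]

theorem m₃_smul₃ (c : k) (x y z : D.Cohomology) : S.m₃ x y (c • z) = c • S.m₃ x y z := by
  rw [m₃, m₃, ← map_smul]
  refine congrArg D.toCohomology (Subtype.ext ?_)
  simp only [Phi, map_smul, mul_smul_comm, SetLike.val_smul, smul_add, smul_sub]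

/-- The secondary multiplication is a Hochschild cocycle. -/
theorem m₃_cocycle (x y z w : D.Cohomology) :
    signTwist D.cohGrading (-1) x * S.m₃ y z w - S.m₃ (x * y) z w + S.m₃ x (y * z) w -
      S.m₃ x y (z * w) + S.m₃ x y z * w = 0 := by
  have hf : ∀ v, D.toCohomology ⟨S.f₁ v, S.d_f₁ v⟩ = v := S.toCohomology_f₁
  rw [← hf (signTwist D.cohGrading (-1) x)]
  nth_rewrite 5 [← hf w]
  rw [m₃, m₃, m₃, m₃, m₃, ← map_mul, ← map_mul, ← map_sub, ← map_add, ← map_sub, ← map_add,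
    D.toCohomology_eq_zero]
  have hs : signTwist 𝒜 (-1) (S.f₂ (signTwist D.cohGrading (-1) x)
      (signTwist D.cohGrading (-1) y)) = - S.f₂ x y := by
    have h : (S.f₂.compl₁₂ (signTwist D.cohGrading (-1)) (signTwist D.cohGrading (-1))).compr₂
        (signTwist 𝒜 (-1)) = - S.f₂ := by
      refine ext_homogeneous D.cohGrading fun i x hx => ext_homogeneous D.cohGrading fun j y hy => ?_
      simp only [LinearMap.compr₂_apply, LinearMap.compl₁₂_apply, LinearMap.neg_apply]
      rw [signTwist_of_mem _ _ hx, signTwist_of_mem _ _ hy, map_zsmul S.f₂,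
        LinearMap.smul_apply, map_zsmul, map_zsmul, map_zsmul,
        signTwist_of_mem _ _ (S.f₂_mem i j x hx y hy), smul_smul, smul_smul, ← Units.val_mul,
        ← Units.val_mul, ← Int.negOnePow_add, ← Int.negOnePow_add,
        show -1 * i + -1 * j + -1 * (i + j - 1) = 2 * (-(i + j)) + 1 by ring,
        Int.negOnePow_two_mul_add_one]
      simp
    exact LinearMap.congr_fun₂ h x y
  refine ⟨- (S.f₂ (signTwist D.cohGrading (-1) x) (signTwist D.cohGrading (-1) y) * S.f₂ z w), ?_⟩
  rw [map_neg, D.d_mul, hs, S.d_f₂, S.d_f₂, ← signTwist_mul]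
  simp only [Subalgebra.coe_add, Subalgebra.coe_sub, Subalgebra.coe_mul, Phi, signTwist_mul,
    mul_assoc]
  noncomm_ring

/-- The multilinear map `(x_0, …, x_4) ↦ (-1)^|x_0| x_0 m₃(x_1, x_2, x_3) x_4`. -/
def m₃Multilinear : MultilinearMap k (fun _ : Fin 5 => D.Cohomology) D.Cohomology :=
  multilinearFive
    (fun x y z w v => signTwist D.cohGrading (-1) x * S.m₃ y z w * v)
    (fun x x' y z w v => by rw [map_add, add_mul, add_mul])
    (fun x y y' z w v => by rw [m₃_add₁, mul_add, add_mul])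
    (fun x y z z' w v => by rw [m₃_add₂, mul_add, add_mul])
    (fun x y z w w' v => by rw [m₃_add₃, mul_add, add_mul])
    (fun x y z w v v' => by rw [mul_add])
    (fun c x y z w v => by rw [map_smul, smul_mul_assoc, smul_mul_assoc])
    (fun c x y z w v => by rw [m₃_smul₁, mul_smul_comm, smul_mul_assoc])
    (fun c x y z w v => by rw [m₃_smul₂, mul_smul_comm, smul_mul_assoc])
    (fun c x y z w v => by rw [m₃_smul₃, mul_smul_comm, smul_mul_assoc])
    (fun c x y z w v => by rw [mul_smul_comm])

/-- The Hochschild cochain of bidegree `(3, -1)` given by the secondary multiplication. -/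
def m₃Cochain : BarTerm k D.Cohomology 3 →ₗ[k] D.Cohomology :=
  PiTensorProduct.lift S.m₃Multilinear

theorem m₃Cochain_tprod (x : Fin 5 → D.Cohomology) :
    S.m₃Cochain (PiTensorProduct.tprod k x) =
      signTwist D.cohGrading (-1) (x 0) * S.m₃ (x 1) (x 2) (x 3) * x 4 := by
  rw [m₃Cochain, PiTensorProduct.lift.tprod]
  rfl

theorem m₃Cochain_mem : S.m₃Cochain ∈ (bar D.cohGrading).cocycles (-1) 3 := by
  refine ⟨⟨fun i => ?_, fun a x => ?_, fun a x => ?_⟩, ?_⟩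
  · refine barGrading_map S.m₃Cochain _ fun e x hx he => ?_
    rw [m₃Cochain_tprod]
    have h := SetLike.GradedMul.mul_mem (SetLike.GradedMul.mul_mem
      (signTwist_mem D.cohGrading (-1) (hx 0)) (S.m₃_mem (hx 1) (hx 2) (hx 3))) (hx 4)
    have h1 : e 0 + e 1 + e 2 + e 3 + e 4 = i := by
      rw [← he]; exact (Fin.sum_univ_five e).symm
    rwa [show e 0 + (e 1 + e 2 + e 3 - 1) + e 4 = i + -1 by rw [← h1]; ring] at h
  · suffices S.m₃Cochain ∘ₗ barLeft k D.Cohomology 3 a =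
        LinearMap.mulLeft k (signTwist D.cohGrading (-1) a) ∘ₗ S.m₃Cochain from
      LinearMap.congr_fun this x
    ext x
    simp only [LinearMap.compMultilinearMap_apply, LinearMap.comp_apply, barLeft_tprod,
      LinearMap.mulLeft_apply, m₃Cochain_tprod]
    simp [Function.update, signTwist_mul, mul_assoc]
  · suffices S.m₃Cochain ∘ₗ barRight k D.Cohomology 3 a =
        LinearMap.mulRight k a ∘ₗ S.m₃Cochain from LinearMap.congr_fun this x
    ext x
    simp only [LinearMap.compMultilinearMap_apply, LinearMap.comp_apply, barRight_tprod,
      LinearMap.mulRight_apply, m₃Cochain_tprod]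
    have h : (Fin.last 4 : Fin 5) = 4 := rfl
    simp [h, Function.update, mul_assoc]
  · suffices S.m₃Cochain ∘ₗ barD k D.Cohomology 3 = 0 from this
    ext x
    simp only [LinearMap.compMultilinearMap_apply, LinearMap.comp_apply, barD_tprod,
      map_sum, map_smul, m₃Cochain_tprod, LinearMap.zero_apply]
    have h := congrArg (fun v => signTwist D.cohGrading (-1) (x 0) * v * x 5)
      (S.m₃_cocycle (x 1) (x 2) (x 3) (x 4))
    simp only [mul_zero, zero_mul] at h
    rw [← h]
    simp [Finset.sum_range_succ, contract, signTwist_mul]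
    have h3 : (-1 : k) ^ 3 = -1 := by norm_num
    have h4 : (-1 : k) ^ 4 = 1 := by norm_num
    rw [h3, h4, neg_smul, one_smul, one_smul]
    simp only [mul_add, mul_sub, add_mul, sub_mul, mul_assoc]
    abel

/-- The canonical class `μ_A` in `HH^{3,-1}(H^*A)` of a dg algebra `A`, the class of the secondary
multiplication. -/
def canonicalClass : HH D.cohGrading 3 (-1) :=
  (bar D.cohGrading).cls 3 (-1) ⟨S.m₃Cochain, S.m₃Cochain_mem⟩

end SecondaryData

end CanonicalClass

end DGHoch

end

open DGHoch

/-!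
Let `φ : R → T` be the flat epimorphism `H^*ψ`. Both `𝔹(T)` and `T ⊗_R 𝔹(R) ⊗_R T` are complexes of
projective `(T, T)`-bimodules (`IsRelHom.exists_lift`, `IsBimoduleHom.exists_lift_baseChange`), and
both are resolutions of `T`. For `𝔹(T)` this is the usual contraction (`bar_exact`). For the other
complex, `𝔹(R) ⊗_R T` augmented by `T` is a contractible complex, and flatness of `T` as a
right `R`-module, in the form of the equational criterion `mem_kernelSpan_of_flat`, keeps it exact
after `T ⊗_R -` (`baseChange_exact`); in degree zero the homology is `T ⊗_R T`, which is `T` since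
`φ` is an epimorphism (`tmul_sub_mem_span_of_epi`, `baseChange_exact_zero`). Hence the mapping cone
of `η` is exact and projective, so it splits (`IsComparison.exists_splitting`), and `η^*` is
bijective (`etaStar_bijective`). The lifting ignores the gradings; the component of the required
degree is taken afterwards (`homogenize`).

Cochains on `T ⊗_R 𝔹(R) ⊗_R T` are cochains of `R` with values in `T` (`relCoch`). In these terms
`Γ[ζ] = [f]` holds exactly when the restriction of `f` to `R` is cohomologous to `φ ∘ ζ`; the
direction used is `Gamma_cls`, and `exists_Gamma_cls` provides such an `f`. Restriction to `R` and
composition with `φ` both respect units and cup products, and the cup product of cochains of `R`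
with values in `T` satisfies the Leibniz rule (`relCup_d`). So `Γ` is a homomorphism of algebras
(`Gamma_one`, `Gamma_cup`).

For the canonical classes, the choices `(f₁, f₂)` for `A` composed with `ψ`, and those for `B`
composed with `H^*ψ`, are two choices of the same kind of data along `H^*ψ`. Two such choices have
secondary multiplications which differ by a Hochschild coboundary
(`RelSecondaryData.exists_m₃_sub`), that is, the restriction of the cocycle of `B` and the
composition of the cocycle of `A` with `H^*ψ` are cohomologous (`Gamma_canonicalClass`).
-/

universe w₁ w₂ w₃ w₄

noncomputable section

namespace DGHoch

/-! ### Flat epimorphisms of rings -/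

section FlatEpimorphism

variable {R : Type v} [Ring R] {T : Type w} [Ring T] {φ : R →+* T}

/-- The additive group of tuples `(∑ s φ(a_j))_j` generated by those with `a` in the kernel of a map
`G` between free left modules; this is the image of `T ⊗_R ker G` in `T^p`. -/
def kernelSpan (φ : R →+* T) {p q : ℕ} (G : (Fin p → R) →ₗ[R] (Fin q → R)) :
    AddSubgroup (Fin p → T) :=
  AddSubgroup.closure {v | ∃ (s : T) (a : Fin p → R), G a = 0 ∧ v = fun j => s * φ (a j)}

/-- The map `T ⊗_R (range G) → T^p / (T · ker G)`, `t ⊗ G(a) ↦ [(t φ(a_j))_j]`. -/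
def rangeTensorMap (φ : R →+* T) {p q : ℕ} (G : (Fin p → R) →ₗ[R] (Fin q → R)) :
    letI : Module Rᵐᵒᵖ T := Module.compHom T (RingHom.op φ)
    NCTensor R T (LinearMap.range G) →+ (Fin p → T) ⧸ kernelSpan φ G :=
  letI : Module Rᵐᵒᵖ T := Module.compHom T (RingHom.op φ)
  -- The map does not depend on the choice of the preimages, which makes it additive.
  let c : LinearMap.range G → (Fin p → R) := fun x => x.2.choose
  have hc : ∀ x, G (c x) = x := fun x => x.2.choose_spec
  have key : ∀ (t : T) (a b : Fin p → R), G a = G b →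
      ((fun j => t * φ (a j) : Fin p → T) : (Fin p → T) ⧸ kernelSpan φ G) =
        (fun j => t * φ (b j) : Fin p → T) := fun t a b h => by
    rw [QuotientAddGroup.eq]
    refine AddSubgroup.subset_closure ⟨t, - a + b, by simp [h], ?_⟩
    ext j
    simp [mul_add]
  QuotientAddGroup.lift _
    (TensorProduct.liftAddHom
      (AddMonoidHom.mk' (fun t => AddMonoidHom.mk'
          (fun x => ((fun j => t * φ (c x j) : Fin p → T) : (Fin p → T) ⧸ kernelSpan φ G))
          (fun x y => by
            rw [key t (c (x + y)) (c x + c y) (by simp [hc]), ← QuotientAddGroup.mk_add]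
            congr 1
            ext j
            simp [mul_add]))
        (fun t s => by
          ext x
          change ((fun j => (t + s) * φ (c x j) : Fin p → T) : (Fin p → T) ⧸ kernelSpan φ G) =
            (fun j => t * φ (c x j) : Fin p → T) + (fun j => s * φ (c x j) : Fin p → T)
          rw [← QuotientAddGroup.mk_add]
          congr 1
          ext j
          simp [add_mul]))
      (fun n t x => by
        rw [map_zsmul, map_zsmul]
        rfl)) <| by
    rw [ncBalancing, AddSubgroup.closure_le]
    rintro _ ⟨t, r, x, rfl⟩
    change _ = _
    rw [map_sub, sub_eq_zero]
    change ((fun j => (t * φ r) * φ (c x j) : Fin p → T) : (Fin p → T) ⧸ kernelSpan φ G) =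
      (fun j => t * φ (c (r • x) j) : Fin p → T)
    rw [key t (c (r • x)) (r • c x) (by simp [hc])]
    congr 1
    ext j
    simp [mul_assoc]

theorem rangeTensorMap_tmul {p q : ℕ} (G : (Fin p → R) →ₗ[R] (Fin q → R)) (t : T)
    (a : Fin p → R) :
    letI : Module Rᵐᵒᵖ T := Module.compHom T (RingHom.op φ)
    rangeTensorMap φ G (QuotientAddGroup.mk (t ⊗ₜ[ℤ] (⟨G a, a, rfl⟩ : LinearMap.range G))) =
      QuotientAddGroup.mk (fun j => t * φ (a j)) := by
  let _ : Module Rᵐᵒᵖ T := Module.compHom T (RingHom.op φ)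
  let x : LinearMap.range G := ⟨G a, a, rfl⟩
  change ((fun j => t * φ (x.2.choose j) : Fin p → T) : (Fin p → T) ⧸ kernelSpan φ G) = _
  rw [QuotientAddGroup.eq]
  have h : G x.2.choose = G a := x.2.choose_spec
  refine AddSubgroup.subset_closure ⟨t, - x.2.choose + a, by simp [h], ?_⟩
  ext j
  simp [mul_add]

/-- The equational criterion: over a flat right module, every relation is a consequence of
relations in the ring. -/
theorem mem_kernelSpan_of_flat
    (hφ : letI : Module Rᵐᵒᵖ T := Module.compHom T (RingHom.op φ); IsFlatRight R T)
    {p q : ℕ} (G : (Fin p → R) →ₗ[R] (Fin q → R)) (t : Fin p → T)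
    (ht : ∀ i, ∑ j, t j * φ (G (Pi.single j 1) i) = 0) : t ∈ kernelSpan φ G := by
  let _ : Module Rᵐᵒᵖ T := Module.compHom T (RingHom.op φ)
  let e : Fin p → LinearMap.range G := fun j => ⟨G (Pi.single j 1), _, rfl⟩
  let mk : T ⊗[ℤ] (LinearMap.range G) →+ NCTensor R T (LinearMap.range G) :=
    QuotientAddGroup.mk' _
  let mk' : T ⊗[ℤ] (Fin q → R) →+ NCTensor R T (Fin q → R) := QuotientAddGroup.mk' _
  -- By flatness the relation already holds in `T ⊗_R (range G)`, where `rangeTensorMap` applies.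
  have h0 : mk (∑ j, t j ⊗ₜ[ℤ] e j) = 0 := by
    refine hφ _ _ (LinearMap.range G).subtype (LinearMap.range G).injective_subtype ?_
    rw [map_zero]
    change mk' (TensorProduct.map _ _ (∑ j, t j ⊗ₜ[ℤ] e j)) = 0
    have h1 : ∀ (s : T) (y : Fin q → R), mk' (s ⊗ₜ[ℤ] y) =
        ∑ i, mk' ((s * φ (y i)) ⊗ₜ[ℤ] Pi.single i 1) := by
      intro s y
      have h2 : ∀ i, mk' ((s * φ (y i)) ⊗ₜ[ℤ] Pi.single i 1) =
          mk' (s ⊗ₜ[ℤ] (y i • Pi.single i (1 : R))) := fun i => by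
        rw [← sub_eq_zero, ← map_sub]
        exact (QuotientAddGroup.eq_zero_iff _).2
          (AddSubgroup.subset_closure ⟨s, y i, Pi.single i 1, rfl⟩)
      simp only [h2]
      rw [← map_sum, ← TensorProduct.tmul_sum]
      congr 2
      ext i
      rw [Finset.sum_apply, Finset.sum_eq_single i]
      · rw [Pi.smul_apply, Pi.single_eq_same, smul_eq_mul, mul_one]
      · intro j _ hj
        rw [Pi.smul_apply, Pi.single_eq_of_ne hj.symm, smul_zero]
      · exact fun h => absurd (Finset.mem_univ i) h
    rw [map_sum, map_sum]
    change ∑ j, mk' (t j ⊗ₜ[ℤ] (e j : Fin q → R)) = 0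
    rw [Finset.sum_congr rfl fun j _ => h1 (t j) (e j), Finset.sum_comm]
    refine Finset.sum_eq_zero fun i _ => ?_
    rw [← map_sum, ← TensorProduct.sum_tmul, ht i, TensorProduct.zero_tmul, map_zero]
  have h3 := congrArg (rangeTensorMap φ G) h0
  rw [map_zero, map_sum, map_sum] at h3
  have h4 : ∀ j, rangeTensorMap φ G (mk (t j ⊗ₜ[ℤ] e j)) =
      QuotientAddGroup.mk (fun i => t j * φ ((Pi.single j 1 : Fin p → R) i)) :=
    fun j => rangeTensorMap_tmul G (t j) (Pi.single j 1)
  rw [Finset.sum_congr rfl fun j _ => h4 j] at h3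
  have h5 : ∑ j, (QuotientAddGroup.mk (fun i => t j * φ ((Pi.single j 1 : Fin p → R) i)) :
      (Fin p → T) ⧸ kernelSpan φ G) = QuotientAddGroup.mk' (kernelSpan φ G) t := by
    have h6 : t = ∑ j, fun i => t j * φ ((Pi.single j 1 : Fin p → R) i) := by
      ext i
      simp [Finset.sum_apply, Pi.single_apply, apply_ite φ]
    conv_rhs => rw [h6, map_sum]
    rfl
  rw [h5] at h3
  exact (QuotientAddGroup.eq_zero_iff _).1 h3

/-- For an epimorphism of rings `φ : R → T`, the elements `s ⊗ t` and `1 ⊗ s t` agree in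
`T ⊗_R T`: conjugation by the unipotent automorphism `(t, e) ↦ (t, e + 1 ⊗ t)` of
`T ⊕ (T ⊗_R T)` fixes the action of `R`, hence also that of `T`. -/
theorem tmul_sub_mem_span_of_epi {k : Type u} [Field k] [Algebra k T]
    (hφ : ∀ (S : Type w) [Ring S] (α β : T →+* S), α.comp φ = β.comp φ → α = β) (s t : T) :
    s ⊗ₜ[k] t - 1 ⊗ₜ[k] (s * t) ∈ Submodule.span T
      {z : T ⊗[k] T | ∃ r y, z = φ r ⊗ₜ[k] y - 1 ⊗ₜ[k] (φ r * y)} := by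
  set J := Submodule.span T {z : T ⊗[k] T | ∃ r y, z = φ r ⊗ₜ[k] y - 1 ⊗ₜ[k] (φ r * y)}
  let E := (T ⊗[k] T) ⧸ J
  let q : T ⊗[k] T →ₗ[T] E := J.mkQ
  let one : T →+ E := AddMonoidHom.mk' (fun t => q (1 ⊗ₜ[k] t))
    (fun a b => by rw [TensorProduct.tmul_add, map_add])
  let S := AddMonoid.End (T × E)
  let α : T →+* S := Module.toAddMonoidEnd T (T × E)
  have hα : ∀ a x, α a x = a • x := fun a x => rfl
  -- `up f` is the unipotent automorphism `(t, e) ↦ (t, e + f t)`.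
  let up : ∀ _ : T →+ E, S := fun f => AddMonoidHom.mk' (fun x => (x.1, x.2 + f x.1))
    (fun x y => by
      refine Prod.ext rfl ?_
      simp only [Prod.snd_add, Prod.fst_add, map_add]
      abel)
  have hup : ∀ f x, up f x = (x.1, x.2 + f x.1) := fun f x => rfl
  have hinv : ∀ f, up f * up (-f) = 1 := fun f => by
    refine AddMonoidHom.ext fun x => ?_
    change up f (up (-f) x) = x
    rw [hup, hup]
    refine Prod.ext rfl ?_
    simp
  have hinv' : ∀ f, up (-f) * up f = 1 := fun f => by
    have := hinv (-f)
    rwa [neg_neg] at this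
  -- The action `α` of `T` on `T × E`, conjugated by `up one`.
  let β : T →+* S :=
    { toFun := fun a => up one * α a * up (-one)
      map_one' := by rw [map_one, mul_one, hinv]
      map_zero' := by rw [map_zero, mul_zero, zero_mul]
      map_add' := fun a b => by rw [map_add, mul_add, add_mul]
      map_mul' := fun a b => by
        calc up one * α (a * b) * up (-one)
            = up one * α a * (1 * (α b * up (-one))) := by rw [map_mul]; noncomm_ring
          _ = up one * α a * up (-one) * (up one * α b * up (-one)) := by
            rw [← hinv' one]; noncomm_ring }
  have hβ : ∀ a, β a = up one * α a * up (-one) := fun a => rfl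
  have hcomm : ∀ r, up one * α (φ r) = α (φ r) * up one := fun r => by
    refine AddMonoidHom.ext fun x => ?_
    change up one (α (φ r) x) = α (φ r) (up one x)
    rw [hup, hup, hα, hα]
    refine Prod.ext rfl ?_
    change φ r • x.2 + q (1 ⊗ₜ[k] (φ r * x.1)) = φ r • (x.2 + q (1 ⊗ₜ[k] x.1))
    rw [smul_add, ← map_smul, TensorProduct.smul_tmul', smul_eq_mul, mul_one]
    congr 1
    exact ((Submodule.Quotient.eq J).2 (Submodule.subset_span ⟨r, x.1, rfl⟩)).symm
  have hab : α = β := hφ S α β <| by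
    ext r : 1
    rw [RingHom.comp_apply, RingHom.comp_apply, hβ, hcomm, mul_assoc, hinv, mul_one]
  have h1 : α s * up one = up one * α s := by
    conv_lhs => rw [hab, hβ, mul_assoc, hinv', mul_one]
  have h2 := congrArg Prod.snd (DFunLike.congr_fun h1 ((t, 0) : T × E))
  change s • ((0 : E) + q (1 ⊗ₜ[k] t)) = s • (0 : E) + q (1 ⊗ₜ[k] (s * t)) at h2
  rw [zero_add, smul_zero, zero_add, ← map_smul, TensorProduct.smul_tmul', smul_eq_mul, mul_one]
    at h2
  exact (Submodule.Quotient.eq J).1 h2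

end FlatEpimorphism

/-! ### The bar resolution and its freeness -/

section Contraction

variable {k : Type u} [Field k] {Λ : Type v} [Ring Λ] [Algebra k Λ]

variable (k Λ) in
/-- The contraction `(x_0, …, x_{n+1}) ↦ (1, x_0, …, x_{n+1})` of the bar resolution. -/
def barCons (n : ℕ) : BarTerm k Λ n →ₗ[k] BarTerm k Λ (n + 1) :=
  PiTensorProduct.lift <| MultilinearMap.mk'
    (fun x => PiTensorProduct.tprod k (Fin.cons 1 x : Fin (n + 3) → Λ))
    (fun x q a b => by simp only [Fin.cons_update, MultilinearMap.map_update_add])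
    (fun x q c a => by simp only [Fin.cons_update, MultilinearMap.map_update_smul])

theorem barCons_tprod (n : ℕ) (x : Fin (n + 2) → Λ) :
    barCons k Λ n (PiTensorProduct.tprod k x) =
      PiTensorProduct.tprod k (Fin.cons 1 x : Fin (n + 3) → Λ) :=
  PiTensorProduct.lift.tprod _

theorem contract_zero_cons {n : ℕ} (x : Fin (n + 1) → Λ) :
    contract 0 (Fin.cons 1 x : Fin (n + 2) → Λ) = x := by
  ext ⟨p, hp⟩
  rcases Nat.eq_zero_or_pos p with rfl | h
  · exact one_mul _
  · simp only [contract, not_lt_zero, if_false, if_neg h.ne', Fin.cons_succ]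

theorem contract_succ_cons {n : ℕ} (i : ℕ) (a : Λ) (x : Fin (n + 1) → Λ) :
    contract (i + 1) (Fin.cons a x : Fin (n + 2) → Λ) = Fin.cons a (contract i x) := by
  ext p
  refine Fin.cases ?_ (fun p => ?_) p
  · simp [contract]
  · simp only [contract, Fin.val_succ, Fin.cons_succ, add_lt_add_iff_right, add_left_inj,
      ← Fin.succ_castSucc]

theorem barD_barCons (n : ℕ) (z : BarTerm k Λ (n + 1)) :
    barD k Λ (n + 1) (barCons k Λ (n + 1) z) = z - barCons k Λ n (barD k Λ n z) := by
  suffices barD k Λ (n + 1) ∘ₗ barCons k Λ (n + 1) =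
      LinearMap.id - barCons k Λ n ∘ₗ barD k Λ n from LinearMap.congr_fun this z
  ext x
  simp only [LinearMap.compMultilinearMap_apply, LinearMap.comp_apply, LinearMap.sub_apply,
    LinearMap.id_apply, barCons_tprod, barD_tprod, map_sum, map_smul]
  rw [Finset.sum_range_succ', contract_zero_cons, pow_zero, one_smul,
    add_comm _ (PiTensorProduct.tprod k x), sub_eq_add_neg, ← Finset.sum_neg_distrib]
  congr 1
  refine Finset.sum_congr rfl fun i _ => ?_
  rw [contract_succ_cons, pow_succ, mul_neg_one, neg_smul]

/-- The contraction in degree zero, where the multiplication takes the place of the differential. -/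
theorem barD_barCons_zero (z : BarTerm k Λ 0) :
    barD k Λ 0 (barCons k Λ 0 z) =
      z - barRight k Λ 0 (mulCochain k Λ z) (PiTensorProduct.tprod k fun _ => 1) := by
  suffices barD k Λ 0 ∘ₗ barCons k Λ 0 =
      LinearMap.id - (barRight k Λ 0).flip (PiTensorProduct.tprod k fun _ => 1) ∘ₗ
        mulCochain k Λ from LinearMap.congr_fun this z
  ext x
  simp only [LinearMap.compMultilinearMap_apply, LinearMap.comp_apply, LinearMap.sub_apply,
    LinearMap.id_apply, barCons_tprod, barD_tprod, LinearMap.flip_apply, barRight_tprod,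
    mulCochain_tprod]
  rw [Finset.sum_range_succ', contract_zero_cons, pow_zero, one_smul, add_comm, sub_eq_add_neg]
  congr 1
  rw [Finset.sum_range_one, contract_succ_cons, pow_succ, pow_zero, one_mul, neg_smul, one_smul]
  congr 2
  ext p
  fin_cases p
  · rfl
  · simp [contract, Function.update]

/-- The bar resolution is exact in positive degrees. -/
theorem bar_exact (n : ℕ) (z : BarTerm k Λ (n + 1)) (hz : barD k Λ n z = 0) :
    ∃ y, barD k Λ (n + 1) y = z :=
  ⟨barCons k Λ (n + 1) z, by rw [barD_barCons, hz, map_zero, sub_zero]⟩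

/-- The bar resolution, augmented by the multiplication, is exact in degree zero. -/
theorem bar_exact_zero (z : BarTerm k Λ 0) (hz : mulCochain k Λ z = 0) :
    ∃ y, barD k Λ 0 y = z :=
  ⟨barCons k Λ 0 z, by rw [barD_barCons_zero, hz, map_zero, LinearMap.zero_apply, sub_zero]⟩

end Contraction

section BimoduleMaps

variable {k : Type u} [Field k] {T : Type w} [Ring T] [Algebra k T]
  {𝒯 : ℤ → Submodule k T} [GradedAlgebra 𝒯]

/-- A homomorphism of `(T, T)`-bimodules between terms of two complexes of bimodules; it need not
respect the gradings. -/
def IsBimoduleHom {P : BimoduleComplex.{u, w, w₁} 𝒯} {Q : BimoduleComplex.{u, w, w₂} 𝒯} {m n : ℕ}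
    (f : P.X m →ₗ[k] Q.X n) : Prop :=
  (∀ a x, f (P.left m a x) = Q.left n a (f x)) ∧ ∀ a x, f (P.right m a x) = Q.right n a (f x)

variable (𝒯) in
/-- The bimodule `T` with the left multiplication twisted by the Koszul sign `(-1)^(t * |a|)` and
the grading shifted by `t`, repeated in every degree with zero differentials. Cochains of degree `t`
are bimodule homomorphisms of degree zero with values in it. -/
def twistedCoefficients (t : ℤ) : BimoduleComplex.{u, w, w} 𝒯 where
  X _ := T
  gr _ i := 𝒯 (i + t)
  left _ := LinearMap.mul k T ∘ₗ signTwist 𝒯 t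
  right _ := (LinearMap.mul k T).flip
  left_one _ x := by simp [signTwist_one]
  left_mul _ a b x := by simp [signTwist_mul, mul_assoc]
  right_one _ x := by simp
  right_mul _ a b x := by simp [mul_assoc]
  left_right _ a b x := by simp [mul_assoc]
  left_mem _ i j a ha x hx := by
    rw [add_assoc]
    exact SetLike.GradedMul.mul_mem (signTwist_mem 𝒯 t ha) hx
  right_mem _ i j a ha x hx := by
    rw [add_right_comm]
    exact SetLike.GradedMul.mul_mem hx ha
  d _ := 0
  d_left _ a x := by simp
  d_right _ a x := by simp
  d_mem _ i x _ := zero_mem _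
  d_d _ x := rfl

end BimoduleMaps

section FreeExtension

variable {k : Type u} [Field k] {R : Type v} [Ring R] [Algebra k R] {T : Type w} [Ring T]
  [Algebra k T] {𝒯 : ℤ → Submodule k T} [GradedAlgebra 𝒯]

/-- A homomorphism of `(R, R)`-bimodules from `𝔹(R)_n` to a `(T, T)`-bimodule, regarded as an
`(R, R)`-bimodule through `φ : R → T`. -/
def IsRelHom (φ : R →ₐ[k] T) {N : BimoduleComplex.{u, w, w₁} 𝒯} {n m : ℕ}
    (f : BarTerm k R n →ₗ[k] N.X m) : Prop :=
  (∀ a x, f (barLeft k R n a x) = N.left m (φ a) (f x)) ∧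
    ∀ a x, f (barRight k R n a x) = N.right m (φ a) (f x)

/-- The tuple `(1, x_1, …, x_n, 1)`. -/
def core {n : ℕ} (x : Fin (n + 2) → R) : Fin (n + 2) → R :=
  Function.update (Function.update x 0 1) (Fin.last (n + 1)) 1

theorem core_update_zero {n : ℕ} (x : Fin (n + 2) → R) (a : R) :
    core (Function.update x 0 a) = core x := by
  rw [core, core, Function.update_idem]

theorem core_update_last {n : ℕ} (x : Fin (n + 2) → R) (a : R) :
    core (Function.update x (Fin.last (n + 1)) a) = core x := by
  have h : (0 : Fin (n + 2)) ≠ Fin.last (n + 1) := (Fin.last_pos).ne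
  rw [core, core, Function.update_comm h.symm, Function.update_idem]

theorem core_update_of_ne {n : ℕ} (x : Fin (n + 2) → R) {q : Fin (n + 2)} (h0 : q ≠ 0)
    (h1 : q ≠ Fin.last (n + 1)) (a : R) :
    core (Function.update x q a) = Function.update (core x) q a := by
  rw [core, core, Function.update_comm h0, Function.update_comm h1]

theorem tprod_eq_core {n : ℕ} (x : Fin (n + 2) → R) :
    PiTensorProduct.tprod k x = barLeft k R n (x 0) (barRight k R n (x (Fin.last (n + 1)))
      (PiTensorProduct.tprod k (core x))) := by
  have h : (0 : Fin (n + 2)) ≠ Fin.last (n + 1) := (Fin.last_pos).ne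
  rw [barRight_tprod, barLeft_tprod]
  congr 1
  ext p
  by_cases h0 : p = 0
  · subst h0; simp [core, h]
  · by_cases h1 : p = Fin.last (n + 1)
    · subst h1; simp [core, h0]
    · simp [core, h0, h1]

/-- The bimodule `𝔹(R)_n` is generated by the tensors `(1, x_1, …, x_n, 1)`. -/
theorem IsRelHom.ext {φ : R →ₐ[k] T} {N : BimoduleComplex.{u, w, w₁} 𝒯} {n m : ℕ}
    {f g : BarTerm k R n →ₗ[k] N.X m} (hf : IsRelHom φ f) (hg : IsRelHom φ g)
    (h : ∀ x, f (PiTensorProduct.tprod k (core x)) = g (PiTensorProduct.tprod k (core x))) :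
    f = g := by
  ext x
  rw [LinearMap.compMultilinearMap_apply, LinearMap.compMultilinearMap_apply, tprod_eq_core,
    hf.1, hg.1, hf.2, hg.2, h]

theorem IsRelHom.comp {φ : R →ₐ[k] T} {N : BimoduleComplex.{u, w, w₁} 𝒯}
    {N' : BimoduleComplex.{u, w, w₂} 𝒯} {n m m' : ℕ} {f : BarTerm k R n →ₗ[k] N.X m}
    (hf : IsRelHom φ f) {g : N.X m →ₗ[k] N'.X m'} (hg : IsBimoduleHom g) :
    IsRelHom φ (g ∘ₗ f) :=
  ⟨fun a x => (congrArg g (hf.1 a x)).trans (hg.1 _ _),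
    fun a x => (congrArg g (hf.2 a x)).trans (hg.2 _ _)⟩

/-- The bimodule homomorphism `(x_0, …, x_{n+1}) ↦ φ(x_0) f(1, x_1, …, x_n, 1) φ(x_{n+1})`; it
exists for every linear map `f`, since `𝔹(R)_n` is a free bimodule. -/
def freeExt (φ : R →ₐ[k] T) (N : BimoduleComplex.{u, w, w₁} 𝒯) (n m : ℕ)
    (f : BarTerm k R n →ₗ[k] N.X m) : BarTerm k R n →ₗ[k] N.X m :=
  PiTensorProduct.lift <| MultilinearMap.mk'
    (fun x => N.left m (φ (x 0)) (N.right m (φ (x (Fin.last (n + 1))))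
      (f (PiTensorProduct.tprod k (core x)))))
    (fun x q a b => by
      have h : (0 : Fin (n + 2)) ≠ Fin.last (n + 1) := (Fin.last_pos).ne
      by_cases h0 : q = 0
      · subst h0
        simp only [core_update_zero, Function.update_self, Function.update_of_ne h.symm, map_add,
          LinearMap.add_apply]
      · by_cases h1 : q = Fin.last (n + 1)
        · subst h1
          simp only [core_update_last, Function.update_self, Function.update_of_ne h, map_add,
            LinearMap.add_apply]
        · simp only [core_update_of_ne x h0 h1, Function.update_of_ne (Ne.symm h0),
            Function.update_of_ne (Ne.symm h1), MultilinearMap.map_update_add, map_add])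
    (fun x q c a => by
      have h : (0 : Fin (n + 2)) ≠ Fin.last (n + 1) := (Fin.last_pos).ne
      by_cases h0 : q = 0
      · subst h0
        simp only [core_update_zero, Function.update_self, Function.update_of_ne h.symm, map_smul,
          LinearMap.smul_apply]
      · by_cases h1 : q = Fin.last (n + 1)
        · subst h1
          simp only [core_update_last, Function.update_self, Function.update_of_ne h, map_smul,
            LinearMap.smul_apply]
        · simp only [core_update_of_ne x h0 h1, Function.update_of_ne (Ne.symm h0),
            Function.update_of_ne (Ne.symm h1), MultilinearMap.map_update_smul, map_smul])

theorem freeExt_tprod (φ : R →ₐ[k] T) (N : BimoduleComplex.{u, w, w₁} 𝒯) (n m : ℕ)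
    (f : BarTerm k R n →ₗ[k] N.X m) (x : Fin (n + 2) → R) :
    freeExt φ N n m f (PiTensorProduct.tprod k x) = N.left m (φ (x 0))
      (N.right m (φ (x (Fin.last (n + 1)))) (f (PiTensorProduct.tprod k (core x)))) :=
  PiTensorProduct.lift.tprod _

theorem freeExt_core (φ : R →ₐ[k] T) (N : BimoduleComplex.{u, w, w₁} 𝒯) (n m : ℕ)
    (f : BarTerm k R n →ₗ[k] N.X m) (x : Fin (n + 2) → R) :
    freeExt φ N n m f (PiTensorProduct.tprod k (core x)) =
      f (PiTensorProduct.tprod k (core x)) := by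
  have h : (0 : Fin (n + 2)) ≠ Fin.last (n + 1) := (Fin.last_pos).ne
  have h0 : core x 0 = 1 := by simp [core, h]
  have h1 : core x (Fin.last (n + 1)) = 1 := by simp [core]
  have h2 : core (core x) = core x := by
    ext p
    by_cases hp : p = Fin.last (n + 1)
    · subst hp; simp [core]
    · by_cases hp' : p = 0
      · subst hp'; simp [core]
      · simp [core, hp, hp']
  rw [freeExt_tprod, h0, h1, h2, map_one, N.left_one, N.right_one]

theorem freeExt_isRelHom (φ : R →ₐ[k] T) (N : BimoduleComplex.{u, w, w₁} 𝒯) (n m : ℕ)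
    (f : BarTerm k R n →ₗ[k] N.X m) : IsRelHom φ (freeExt φ N n m f) := by
  have h : (0 : Fin (n + 2)) ≠ Fin.last (n + 1) := (Fin.last_pos).ne
  constructor
  · intro a x
    suffices freeExt φ N n m f ∘ₗ barLeft k R n a = N.left m (φ a) ∘ₗ freeExt φ N n m f from
      LinearMap.congr_fun this x
    ext x
    simp only [LinearMap.compMultilinearMap_apply, LinearMap.comp_apply, barLeft_tprod,
      freeExt_tprod, core_update_zero, Function.update_self, Function.update_of_ne h.symm, map_mul,
      N.left_mul]
  · intro a x
    suffices freeExt φ N n m f ∘ₗ barRight k R n a = N.right m (φ a) ∘ₗ freeExt φ N n m f from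
      LinearMap.congr_fun this x
    ext x
    simp only [LinearMap.compMultilinearMap_apply, LinearMap.comp_apply, barRight_tprod,
      freeExt_tprod, core_update_last, Function.update_self, Function.update_of_ne h, map_mul,
      N.right_mul, N.left_right]

/-- The term `𝔹(R)_n` has the lifting property of a projective bimodule: a `k`-linear lift, which
exists over a field, is made into a bimodule homomorphism by `freeExt`. -/
theorem IsRelHom.exists_lift {φ : R →ₐ[k] T} {N : BimoduleComplex.{u, w, w₁} 𝒯}
    {N' : BimoduleComplex.{u, w, w₂} 𝒯} {n m m' : ℕ} {f : BarTerm k R n →ₗ[k] N.X m}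
    (hf : IsRelHom φ f) {g : N'.X m' →ₗ[k] N.X m} (hg : IsBimoduleHom g)
    (hr : ∀ x, ∃ y, g y = f x) :
    ∃ h : BarTerm k R n →ₗ[k] N'.X m', IsRelHom φ h ∧ g ∘ₗ h = f := by
  obtain ⟨s, hs⟩ := SecondaryData.exists_ginv g
  have h1 := freeExt_isRelHom φ N' n m' (s ∘ₗ f)
  refine ⟨_, h1, IsRelHom.ext (h1.comp hg) hf fun x => ?_⟩
  obtain ⟨y, hy⟩ := hr (PiTensorProduct.tprod k (core x))
  rw [LinearMap.comp_apply, freeExt_core, LinearMap.comp_apply, ← hy, hs]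

end FreeExtension

/-! ### The complex `T ⊗_R 𝔹(R) ⊗_R T` -/

section FreeBimodule

variable {k : Type u} [Field k] {R : Type v} [Ring R] [Algebra k R] {T : Type w} [Ring T]
  [Algebra k T]

/-- The bimodule `R ⊗ V ⊗ T`, on which `R` acts from the right through `φ : R → T`, repeated in
every degree with zero differentials and the trivial grading. -/
def freeBimodule (ℛ : ℤ → Submodule k R) [GradedAlgebra ℛ] (φ : R →ₐ[k] T) (V : Type w₁)
    [AddCommGroup V] [Module k V] : BimoduleComplex.{u, v, max v w w₁} ℛ where
  X _ := R ⊗[k] (V ⊗[k] T)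
  gr _ _ := ⊤
  left _ := LinearMap.rTensorHom (V ⊗[k] T) ∘ₗ LinearMap.mul k R
  right _ := LinearMap.lTensorHom R ∘ₗ LinearMap.lTensorHom V ∘ₗ (LinearMap.mul k T).flip ∘ₗ
    φ.toLinearMap
  left_one _ x := by
    rw [LinearMap.comp_apply, show LinearMap.mul k R 1 = LinearMap.id from LinearMap.ext one_mul]
    exact LinearMap.rTensor_id_apply _ _ _
  left_mul _ a b x := by
    rw [LinearMap.comp_apply, show LinearMap.mul k R (a * b) = LinearMap.mul k R a ∘ₗ
      LinearMap.mul k R b from LinearMap.ext (mul_assoc a b)]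
    exact LinearMap.rTensor_comp_apply _ _ _ _
  right_one _ x := by
    induction x using TensorProduct.induction_on with
    | zero => simp
    | add x y hx hy => rw [map_add, hx, hy]
    | tmul r y =>
      induction y using TensorProduct.induction_on with
      | zero => simp
      | add x y hx hy => rw [TensorProduct.tmul_add, map_add, hx, hy]
      | tmul v t => simp
  right_mul _ a b x := by
    induction x using TensorProduct.induction_on with
    | zero => simp
    | add x y hx hy => rw [map_add, map_add, map_add, hx, hy]
    | tmul r y =>
      induction y using TensorProduct.induction_on with
      | zero => simp
      | add x y hx hy => rw [TensorProduct.tmul_add, map_add, map_add, map_add, hx, hy]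
      | tmul v t => simp [mul_assoc]
  left_right _ a b x := by
    change (LinearMap.rTensor _ _ ∘ₗ LinearMap.lTensor _ _) x =
      (LinearMap.lTensor _ _ ∘ₗ LinearMap.rTensor _ _) x
    rw [LinearMap.rTensor_comp_lTensor, LinearMap.lTensor_comp_rTensor]
  left_mem _ _ _ _ _ _ _ := Submodule.mem_top
  right_mem _ _ _ _ _ _ _ := Submodule.mem_top
  d _ := 0
  d_left _ a x := by simp
  d_right _ a x := by simp
  d_mem _ i x _ := Submodule.mem_top
  d_d _ x := rfl

/-- The equational criterion of flatness for relations in a free module `R ⊗ W`. -/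
theorem mem_closure_of_flat {φ : R →ₐ[k] T}
    (hφ : letI : Module Rᵐᵒᵖ T := Module.compHom T (RingHom.op φ.toRingHom); IsFlatRight R T)
    {W : Type w₁} [AddCommGroup W] [Module k W] {p : ℕ} (m : Fin p → R ⊗[k] W) (t : Fin p → T)
    (ht : ∑ j, LinearMap.rTensor W (LinearMap.mulLeft k (t j) ∘ₗ φ.toLinearMap) (m j) = 0) :
    t ∈ AddSubgroup.closure {v | ∃ (s : T) (a : Fin p → R), ∑ j, a j • m j = 0 ∧
      v = fun j => s * φ (a j)} := by
  classical
  -- Coordinates with respect to a basis of `W` lead to relations in the finite free module on the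
  -- set `I` of the basis vectors which occur.
  let b := Module.Basis.ofVectorSpace k W
  let bR := Algebra.TensorProduct.basis R b
  let bT := Algebra.TensorProduct.basis T b
  have hb : ∀ (s : T) (y : R ⊗[k] W) i,
      bT.repr (LinearMap.rTensor W (LinearMap.mulLeft k s ∘ₗ φ.toLinearMap) y) i =
        s * φ (bR.repr y i) := by
    intro s y i
    induction y using TensorProduct.induction_on with
    | zero => simp
    | add x y hx hy => simp only [map_add, Finsupp.add_apply, hx, hy, mul_add]
    | tmul r x => simp [bT, bR, mul_assoc]
  let I : Finset _ := Finset.univ.biUnion fun j => (bR.repr (m j)).support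
  let e := I.equivFin
  let G : (Fin p → R) →ₗ[R] (Fin I.card → R) :=
    { toFun := fun a i => bR.repr (∑ j, a j • m j) (e.symm i)
      map_add' := fun a a' => by
        ext i
        simp only [Pi.add_apply, add_smul, Finset.sum_add_distrib, map_add, Finsupp.add_apply]
      map_smul' := fun c a => by
        ext i
        simp only [Pi.smul_apply, smul_eq_mul, RingHom.id_apply, mul_smul, ← Finset.smul_sum,
          map_smul, Finsupp.smul_apply] }
  have hG : ∀ a i, G a i = bR.repr (∑ j, a j • m j) (e.symm i) := fun a i => rfl
  have hmem := mem_kernelSpan_of_flat hφ G t fun i => by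
    have h1 : ∀ j, t j * φ (G (Pi.single j 1) i) =
        bT.repr (LinearMap.rTensor W (LinearMap.mulLeft k (t j) ∘ₗ φ.toLinearMap) (m j))
          (e.symm i) := fun j => by
      rw [hb, hG]
      have h2 : ∑ j', (Pi.single j 1 : Fin p → R) j' • m j' = m j := by
        rw [Finset.sum_eq_single j, Pi.single_eq_same, one_smul]
        · intro j' _ hj
          rw [Pi.single_eq_of_ne hj, zero_smul]
        · exact fun h => absurd (Finset.mem_univ j) h
      rw [h2]
    refine (Finset.sum_congr rfl fun j _ => h1 j).trans ?_
    rw [← Finsupp.finsetSum_apply, ← map_sum, ht, map_zero,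
      Finsupp.zero_apply]
  refine AddSubgroup.closure_mono ?_ hmem
  rintro _ ⟨s, a, ha, rfl⟩
  refine ⟨s, a, bR.repr.injective ?_, rfl⟩
  rw [map_zero]
  ext i
  by_cases hi : i ∈ I
  · have := congrFun ha (e ⟨i, hi⟩)
    rwa [hG, Equiv.symm_apply_apply] at this
  · rw [map_sum, Finsupp.finsetSum_apply]
    refine Finset.sum_eq_zero fun j _ => ?_
    have h1 : bR.repr (m j) i = 0 := by
      by_contra h
      exact hi (Finset.mem_biUnion.2 ⟨j, Finset.mem_univ j, Finsupp.mem_support_iff.2 h⟩)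
    rw [map_smul, Finsupp.smul_apply, h1, smul_zero]

end FreeBimodule

section BaseChangeHom

variable {k : Type u} [Field k] {R : Type v} [Ring R] [Algebra k R] {T : Type w} [Ring T]
  [Algebra k T] {ℛ : ℤ → Submodule k R} [GradedAlgebra ℛ] {𝒯 : ℤ → Submodule k T}
  [GradedAlgebra 𝒯] (φ : ℛ →ₐᵍ[k] 𝒯)

/-- The quotient map `T ⊗ 𝔹(R)_n ⊗ T → T ⊗_R 𝔹(R)_n ⊗_R T`. -/
def barMk (n : ℕ) : T ⊗[k] (BarTerm k R n ⊗[k] T) →ₗ[k] (bar ℛ).BCTerm φ n := (bar ℛ).bcMk φ n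

theorem barMk_surjective (n : ℕ) : Function.Surjective (barMk φ n) :=
  ((bar ℛ).balancing φ n).mkQ_surjective

theorem barMk_left (n : ℕ) (s : T) (a : R) (x : BarTerm k R n) (t : T) :
    barMk φ n ((s * φ a) ⊗ₜ[k] (x ⊗ₜ[k] t)) = barMk φ n (s ⊗ₜ[k] (barLeft k R n a x ⊗ₜ[k] t)) :=
  (bar ℛ).bcTmul_left φ n s a x t

theorem barMk_right (n : ℕ) (s : T) (a : R) (x : BarTerm k R n) (t : T) :
    barMk φ n (s ⊗ₜ[k] (barRight k R n a x ⊗ₜ[k] t)) = barMk φ n (s ⊗ₜ[k] (x ⊗ₜ[k] (φ a * t))) :=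
  (bar ℛ).bcTmul_right φ n s a x t

theorem bcD_barMk (n : ℕ) (s : T) (y : BarTerm k R (n + 1) ⊗[k] T) :
    (bar ℛ).bcD φ n (barMk φ (n + 1) (s ⊗ₜ[k] y)) =
      barMk φ n (s ⊗ₜ[k] LinearMap.rTensor T (barD k R n) y) := rfl

theorem bcLeft_barMk (n : ℕ) (b s : T) (y : BarTerm k R n ⊗[k] T) :
    (bar ℛ).bcLeft φ n b (barMk φ n (s ⊗ₜ[k] y)) = barMk φ n ((b * s) ⊗ₜ[k] y) := rfl

theorem bcRight_barMk (n : ℕ) (b s : T) (x : BarTerm k R n) (t : T) :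
    (bar ℛ).bcRight φ n b (barMk φ n (s ⊗ₜ[k] (x ⊗ₜ[k] t))) =
      barMk φ n (s ⊗ₜ[k] (x ⊗ₜ[k] (t * b))) := rfl

theorem eta_barMk (n : ℕ) (s : T) (x : BarTerm k R n) (t : T) :
    eta φ n (barMk φ n (s ⊗ₜ[k] (x ⊗ₜ[k] t))) =
      barLeft k T n s (barRight k T n t (barMap φ n x)) := rfl

variable {φ} in
theorem barMk_ext {M : Type*} [AddCommGroup M] [Module k M] {n : ℕ}
    {f g : (bar ℛ).BCTerm φ n →ₗ[k] M}
    (h : ∀ s x t, f (barMk φ n (s ⊗ₜ[k] (PiTensorProduct.tprod k x ⊗ₜ[k] t))) =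
      g (barMk φ n (s ⊗ₜ[k] (PiTensorProduct.tprod k x ⊗ₜ[k] t)))) : f = g := by
  have h1 : f ∘ₗ barMk φ n = g ∘ₗ barMk φ n := by
    ext s x t
    exact h s x t
  ext z
  obtain ⟨z, rfl⟩ := barMk_surjective φ n z
  exact LinearMap.congr_fun h1 z

/-- The map `x ↦ 1 ⊗ x ⊗ 1` from `𝔹(R)_n` to `T ⊗_R 𝔹(R)_n ⊗_R T`. -/
def bcUnit (n : ℕ) : BarTerm k R n →ₗ[k] (bar ℛ).BCTerm φ n :=
  barMk φ n ∘ₗ TensorProduct.mk k T _ 1 ∘ₗ (TensorProduct.mk k (BarTerm k R n) T).flip 1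

theorem bcUnit_apply (n : ℕ) (x : BarTerm k R n) :
    bcUnit φ n x = barMk φ n (1 ⊗ₜ[k] (x ⊗ₜ[k] 1)) := rfl

theorem barMk_eq_bcUnit (n : ℕ) (s : T) (x : BarTerm k R n) (t : T) :
    barMk φ n (s ⊗ₜ[k] (x ⊗ₜ[k] t)) =
      (bar ℛ).bcLeft φ n s ((bar ℛ).bcRight φ n t (bcUnit φ n x)) := by
  rw [bcUnit_apply, bcRight_barMk, bcLeft_barMk, mul_one, one_mul]

theorem bcUnit_isRelHom (n : ℕ) :
    IsRelHom (N := (bar ℛ).baseChange φ) (m := n) φ.toAlgHom (bcUnit φ n) := by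
  constructor
  · intro a x
    change bcUnit φ n (barLeft k R n a x) = (bar ℛ).bcLeft φ n (φ a) (bcUnit φ n x)
    rw [bcUnit_apply, ← barMk_left, bcUnit_apply, bcLeft_barMk, one_mul, mul_one]
  · intro a x
    change bcUnit φ n (barRight k R n a x) = (bar ℛ).bcRight φ n (φ a) (bcUnit φ n x)
    rw [bcUnit_apply, barMk_right, bcUnit_apply, bcRight_barMk, one_mul, mul_one]

theorem eta_bcUnit (n : ℕ) (x : BarTerm k R n) : eta φ n (bcUnit φ n x) = barMap φ n x := by
  rw [bcUnit_apply, eta_barMk]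
  exact ((bar 𝒯).left_one n _).trans ((bar 𝒯).right_one n _)

variable {φ} {N : BimoduleComplex.{u, w, w₁} 𝒯} {n m : ℕ}

/-- The extension of a bimodule homomorphism on `𝔹(R)_n` to `T ⊗_R 𝔹(R)_n ⊗_R T`. -/
def IsRelHom.extend {f : BarTerm k R n →ₗ[k] N.X m} (hf : IsRelHom φ.toAlgHom f) :
    (bar ℛ).BCTerm φ n →ₗ[k] N.X m :=
  BimoduleComplex.bcLift (TensorProduct.lift (N.left m) ∘ₗ
      TensorProduct.map LinearMap.id (TensorProduct.lift ((N.right m).flip ∘ₗ f)))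
    (fun s a x t => by
      refine (N.left_mul m s (φ a) _).trans ?_
      refine congrArg (N.left m s) ((N.left_right m (φ a) t _).trans ?_)
      exact congrArg (N.right m t) (hf.1 a x).symm)
    (fun s a x t => by
      refine congrArg (N.left m s) (Eq.trans ?_ (N.right_mul m (φ a) t _).symm)
      exact congrArg (N.right m t) (hf.2 a x))

theorem IsRelHom.extend_barMk {f : BarTerm k R n →ₗ[k] N.X m} (hf : IsRelHom φ.toAlgHom f) (s : T)
    (x : BarTerm k R n) (t : T) :
    hf.extend (barMk φ n (s ⊗ₜ[k] (x ⊗ₜ[k] t))) = N.left m s (N.right m t (f x)) := rfl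

theorem IsRelHom.extend_bcUnit {f : BarTerm k R n →ₗ[k] N.X m} (hf : IsRelHom φ.toAlgHom f)
    (x : BarTerm k R n) : hf.extend (bcUnit φ n x) = f x := by
  rw [bcUnit_apply, hf.extend_barMk, N.left_one, N.right_one]

theorem IsRelHom.extend_isBimoduleHom {f : BarTerm k R n →ₗ[k] N.X m}
    (hf : IsRelHom φ.toAlgHom f) :
    IsBimoduleHom (P := (bar ℛ).baseChange φ) (m := n) hf.extend := by
  constructor
  · intro b z
    suffices hf.extend ∘ₗ (bar ℛ).bcLeft φ n b = N.left m b ∘ₗ hf.extend from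
      LinearMap.congr_fun this z
    exact barMk_ext fun s x t => N.left_mul m b s _
  · intro b z
    suffices hf.extend ∘ₗ (bar ℛ).bcRight φ n b = N.right m b ∘ₗ hf.extend from
      LinearMap.congr_fun this z
    exact barMk_ext fun s x t =>
      (congrArg (N.left m s) (N.right_mul m t b _)).trans (N.left_right m s b _)

/-- The bimodule `T ⊗_R 𝔹(R)_n ⊗_R T` is generated by the elements `1 ⊗ x ⊗ 1`. -/
theorem IsBimoduleHom.bc_ext {f g : (bar ℛ).BCTerm φ n →ₗ[k] N.X m}
    (hf : IsBimoduleHom (P := (bar ℛ).baseChange φ) (m := n) f)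
    (hg : IsBimoduleHom (P := (bar ℛ).baseChange φ) (m := n) g)
    (h : ∀ x, f (bcUnit φ n x) = g (bcUnit φ n x)) : f = g := by
  refine barMk_ext fun s x t => ?_
  rw [barMk_eq_bcUnit]
  refine (hf.1 _ _).trans (Eq.trans ?_ (hg.1 _ _).symm)
  refine congrArg (N.left m s) ((hf.2 _ _).trans (Eq.trans ?_ (hg.2 _ _).symm))
  exact congrArg (N.right m t) (h _)

/-- The term `T ⊗_R 𝔹(R)_n ⊗_R T` has the lifting property of a projective bimodule. -/
theorem IsBimoduleHom.exists_lift_baseChange {f : (bar ℛ).BCTerm φ n →ₗ[k] N.X m}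
    (hf : IsBimoduleHom (P := (bar ℛ).baseChange φ) (m := n) f)
    {N' : BimoduleComplex.{u, w, w₂} 𝒯} {m' : ℕ} {g : N'.X m' →ₗ[k] N.X m} (hg : IsBimoduleHom g)
    (hr : ∀ x, ∃ y, g y = f x) :
    ∃ h : (bar ℛ).BCTerm φ n →ₗ[k] N'.X m',
      IsBimoduleHom (P := (bar ℛ).baseChange φ) (m := n) h ∧ g ∘ₗ h = f := by
  obtain ⟨h, hh, hgh⟩ := ((bcUnit_isRelHom φ n).comp hf).exists_lift hg fun x => hr _
  refine ⟨hh.extend, hh.extend_isBimoduleHom, IsBimoduleHom.bc_ext ⟨fun a x => ?_, fun a x => ?_⟩ hf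
    fun x => ?_⟩
  · exact (congrArg g (hh.extend_isBimoduleHom.1 a x)).trans (hg.1 _ _)
  · exact (congrArg g (hh.extend_isBimoduleHom.2 a x)).trans (hg.2 _ _)
  · rw [LinearMap.comp_apply, hh.extend_bcUnit]
    exact LinearMap.congr_fun hgh x

end BaseChangeHom

section BaseChangeExact

variable {k : Type u} [Field k] {R : Type v} [Ring R] [Algebra k R] {T : Type w} [Ring T]
  [Algebra k T] {ℛ : ℤ → Submodule k R} [GradedAlgebra ℛ] {𝒯 : ℤ → Submodule k T}
  [GradedAlgebra 𝒯] (φ : ℛ →ₐᵍ[k] 𝒯)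

theorem barCons_barRight (n : ℕ) (a : R) (x : BarTerm k R n) :
    barCons k R n (barRight k R n a x) = barRight k R (n + 1) a (barCons k R n x) := by
  suffices barCons k R n ∘ₗ barRight k R n a = barRight k R (n + 1) a ∘ₗ barCons k R n from
    LinearMap.congr_fun this x
  ext x
  simp only [LinearMap.compMultilinearMap_apply, LinearMap.comp_apply, barRight_tprod,
    barCons_tprod, Fin.cons_update]
  rfl

/-- The isomorphism of `𝔹(R)_n ⊗_R T` with a free left `R`-module, as a map on `𝔹(R)_n ⊗ T`:
`(x_0, …, x_{n+1}) ⊗ t ↦ x_0 ⊗ (1, x_1, …, x_n, 1) ⊗ φ(x_{n+1}) t`. Only injectivity matters, so the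
space of generators is not cut down to the tensors `(1, x_1, …, x_n, 1) ⊗ t`. -/
def leftCoord (n : ℕ) : BarTerm k R n ⊗[k] T →ₗ[k] R ⊗[k] (BarTerm k R n ⊗[k] T) :=
  let F : BarTerm k R n →ₗ[k] R ⊗[k] (BarTerm k R n ⊗[k] T) :=
    freeExt (AlgHom.id k R) (freeBimodule ℛ φ.toAlgHom (BarTerm k R n)) n 0
      (TensorProduct.mk k R _ 1 ∘ₗ (TensorProduct.mk k (BarTerm k R n) T).flip 1)
  TensorProduct.lift ((LinearMap.lTensorHom R ∘ₗ LinearMap.lTensorHom (BarTerm k R n) ∘ₗ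
    (LinearMap.mul k T).flip).flip ∘ₗ F)

theorem leftCoord_tmul (n : ℕ) (x : Fin (n + 2) → R) (t : T) :
    leftCoord φ n (PiTensorProduct.tprod k x ⊗ₜ[k] t) =
      x 0 ⊗ₜ[k] (PiTensorProduct.tprod k (core x) ⊗ₜ[k] (φ (x (Fin.last (n + 1))) * t)) := by
  have h := freeExt_tprod (AlgHom.id k R) (freeBimodule ℛ φ.toAlgHom (BarTerm k R n)) n 0
      (TensorProduct.mk k R _ 1 ∘ₗ (TensorProduct.mk k (BarTerm k R n) T).flip 1) x
  refine (congrArg (LinearMap.lTensor R (LinearMap.lTensor (BarTerm k R n)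
    ((LinearMap.mul k T).flip t))) h).trans ?_
  change (x 0 * 1) ⊗ₜ[k] (PiTensorProduct.tprod k (core x) ⊗ₜ[k]
    (1 * φ (x (Fin.last (n + 1))) * t)) = _
  rw [mul_one, one_mul]

theorem leftCoord_left (n : ℕ) (a : R) (y : BarTerm k R n ⊗[k] T) :
    leftCoord φ n (LinearMap.rTensor T (barLeft k R n a) y) = a • leftCoord φ n y := by
  suffices leftCoord φ n ∘ₗ LinearMap.rTensor T (barLeft k R n a) =
      LinearMap.rTensor _ (LinearMap.mulLeft k a) ∘ₗ leftCoord φ n by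
    refine (LinearMap.congr_fun this y).trans ?_
    rw [LinearMap.comp_apply]
    generalize leftCoord φ n y = z
    induction z using TensorProduct.induction_on with
    | zero => rw [map_zero, smul_zero]
    | add x y hx hy => rw [map_add, hx, hy, smul_add]
    | tmul r z => rfl
  ext x t
  have h : (0 : Fin (n + 2)) ≠ Fin.last (n + 1) := (Fin.last_pos).ne
  simp [barLeft_tprod, leftCoord_tmul, core_update_zero, h.symm]

/-- The isomorphism of `T ⊗_R 𝔹(R)_n ⊗_R T` with a free bimodule, into a larger one:
`s ⊗ (x_0, …, x_{n+1}) ⊗ t ↦ s φ(x_0) ⊗ (1, x_1, …, x_n, 1) ⊗ φ(x_{n+1}) t`. -/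
def bcCoord (n : ℕ) : (bar ℛ).BCTerm φ n →ₗ[k] T ⊗[k] (BarTerm k R n ⊗[k] T) :=
  (freeExt_isRelHom φ.toAlgHom (freeBimodule 𝒯 (AlgHom.id k T) (BarTerm k R n)) n 0
    (TensorProduct.mk k T _ 1 ∘ₗ (TensorProduct.mk k (BarTerm k R n) T).flip 1)).extend

theorem bcCoord_tmul (n : ℕ) (s : T) (x : Fin (n + 2) → R) (t : T) :
    bcCoord φ n (barMk φ n (s ⊗ₜ[k] (PiTensorProduct.tprod k x ⊗ₜ[k] t))) =
      (s * φ (x 0)) ⊗ₜ[k] (PiTensorProduct.tprod k (core x) ⊗ₜ[k]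
        (φ (x (Fin.last (n + 1))) * t)) := by
  have h := freeExt_tprod φ.toAlgHom (freeBimodule 𝒯 (AlgHom.id k T) (BarTerm k R n)) n 0
    (TensorProduct.mk k T _ 1 ∘ₗ (TensorProduct.mk k (BarTerm k R n) T).flip 1) x
  refine (congrArg (fun z => (freeBimodule 𝒯 (AlgHom.id k T) (BarTerm k R n)).left 0 s
    ((freeBimodule 𝒯 (AlgHom.id k T) (BarTerm k R n)).right 0 t z)) h).trans ?_
  change (s * (φ (x 0) * 1)) ⊗ₜ[k] (PiTensorProduct.tprod k (core x) ⊗ₜ[k]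
    (1 * φ (x (Fin.last (n + 1))) * t)) = _
  rw [mul_one, one_mul]

theorem bcCoord_barMk (n : ℕ) (s : T) (y : BarTerm k R n ⊗[k] T) :
    bcCoord φ n (barMk φ n (s ⊗ₜ[k] y)) =
      LinearMap.rTensor _ (LinearMap.mulLeft k s ∘ₗ φ.toAlgHom.toLinearMap) (leftCoord φ n y) := by
  suffices bcCoord φ n ∘ₗ barMk φ n ∘ₗ TensorProduct.mk k T _ s =
      LinearMap.rTensor _ (LinearMap.mulLeft k s ∘ₗ φ.toAlgHom.toLinearMap) ∘ₗ leftCoord φ n from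
    LinearMap.congr_fun this y
  ext x t
  change bcCoord φ n (barMk φ n (s ⊗ₜ[k] (PiTensorProduct.tprod k x ⊗ₜ[k] t))) =
    LinearMap.rTensor _ _ (leftCoord φ n (PiTensorProduct.tprod k x ⊗ₜ[k] t))
  rw [bcCoord_tmul, leftCoord_tmul]
  rfl

/-- The contraction of `𝔹(R) ⊗_R T` is not `R`-linear, but it shows that `s ⊗ y` is a boundary for
every cycle `y` of this complex. -/
theorem barMk_mem_range (n : ℕ) (s : T) (y : BarTerm k R (n + 1) ⊗[k] T)
    (hy : leftCoord φ n (LinearMap.rTensor T (barD k R n) y) = 0) :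
    barMk φ (n + 1) (s ⊗ₜ[k] y) ∈ LinearMap.range ((bar ℛ).bcD φ (n + 1)) := by
  let K : R ⊗[k] (BarTerm k R n ⊗[k] T) →ₗ[k] (bar ℛ).BCTerm φ (n + 1) :=
    barMk φ (n + 1) ∘ₗ TensorProduct.mk k T _ s ∘ₗ LinearMap.rTensor T (barCons k R n) ∘ₗ
      TensorProduct.lift (LinearMap.rTensorHom T ∘ₗ barLeft k R n)
  -- The map `s ⊗ (contraction)` factors through `leftCoord`, hence it kills `d y`.
  have hK : K ∘ₗ leftCoord φ n =
      barMk φ (n + 1) ∘ₗ TensorProduct.mk k T _ s ∘ₗ LinearMap.rTensor T (barCons k R n) := by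
    ext x t
    change K (leftCoord φ n (PiTensorProduct.tprod k x ⊗ₜ[k] t)) =
      barMk φ (n + 1) (s ⊗ₜ[k] (barCons k R n (PiTensorProduct.tprod k x) ⊗ₜ[k] t))
    rw [leftCoord_tmul]
    change barMk φ (n + 1) (s ⊗ₜ[k] (barCons k R n (barLeft k R n (x 0)
      (PiTensorProduct.tprod k (core x))) ⊗ₜ[k] (φ (x (Fin.last (n + 1))) * t))) = _
    have h := (bar ℛ).left_right n (x 0) (x (Fin.last (n + 1))) (PiTensorProduct.tprod k (core x))
    rw [← barMk_right, ← barCons_barRight, tprod_eq_core x]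
    exact congrArg (fun z => barMk φ (n + 1) (s ⊗ₜ[k] (barCons k R n z ⊗ₜ[k] t))) h.symm
  refine ⟨barMk φ (n + 2) (s ⊗ₜ[k] LinearMap.rTensor T (barCons k R (n + 1)) y), ?_⟩
  have h1 : barD k R (n + 1) ∘ₗ barCons k R (n + 1) =
      LinearMap.id - barCons k R n ∘ₗ barD k R n := LinearMap.ext (barD_barCons n)
  rw [bcD_barMk, ← LinearMap.rTensor_comp_apply, h1, LinearMap.rTensor_sub, LinearMap.sub_apply,
    LinearMap.rTensor_id_apply, LinearMap.rTensor_comp_apply, TensorProduct.tmul_sub, map_sub]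
  have h2 := LinearMap.congr_fun hK (LinearMap.rTensor T (barD k R n) y)
  rw [LinearMap.comp_apply, hy, map_zero] at h2
  exact sub_eq_self.2 h2.symm

/-- If `T` is flat as a right `R`-module, then `T ⊗_R 𝔹(R) ⊗_R T` is exact in positive degrees. -/
theorem baseChange_exact
    (hφ : letI : Module Rᵐᵒᵖ T := Module.compHom T (RingHom.op φ.toAlgHom.toRingHom)
      IsFlatRight R T) (n : ℕ) (z : (bar ℛ).BCTerm φ (n + 1)) (hz : (bar ℛ).bcD φ n z = 0) :
    z ∈ LinearMap.range ((bar ℛ).bcD φ (n + 1)) := by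
  obtain ⟨z, rfl⟩ := barMk_surjective φ (n + 1) z
  obtain ⟨p, s, y, rfl⟩ := TensorProduct.exists_sum_tmul_eq z
  let Ψ : (Fin p → T) →+ (bar ℛ).BCTerm φ (n + 1) := AddMonoidHom.mk'
    (fun s => barMk φ (n + 1) (∑ j, s j ⊗ₜ[k] y j)) fun s s' => by
      simp only [Pi.add_apply, TensorProduct.add_tmul, Finset.sum_add_distrib, map_add]
  have h0 := congrArg (bcCoord φ n) hz
  simp only [map_sum, map_zero, bcD_barMk, bcCoord_barMk] at h0
  -- Flatness reduces to `s_j = t φ(a_j)` where `∑ a_j y_j` is a cycle of `𝔹(R) ⊗_R T`.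
  have h2 := mem_closure_of_flat hφ _ s h0
  change Ψ s ∈ (LinearMap.range ((bar ℛ).bcD φ (n + 1))).toAddSubgroup
  rw [← AddSubgroup.mem_comap]
  refine (AddSubgroup.closure_le _).2 ?_ h2
  rintro _ ⟨t, a, ha, rfl⟩
  change barMk φ (n + 1) (∑ j, (t * φ (a j)) ⊗ₜ[k] y j) ∈ LinearMap.range _
  have h3 : ∀ (r : R) (y : BarTerm k R (n + 1) ⊗[k] T),
      barMk φ (n + 1) ((t * φ r) ⊗ₜ[k] y) =
      barMk φ (n + 1) (t ⊗ₜ[k] LinearMap.rTensor T (barLeft k R (n + 1) r) y) := by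
    intro r y
    induction y using TensorProduct.induction_on with
    | zero => simp
    | add x y hx hy => rw [TensorProduct.tmul_add, map_add, map_add, hx, hy, TensorProduct.tmul_add,
        map_add]
    | tmul x t' => exact barMk_left φ (n + 1) t r x t'
  rw [map_sum, Finset.sum_congr rfl fun j _ => h3 (a j) (y j), ← map_sum, ← TensorProduct.tmul_sum]
  refine barMk_mem_range φ n t _ ?_
  rw [map_sum, map_sum, ← ha]
  refine Finset.sum_congr rfl fun j _ => ?_
  rw [← leftCoord_left]
  refine congrArg (leftCoord φ n) ?_
  rw [← LinearMap.rTensor_comp_apply, ← LinearMap.rTensor_comp_apply]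
  exact congrArg (fun f => LinearMap.rTensor T f (y j))
    (LinearMap.ext fun x => (bar ℛ).d_left n (a j) x)

/-- The element `s ⊗ (1, 1) ⊗ t` of `T ⊗_R 𝔹(R)_0 ⊗_R T`, linearly extended to `T ⊗ T`. -/
def tensorBarZero : T ⊗[k] T →ₗ[k] (bar ℛ).BCTerm φ 0 :=
  barMk φ 0 ∘ₗ LinearMap.lTensor T (TensorProduct.mk k (BarTerm k R 0) T
    (PiTensorProduct.tprod k fun _ => 1))

theorem tensorBarZero_tmul (s t : T) : tensorBarZero φ (s ⊗ₜ[k] t) =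
    barMk φ 0 (s ⊗ₜ[k] ((PiTensorProduct.tprod k fun _ => 1) ⊗ₜ[k] t)) := rfl

/-- The relations of `T ⊗_R T` are boundaries: `φ(r) ⊗ y - 1 ⊗ φ(r) y` comes from
`1 ⊗ (1, r, 1) ⊗ y`. -/
theorem tensorBarZero_mem_range (y : T ⊗[k] T) (hy : y ∈ Submodule.span T
      {z : T ⊗[k] T | ∃ r y, z = φ.toAlgHom.toRingHom r ⊗ₜ[k] y -
        1 ⊗ₜ[k] (φ.toAlgHom.toRingHom r * y)}) :
    tensorBarZero φ y ∈ LinearMap.range ((bar ℛ).bcD φ 0) := by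
  have hl : ∀ (s : T) y, tensorBarZero φ (s • y) = (bar ℛ).bcLeft φ 0 s (tensorBarZero φ y) := by
    intro s y
    induction y using TensorProduct.induction_on with
    | zero => rw [smul_zero, map_zero, map_zero]
    | add x y hx hy => rw [smul_add, map_add, map_add, map_add, hx, hy]
    | tmul x t => rfl
  induction hy using Submodule.span_induction with
  | zero => rw [map_zero]; exact zero_mem _
  | add x y _ _ hx hy => rw [map_add]; exact add_mem hx hy
  | smul a x _ hx =>
    obtain ⟨w, hw⟩ := hx
    rw [hl, ← hw]
    exact ⟨(bar ℛ).bcLeft φ 1 a w, ((bar ℛ).baseChange φ).d_left 0 a w⟩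
  | mem x hx =>
    obtain ⟨r, y, rfl⟩ := hx
    refine ⟨barMk φ 1 (1 ⊗ₜ[k] ((PiTensorProduct.tprod k ![1, r, 1]) ⊗ₜ[k] y)), ?_⟩
    have h2 : barD k R 0 (PiTensorProduct.tprod k ![1, r, 1]) =
        barLeft k R 0 r (PiTensorProduct.tprod k fun _ => 1) -
          barRight k R 0 r (PiTensorProduct.tprod k fun _ => 1) := by
      rw [barD_tprod, Finset.sum_range_succ, Finset.sum_range_one, pow_zero, one_smul, pow_one,
        neg_smul, one_smul, ← sub_eq_add_neg, barLeft_tprod, barRight_tprod]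
      congr 2
      · ext p; fin_cases p <;> simp [contract]
      · ext p; fin_cases p <;> simp [contract, Function.update]
    rw [bcD_barMk, LinearMap.rTensor_tmul, h2, TensorProduct.sub_tmul, TensorProduct.tmul_sub,
      map_sub, map_sub, ← barMk_left, barMk_right, one_mul]
    rfl

/-- If `φ` is an epimorphism, then `T ⊗_R 𝔹(R) ⊗_R T` has the homology `T ⊗_R T = T` in degree
zero. -/
theorem baseChange_exact_zero
    (hφ : ∀ (S : Type w) [Ring S] (α β : T →+* S),
      α.comp φ.toAlgHom.toRingHom = β.comp φ.toAlgHom.toRingHom → α = β)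
    (z : (bar ℛ).BCTerm φ 0) (hz : mulCochain k T (eta φ 0 z) = 0) :
    z ∈ LinearMap.range ((bar ℛ).bcD φ 0) := by
  -- Up to boundaries, `s ⊗ x ⊗ t` equals `1 ⊗ (1, 1) ⊗ s φ(x_0 x_1) t`.
  have h3 : (LinearMap.range ((bar ℛ).bcD φ 0)).mkQ ∘ₗ
      (LinearMap.id - tensorBarZero φ ∘ₗ TensorProduct.mk k T T 1 ∘ₗ mulCochain k T ∘ₗ eta φ 0) =
        0 := by
    refine barMk_ext fun s x t => ?_
    have h5 : barMk φ 0 (s ⊗ₜ[k] ((PiTensorProduct.tprod k x) ⊗ₜ[k] t)) =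
        tensorBarZero φ ((s * φ (x 0)) ⊗ₜ[k] (φ (x 1) * t)) := by
      have h7 : core x = fun _ => 1 := by
        ext p
        fin_cases p <;> simp [core, Function.update]
      rw [tensorBarZero_tmul, ← barMk_right, barMk_left, ← h7]
      exact congrArg (fun z => barMk φ 0 (s ⊗ₜ[k] (z ⊗ₜ[k] t))) (tprod_eq_core x)
    have h6 : mulCochain k T (eta φ 0 (barMk φ 0 (s ⊗ₜ[k] ((PiTensorProduct.tprod k x) ⊗ₜ[k] t)))) =
        (s * φ (x 0)) * (φ (x 1) * t) := by
      rw [eta_barMk, barMap_tprod, barRight_tprod, barLeft_tprod, mulCochain_tprod]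
      simp [Function.update]
    refine (Submodule.Quotient.mk_eq_zero _).2 ?_
    rw [LinearMap.sub_apply, LinearMap.id_apply, LinearMap.comp_apply, LinearMap.comp_apply,
      LinearMap.comp_apply, h6, h5, TensorProduct.mk_apply, ← map_sub]
    exact tensorBarZero_mem_range φ _ (tmul_sub_mem_span_of_epi hφ _ _)
  have h7 := (Submodule.Quotient.mk_eq_zero _).1 (LinearMap.congr_fun h3 z)
  rwa [LinearMap.sub_apply, LinearMap.id_apply, LinearMap.comp_apply, LinearMap.comp_apply,
    LinearMap.comp_apply, hz, map_zero, map_zero, sub_zero] at h7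

end BaseChangeExact

/-! ### Comparison of projective resolutions -/

section Cone

variable {k : Type u} [Field k] {T : Type w} [Ring T] [Algebra k T]
  {𝒯 : ℤ → Submodule k T} [GradedAlgebra 𝒯]

section Closure

variable {P : BimoduleComplex.{u, w, w₁} 𝒯} {Q : BimoduleComplex.{u, w, w₂} 𝒯}
  {N : BimoduleComplex.{u, w, w₃} 𝒯} {l m n : ℕ}

theorem IsBimoduleHom.id : IsBimoduleHom (LinearMap.id : P.X m →ₗ[k] P.X m) :=
  ⟨fun _ _ => rfl, fun _ _ => rfl⟩

theorem IsBimoduleHom.comp {g : Q.X m →ₗ[k] N.X n} {f : P.X l →ₗ[k] Q.X m} (hg : IsBimoduleHom g)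
    (hf : IsBimoduleHom f) : IsBimoduleHom (g ∘ₗ f) :=
  ⟨fun a x => (congrArg g (hf.1 a x)).trans (hg.1 _ _),
    fun a x => (congrArg g (hf.2 a x)).trans (hg.2 _ _)⟩

theorem IsBimoduleHom.add {f g : P.X l →ₗ[k] Q.X m} (hf : IsBimoduleHom f)
    (hg : IsBimoduleHom g) : IsBimoduleHom (f + g) :=
  ⟨fun a x => by rw [LinearMap.add_apply, LinearMap.add_apply, hf.1, hg.1, map_add],
    fun a x => by rw [LinearMap.add_apply, LinearMap.add_apply, hf.2, hg.2, map_add]⟩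

theorem IsBimoduleHom.sub {f g : P.X l →ₗ[k] Q.X m} (hf : IsBimoduleHom f)
    (hg : IsBimoduleHom g) : IsBimoduleHom (f - g) :=
  ⟨fun a x => by rw [LinearMap.sub_apply, LinearMap.sub_apply, hf.1, hg.1, map_sub],
    fun a x => by rw [LinearMap.sub_apply, LinearMap.sub_apply, hf.2, hg.2, map_sub]⟩

theorem BimoduleComplex.isBimoduleHom_d (P : BimoduleComplex.{u, w, w₁} 𝒯) (n : ℕ) :
    IsBimoduleHom (P.d n) := ⟨P.d_left n, P.d_right n⟩

end Closure

/-- The lifting property of a projective bimodule for the term `P_n`, in given universes. -/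
def HasLifting (P : BimoduleComplex.{u, w, w₁} 𝒯) (n : ℕ) : Prop :=
  ∀ (N : BimoduleComplex.{u, w, w₃} 𝒯) (N' : BimoduleComplex.{u, w, w₄} 𝒯) (m m' : ℕ)
    (f : P.X n →ₗ[k] N.X m) (g : N'.X m' →ₗ[k] N.X m), IsBimoduleHom f → IsBimoduleHom g →
    (∀ x, ∃ y, g y = f x) → ∃ h : P.X n →ₗ[k] N'.X m', IsBimoduleHom h ∧ g ∘ₗ h = f

variable {P : BimoduleComplex.{u, w, w₁} 𝒯} {Q : BimoduleComplex.{u, w, w₂} 𝒯}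

/-- A chain map of complexes of bimodules, which need not respect the gradings. -/
structure ChainMap (P : BimoduleComplex.{u, w, w₁} 𝒯) (Q : BimoduleComplex.{u, w, w₂} 𝒯) where
  /-- The components. -/
  f : ∀ n, P.X n →ₗ[k] Q.X n
  isBimoduleHom : ∀ n, IsBimoduleHom (f n)
  comm : ∀ n x, f n (P.d n x) = Q.d n (f (n + 1) x)

variable (η : ChainMap P Q)

/-- The mapping cone of `η : P → Q` in degrees `≥ 1`, shifted so that its term of degree `n` is
`Q_{n+1} ⊕ P_n`, with differential `(b, p) ↦ (d b + η p, - d p)` and the trivial grading. Its last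
term `Q_0` is split off as the target of `coneAug`. -/
def cone : BimoduleComplex.{u, w, max w₁ w₂} 𝒯 where
  X n := Q.X (n + 1) × P.X n
  gr _ _ := ⊤
  left n := LinearMap.prodMapLinear k _ _ _ _ k ∘ₗ (Q.left (n + 1)).prod (P.left n)
  right n := LinearMap.prodMapLinear k _ _ _ _ k ∘ₗ (Q.right (n + 1)).prod (P.right n)
  left_one _ x := Prod.ext (Q.left_one _ _) (P.left_one _ _)
  left_mul _ a b x := Prod.ext (Q.left_mul _ _ _ _) (P.left_mul _ _ _ _)
  right_one _ x := Prod.ext (Q.right_one _ _) (P.right_one _ _)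
  right_mul _ a b x := Prod.ext (Q.right_mul _ _ _ _) (P.right_mul _ _ _ _)
  left_right _ a b x := Prod.ext (Q.left_right _ _ _ _) (P.left_right _ _ _ _)
  left_mem _ _ _ _ _ _ _ := Submodule.mem_top
  right_mem _ _ _ _ _ _ _ := Submodule.mem_top
  d n := ((Q.d (n + 1)).coprod (η.f (n + 1))).prod (-(P.d n ∘ₗ LinearMap.snd k _ _))
  d_left n a x := by
    refine Prod.ext ?_ ?_
    · change Q.d _ (Q.left _ a x.1) + η.f _ (P.left _ a x.2) = Q.left _ a (Q.d _ x.1 + η.f _ x.2)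
      rw [Q.d_left, (η.isBimoduleHom _).1, map_add]
    · change - P.d _ (P.left _ a x.2) = P.left _ a (- P.d _ x.2)
      rw [P.d_left, map_neg]
  d_right n a x := by
    refine Prod.ext ?_ ?_
    · change Q.d _ (Q.right _ a x.1) + η.f _ (P.right _ a x.2) =
        Q.right _ a (Q.d _ x.1 + η.f _ x.2)
      rw [Q.d_right, (η.isBimoduleHom _).2, map_add]
    · change - P.d _ (P.right _ a x.2) = P.right _ a (- P.d _ x.2)
      rw [P.d_right, map_neg]
  d_mem _ _ _ _ := Submodule.mem_top
  d_d n x := by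
    refine Prod.ext ?_ ?_
    · change Q.d _ (Q.d _ x.1 + η.f _ x.2) + η.f _ (- P.d _ x.2) = 0
      rw [map_add, Q.d_d, map_neg, η.comm, zero_add, add_neg_cancel]
    · change - P.d _ (- P.d _ x.2) = 0
      rw [map_neg, P.d_d, neg_zero, neg_zero]

/-- The last differential `Q_1 ⊕ P_0 → Q_0` of the mapping cone. -/
def coneAug : (cone η).X 0 →ₗ[k] Q.X 0 := (Q.d 0).coprod (η.f 0)

theorem cone_d_apply (n : ℕ) (b : Q.X (n + 2)) (p : P.X (n + 1)) :
    (cone η).d n (b, p) = (Q.d (n + 1) b + η.f (n + 1) p, - P.d n p) := rfl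

theorem coneAug_apply (b : Q.X 1) (p : P.X 0) : coneAug η (b, p) = Q.d 0 b + η.f 0 p := rfl

theorem coneAug_isBimoduleHom : IsBimoduleHom (coneAug η) := by
  constructor
  · intro a x
    change Q.d _ (Q.left _ a x.1) + η.f _ (P.left _ a x.2) = Q.left _ a (Q.d _ x.1 + η.f _ x.2)
    rw [Q.d_left, (η.isBimoduleHom _).1, map_add]
  · intro a x
    change Q.d _ (Q.right _ a x.1) + η.f _ (P.right _ a x.2) = Q.right _ a (Q.d _ x.1 + η.f _ x.2)
    rw [Q.d_right, (η.isBimoduleHom _).2, map_add]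

theorem coneAug_d (x : (cone η).X 1) : coneAug η ((cone η).d 0 x) = 0 := by
  change Q.d _ (Q.d _ x.1 + η.f _ x.2) + η.f _ (- P.d _ x.2) = 0
  rw [map_add, Q.d_d, map_neg, η.comm, zero_add, add_neg_cancel]

theorem inl_isBimoduleHom (n : ℕ) : IsBimoduleHom (P := Q) (Q := cone η) (m := n + 1) (n := n)
    (LinearMap.inl k (Q.X (n + 1)) (P.X n)) :=
  ⟨fun a _ => Prod.ext rfl (map_zero (P.left n a)).symm,
    fun a _ => Prod.ext rfl (map_zero (P.right n a)).symm⟩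

theorem inr_isBimoduleHom (n : ℕ) : IsBimoduleHom (P := P) (Q := cone η) (m := n) (n := n)
    (LinearMap.inr k (Q.X (n + 1)) (P.X n)) :=
  ⟨fun a _ => Prod.ext (map_zero (Q.left (n + 1) a)).symm rfl,
    fun a _ => Prod.ext (map_zero (Q.right (n + 1) a)).symm rfl⟩

theorem HasLifting.cone {n : ℕ} (hQ : HasLifting.{u, w, w₂, w₃, w₄} Q (n + 1))
    (hP : HasLifting.{u, w, w₁, w₃, w₄} P n) :
    HasLifting.{u, w, max w₁ w₂, w₃, w₄} (cone η) n := by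
  intro N N' m m' f g hf hg hr
  obtain ⟨h, hh, hgh⟩ := hQ N N' m m' _ g (hf.comp (inl_isBimoduleHom η n)) hg (fun x => hr _)
  obtain ⟨h', hh', hgh'⟩ := hP N N' m m' _ g (hf.comp (inr_isBimoduleHom η n)) hg (fun x => hr _)
  refine ⟨h.coprod h', ⟨fun a x => ?_, fun a x => ?_⟩, LinearMap.prod_ext ?_ ?_⟩
  · change h (Q.left _ a x.1) + h' (P.left _ a x.2) = N'.left _ a (h x.1 + h' x.2)
    rw [hh.1, hh'.1, map_add]
  · change h (Q.right _ a x.1) + h' (P.right _ a x.2) = N'.right _ a (h x.1 + h' x.2)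
    rw [hh.2, hh'.2, map_add]
  · refine LinearMap.ext fun x => Eq.trans (congrArg g ?_) (LinearMap.congr_fun hgh x)
    change h x + h' 0 = h x
    rw [map_zero, add_zero]
  · refine LinearMap.ext fun x => Eq.trans (congrArg g ?_) (LinearMap.congr_fun hgh' x)
    change h 0 + h' x = h' x
    rw [map_zero, zero_add]

variable {N : BimoduleComplex.{u, w, w₃} 𝒯} {m : ℕ}

/-- The comparison of two projective resolutions: termwise projectivity of `P` and `Q`, and
exactness of the mapping cone of `η : P → Q`. -/
structure IsComparison : Prop where
  lift_zero : HasLifting.{u, w, w₂, w₂, max w₁ w₂} Q 0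
  lift : ∀ n, HasLifting.{u, w, max w₁ w₂, max w₁ w₂, max w₁ w₂} (cone η) n
  surjective : Function.Surjective (coneAug η)
  exact_zero : ∀ c, coneAug η c = 0 → ∃ c', (cone η).d 0 c' = c
  exact : ∀ n c, (cone η).d n c = 0 → ∃ c', (cone η).d (n + 1) c' = c

namespace IsComparison

variable {η}

theorem exists_section (H : IsComparison η) : ∃ s : Q.X 0 →ₗ[k] (cone η).X 0,
    IsBimoduleHom s ∧ coneAug η ∘ₗ s = LinearMap.id :=
  H.lift_zero Q (cone η) 0 0 LinearMap.id (coneAug η) IsBimoduleHom.id (coneAug_isBimoduleHom η)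
    (fun x => H.surjective x)

/-- Every module of boundaries of the mapping cone is a direct summand, by induction: if `h` splits
off the boundaries in one degree, then `1 - h d` maps to the cycles in the next degree and can be
lifted. -/
theorem exists_splitting (H : IsComparison η) (n : ℕ) : ∃ h : (cone η).X n →ₗ[k] (cone η).X (n + 1),
    IsBimoduleHom h ∧ ∀ x, (cone η).d n (h ((cone η).d n x)) = (cone η).d n x := by
  induction n with
  | zero =>
    obtain ⟨s, hs, hs'⟩ := H.exists_section
    have hs'' : ∀ x, coneAug η (s x) = x := LinearMap.congr_fun hs'
    obtain ⟨h, hh, hh'⟩ := H.lift 0 (cone η) (cone η) 0 1 (LinearMap.id - s ∘ₗ coneAug η)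
      ((cone η).d 0) (IsBimoduleHom.id.sub (hs.comp (coneAug_isBimoduleHom η)))
      ((cone η).isBimoduleHom_d 0) (fun x => H.exact_zero _ (by
        rw [LinearMap.sub_apply, map_sub, LinearMap.comp_apply, hs'', LinearMap.id_apply,
          sub_self]))
    refine ⟨h, hh, fun x => ?_⟩
    have h1 := LinearMap.congr_fun hh' ((cone η).d 0 x)
    rwa [LinearMap.sub_apply, LinearMap.comp_apply, LinearMap.comp_apply, coneAug_d, map_zero,
      sub_zero] at h1
  | succ n ih =>
    obtain ⟨s, hs, hs'⟩ := ih
    obtain ⟨h, hh, hh'⟩ := H.lift (n + 1) (cone η) (cone η) (n + 1) (n + 2)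
      (LinearMap.id - s ∘ₗ (cone η).d n) ((cone η).d (n + 1))
      (IsBimoduleHom.id.sub (hs.comp ((cone η).isBimoduleHom_d n)))
      ((cone η).isBimoduleHom_d (n + 1)) (fun x => H.exact n _ (by
        rw [LinearMap.sub_apply, map_sub, LinearMap.comp_apply, hs', LinearMap.id_apply,
          sub_self]))
    refine ⟨h, hh, fun x => ?_⟩
    have h1 := LinearMap.congr_fun hh' ((cone η).d (n + 1) x)
    rwa [LinearMap.sub_apply, LinearMap.comp_apply, LinearMap.comp_apply, (cone η).d_d, map_zero,
      sub_zero] at h1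

/-- Since the mapping cone is split exact, every cocycle on it is a coboundary. In the lowest degree
it factors through `coneAug`. -/
theorem cocycle_zero (H : IsComparison η) {f : (cone η).X 0 →ₗ[k] N.X m} (hf : IsBimoduleHom f)
    (hd : ∀ x, f ((cone η).d 0 x) = 0) :
    ∃ g : Q.X 0 →ₗ[k] N.X m, IsBimoduleHom g ∧ ∀ x, f x = g (coneAug η x) := by
  obtain ⟨s, hs, hs'⟩ := H.exists_section
  refine ⟨f ∘ₗ s, hf.comp hs, fun x => ?_⟩
  obtain ⟨y, hy⟩ := H.exact_zero (x - s (coneAug η x)) (by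
    rw [map_sub, sub_eq_zero]
    exact (LinearMap.congr_fun hs' _).symm)
  have h1 := hd y
  rwa [hy, map_sub, sub_eq_zero] at h1

/-- Every cocycle of positive degree on the mapping cone is a coboundary. -/
theorem cocycle_succ (H : IsComparison η) {n : ℕ} {f : (cone η).X (n + 1) →ₗ[k] N.X m}
    (hf : IsBimoduleHom f) (hd : ∀ x, f ((cone η).d (n + 1) x) = 0) :
    ∃ g : (cone η).X n →ₗ[k] N.X m, IsBimoduleHom g ∧ ∀ x, f x = g ((cone η).d n x) := by
  obtain ⟨s, hs, hs'⟩ := H.exists_splitting n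
  refine ⟨f ∘ₗ s, hf.comp hs, fun x => ?_⟩
  obtain ⟨y, hy⟩ := H.exact n (x - s ((cone η).d n x)) (by rw [map_sub, hs', sub_self])
  have h1 := hd y
  rwa [hy, map_sub, sub_eq_zero] at h1

theorem coprod_isBimoduleHom {n : ℕ} {f : Q.X (n + 1) →ₗ[k] N.X m} {g : P.X n →ₗ[k] N.X m}
    (hf : IsBimoduleHom f) (hg : IsBimoduleHom g) :
    IsBimoduleHom (P := cone η) (m := n) (f.coprod g) := by
  constructor
  · intro a x
    change f (Q.left _ a x.1) + g (P.left _ a x.2) = N.left _ a (f x.1 + g x.2)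
    rw [hf.1, hg.1, map_add]
  · intro a x
    change f (Q.right _ a x.1) + g (P.right _ a x.2) = N.right _ a (f x.1 + g x.2)
    rw [hf.2, hg.2, map_add]

theorem zero_isBimoduleHom {M : BimoduleComplex.{u, w, w₄} 𝒯} {l : ℕ} :
    IsBimoduleHom (0 : M.X l →ₗ[k] N.X m) :=
  ⟨fun a _ => (map_zero (N.left m a)).symm, fun a _ => (map_zero (N.right m a)).symm⟩

/-- Every cocycle of degree zero on `P` is the restriction of a cocycle on `Q`. -/
theorem surjective_zero (H : IsComparison η) {g : P.X 0 →ₗ[k] N.X m} (hg : IsBimoduleHom g)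
    (hd : ∀ x, g (P.d 0 x) = 0) :
    ∃ f : Q.X 0 →ₗ[k] N.X m, IsBimoduleHom f ∧ (∀ x, f (Q.d 0 x) = 0) ∧
      ∀ x, f (η.f 0 x) = g x := by
  -- `(0, g)` is a cocycle on the mapping cone.
  obtain ⟨f, hf, h⟩ := H.cocycle_zero (coprod_isBimoduleHom (zero_isBimoduleHom (M := Q)) hg)
    (fun x => by
      change (0 : N.X m) + g (- P.d 0 x.2) = 0
      rw [map_neg, hd, neg_zero, add_zero])
  refine ⟨f, hf, fun x => ?_, fun x => ?_⟩
  · have h1 : (0 : N.X m) + g 0 = f (Q.d 0 x + η.f 0 0) := h (x, 0)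
    rw [map_zero, map_zero, add_zero, add_zero] at h1
    exact h1.symm
  · have h1 : (0 : N.X m) + g x = f (Q.d 0 0 + η.f 0 x) := h (0, x)
    rw [map_zero, zero_add, zero_add] at h1
    exact h1.symm

/-- Every cocycle of positive degree on `P` is cohomologous to the restriction of a cocycle on
`Q`. -/
theorem surjective_succ (H : IsComparison η) {n : ℕ} {g : P.X (n + 1) →ₗ[k] N.X m}
    (hg : IsBimoduleHom g) (hd : ∀ x, g (P.d (n + 1) x) = 0) :
    ∃ (f : Q.X (n + 1) →ₗ[k] N.X m) (h : P.X n →ₗ[k] N.X m), IsBimoduleHom f ∧ IsBimoduleHom h ∧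
      (∀ x, f (Q.d (n + 1) x) = 0) ∧ ∀ x, f (η.f (n + 1) x) = g x + h (P.d n x) := by
  obtain ⟨F, hF, h⟩ := H.cocycle_succ (coprod_isBimoduleHom (zero_isBimoduleHom (M := Q)) hg)
    (fun x => by
      change (0 : N.X m) + g (- P.d (n + 1) x.2) = 0
      rw [map_neg, hd, neg_zero, add_zero])
  refine ⟨F ∘ₗ LinearMap.inl k (Q.X (n + 1)) (P.X n), F ∘ₗ LinearMap.inr k (Q.X (n + 1)) (P.X n),
    hF.comp (inl_isBimoduleHom η n), hF.comp (inr_isBimoduleHom η n), fun x => ?_, fun x => ?_⟩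
  · have h1 : (0 : N.X m) + g 0 = F (Q.d _ x + η.f _ 0, - P.d n 0) := h (x, 0)
    rw [map_zero, map_zero, map_zero, add_zero, add_zero, neg_zero] at h1
    exact h1.symm
  · have h1 : (0 : N.X m) + g x = F (Q.d _ 0 + η.f _ x, - P.d n x) := h (0, x)
    have h2 : (Q.d (n + 1) 0 + η.f (n + 1) x, - P.d n x) =
        LinearMap.inl k (Q.X (n + 1)) (P.X n) (η.f (n + 1) x) -
          LinearMap.inr k (Q.X (n + 1)) (P.X n) (P.d n x) := by
      refine Prod.ext ?_ ?_
      · change Q.d (n + 1) 0 + η.f (n + 1) x = η.f (n + 1) x - 0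
        rw [map_zero, zero_add, sub_zero]
      · change - P.d n x = 0 - P.d n x
        rw [zero_sub]
    rw [zero_add, h2] at h1
    have h3 : ∀ y z : (cone η).X n, F y = F (y - z) + F z := fun y z => by
      rw [← map_add, sub_add_cancel]
    rw [h1]
    exact h3 _ _

/-- A cocycle of degree zero on `Q` which vanishes on `P` is zero. -/
theorem injective_zero (H : IsComparison η) {f : Q.X 0 →ₗ[k] N.X m} (hd : ∀ x, f (Q.d 0 x) = 0)
    (h : ∀ x, f (η.f 0 x) = 0) : f = 0 := by
  ext x
  obtain ⟨⟨b, p⟩, rfl⟩ := H.surjective x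
  rw [coneAug_apply, map_add, hd, h, add_zero, LinearMap.zero_apply]

/-- A cocycle of positive degree on `Q` whose restriction to `P` is a coboundary is a
coboundary. -/
theorem injective_succ (H : IsComparison η) {n : ℕ} {f : Q.X (n + 1) →ₗ[k] N.X m}
    {h : P.X n →ₗ[k] N.X m} (hf : IsBimoduleHom f) (hh : IsBimoduleHom h)
    (hd : ∀ x, f (Q.d (n + 1) x) = 0) (hfh : ∀ x, f (η.f (n + 1) x) = h (P.d n x)) :
    ∃ g : Q.X n →ₗ[k] N.X m, IsBimoduleHom g ∧ ∀ x, f x = g (Q.d n x) := by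
  -- `(f, h)` is a cocycle on the mapping cone.
  have hF : IsBimoduleHom (P := cone η) (m := n) (f.coprod h) := coprod_isBimoduleHom hf hh
  have hFd : ∀ x, (f.coprod h) ((cone η).d n x) = 0 := fun x => by
    change f (Q.d _ x.1 + η.f _ x.2) + h (- P.d n x.2) = 0
    rw [map_add, hd, hfh, map_neg, zero_add, add_neg_cancel]
  have hb : ∀ b, f b = (f.coprod h) (b, 0) := fun b => by
    rw [LinearMap.coprod_apply, map_zero, add_zero]
  cases n with
  | zero =>
    obtain ⟨g, hg, hg'⟩ := H.cocycle_zero hF hFd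
    refine ⟨g, hg, fun b => (hb b).trans ((hg' (b, 0)).trans ?_)⟩
    rw [coneAug_apply, map_zero, add_zero]
  | succ n =>
    obtain ⟨g, hg, hg'⟩ := H.cocycle_succ hF hFd
    refine ⟨g ∘ₗ LinearMap.inl k (Q.X (n + 1)) (P.X n), hg.comp (inl_isBimoduleHom η n),
      fun b => (hb b).trans ((hg' (b, 0)).trans ?_)⟩
    rw [cone_d_apply, map_zero, map_zero, add_zero, neg_zero]
    rfl

end IsComparison

/-- A chain map between termwise projective complexes which have the same homology, concentrated
in degree zero, is a comparison. -/
theorem IsComparison.mk_of_exact {M : Type*} [AddCommGroup M] [Module k M] (ε : Q.X 0 →ₗ[k] M)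
    (hQ : ∀ n, HasLifting.{u, w, w₂, max w₁ w₂, max w₁ w₂} Q n)
    (hQ₀ : HasLifting.{u, w, w₂, w₂, max w₁ w₂} Q 0)
    (hP : ∀ n, HasLifting.{u, w, w₁, max w₁ w₂, max w₁ w₂} P n)
    (hε : ∀ q, ∃ p, ε (η.f 0 p) = ε q) (hεd : ∀ x, ε (Q.d 0 x) = 0)
    (hQ' : ∀ q, ε q = 0 → ∃ y, Q.d 0 y = q)
    (hP' : ∀ p, ε (η.f 0 p) = 0 → ∃ y, P.d 0 y = p)
    (hQe : ∀ n q, Q.d n q = 0 → ∃ y, Q.d (n + 1) y = q)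
    (hPe : ∀ n p, P.d n p = 0 → ∃ y, P.d (n + 1) y = p) : IsComparison η where
  lift_zero := hQ₀
  lift n := (hQ (n + 1)).cone η (hP n)
  surjective q := by
    obtain ⟨p, hp⟩ := hε q
    obtain ⟨b, hb⟩ := hQ' (q - η.f 0 p) (by rw [map_sub, hp, sub_self])
    exact ⟨(b, p), by rw [coneAug_apply, hb, sub_add_cancel]⟩
  exact_zero := by
    rintro ⟨b, p⟩ h
    rw [coneAug_apply] at h
    obtain ⟨p', rfl⟩ := hP' p (by
      have := congrArg ε h
      rwa [map_add, hεd, zero_add, map_zero] at this)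
    obtain ⟨b', hb'⟩ := hQe 0 (b + η.f 1 p') (by rw [map_add, ← η.comm, h])
    refine ⟨(b', - p'), ?_⟩
    rw [cone_d_apply, hb', map_neg, add_neg_cancel_right, map_neg, neg_neg]
  exact := by
    rintro n ⟨b, p⟩ h
    rw [cone_d_apply] at h
    have h1 : Q.d (n + 1) b + η.f (n + 1) p = 0 := congrArg Prod.fst h
    have h2 : - P.d n p = 0 := congrArg Prod.snd h
    obtain ⟨p', rfl⟩ := hPe n p (neg_eq_zero.1 h2)
    obtain ⟨b', hb'⟩ := hQe (n + 1) (b + η.f (n + 2) p') (by rw [map_add, ← η.comm, h1])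
    refine ⟨(b', - p'), ?_⟩
    rw [cone_d_apply, hb', map_neg, add_neg_cancel_right, map_neg, neg_neg]

end Cone

/-! ### Cochains with values in `T` and the bijectivity of `η^*` -/

section Comparison

variable {k : Type u} [Field k] {R : Type v} [Ring R] [Algebra k R] {T : Type w} [Ring T]
  [Algebra k T] {ℛ : ℤ → Submodule k R} [GradedAlgebra ℛ] {𝒯 : ℤ → Submodule k T}
  [GradedAlgebra 𝒯] (φ : ℛ →ₐᵍ[k] 𝒯)

/-- The chain map `η : T ⊗_R 𝔹(R) ⊗_R T → 𝔹(T)`. -/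
def etaChainMap : ChainMap ((bar ℛ).baseChange φ) (bar 𝒯) where
  f := eta φ
  isBimoduleHom n := ⟨eta_left φ n, eta_right φ n⟩
  comm := eta_d φ

variable (𝒯) in
theorem bar_hasLifting (n : ℕ) : HasLifting.{u, w, max u w, w₃, w₄} (bar 𝒯) n :=
  fun _ _ _ _ _ _ hf hg hr => by
    obtain ⟨h, hh, e⟩ := IsRelHom.exists_lift (φ := AlgHom.id k T) ⟨hf.1, hf.2⟩ hg hr
    exact ⟨h, ⟨hh.1, hh.2⟩, e⟩

theorem baseChange_hasLifting (n : ℕ) :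
    HasLifting.{u, w, max u v w, w₃, w₄} ((bar ℛ).baseChange φ) n :=
  fun _ _ _ _ _ _ hf hg hr => IsBimoduleHom.exists_lift_baseChange hf hg hr

/-- For a flat epimorphism `φ`, both `T ⊗_R 𝔹(R) ⊗_R T` and `𝔹(T)` are projective resolutions of the
bimodule `T`. Only the flatness as a right module is needed. -/
theorem eta_isComparison
    (hflat : letI : Module Rᵐᵒᵖ T := Module.compHom T (RingHom.op φ.toAlgHom.toRingHom)
      IsFlatRight R T)
    (hepi : ∀ (S : Type w) [Ring S] (α β : T →+* S),
      α.comp φ.toAlgHom.toRingHom = β.comp φ.toAlgHom.toRingHom → α = β) :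
    IsComparison (etaChainMap φ) :=
  IsComparison.mk_of_exact (etaChainMap φ) (mulCochain k T) (bar_hasLifting 𝒯)
    (bar_hasLifting 𝒯 0) (baseChange_hasLifting φ)
    (fun q => ⟨barMk φ 0 (mulCochain k T q ⊗ₜ[k]
      ((PiTensorProduct.tprod k fun _ => 1) ⊗ₜ[k] 1)), by
        change mulCochain k T (eta φ 0 _) = _
        rw [eta_barMk, barMap_tprod, barRight_tprod, barLeft_tprod, mulCochain_tprod]
        simp
        rfl⟩)
    (LinearMap.congr_fun (mulCochain_mem 𝒯).2)
    (fun q hq => bar_exact_zero q hq)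
    (fun p hp => baseChange_exact_zero φ hepi p hp)
    (fun n q hq => bar_exact n q hq)
    (fun n p hp => baseChange_exact φ hflat n p hp)

end Comparison

section Homogeneous

variable {k : Type u} [Field k] {R : Type v} [Ring R] [Algebra k R]
  (ℛ : ℤ → Submodule k R) [GradedAlgebra ℛ]

/-- Linear maps on `𝔹(R)_n` which agree on tensors of homogeneous elements are equal. -/
theorem bar_ext_homogeneous {M : Type*} [AddCommGroup M] [Module k M] {n : ℕ}
    {f g : BarTerm k R n →ₗ[k] M} (h : ∀ (e : Fin (n + 2) → ℤ) (x : Fin (n + 2) → R),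
      (∀ p, x p ∈ ℛ (e p)) → f (PiTensorProduct.tprod k x) = g (PiTensorProduct.tprod k x)) :
    f = g := by
  classical
  ext x
  have hx : x = fun p => ∑ i ∈ (DirectSum.decompose ℛ (x p)).support,
      (DirectSum.decompose ℛ (x p) i : R) :=
    funext fun p => (DirectSum.sum_support_decompose ℛ (x p)).symm
  rw [hx, MultilinearMap.map_sum_finset, MultilinearMap.map_sum_finset]
  exact Finset.sum_congr rfl fun e _ => h e _ fun p => SetLike.coe_mem _

/-- Linear maps on `𝔹(R)_n` which agree on the homogeneous elements are equal. -/
theorem bar_ext_grading {M : Type*} [AddCommGroup M] [Module k M] {n : ℕ}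
    {f g : BarTerm k R n →ₗ[k] M} (h : ∀ i, ∀ x ∈ barGrading ℛ n i, f x = g x) : f = g :=
  bar_ext_homogeneous ℛ fun _ _ hx => h _ _ (tprod_mem_barGrading hx rfl)

variable {T : Type w} [Ring T] [Algebra k T] (𝒯 : ℤ → Submodule k T) [GradedAlgebra 𝒯]

/-- Every linear map on `𝔹(R)_n` has a component of degree `t`. -/
theorem exists_homogenize (t : ℤ) {n : ℕ} (u : BarTerm k R n →ₗ[k] T) :
    ∃ u' : BarTerm k R n →ₗ[k] T, ∀ i, ∀ x ∈ barGrading ℛ n i,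
      u' x = GradedRing.proj 𝒯 (i + t) (u x) := by
  classical
  -- Multilinear maps on the direct sums of the homogeneous parts are families of multilinear maps
  -- on these parts; on the part of multidegree `e`, the value is projected to degree `∑ e_p + t`.
  let F (e : Fin (n + 2) → ℤ) : MultilinearMap k (fun p => ℛ (e p)) T :=
    ((GradedAlgebra.proj 𝒯 (∑ p, e p + t) ∘ₗ u).compMultilinearMap
      (PiTensorProduct.tprod k)).compLinearMap fun p => (ℛ (e p)).subtype
  let G : MultilinearMap k (fun _ : Fin (n + 2) => Π₀ j, ℛ j) T :=
    MultilinearMap.fromDFinsuppEquiv (R := k) (κ := fun _ : Fin (n + 2) => ℤ)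
      (M := fun _ j => ℛ j) (N := T) F
  let D : R →ₗ[k] Π₀ j, ℛ j := (DirectSum.decomposeLinearEquiv ℛ).toLinearMap
  have hD : ∀ i (a : R) (ha : a ∈ ℛ i), D a = DFinsupp.single i ⟨a, ha⟩ := fun i a ha =>
    DirectSum.decompose_of_mem ℛ ha
  refine ⟨PiTensorProduct.lift (G.compLinearMap fun _ => D), fun i x hx => ?_⟩
  have h1 := barGrading_map (PiTensorProduct.lift (G.compLinearMap fun _ => D) -
    GradedAlgebra.proj 𝒯 (i + t) ∘ₗ u) ⊥ (fun e x hx he => by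
      rw [Submodule.mem_bot, LinearMap.sub_apply, sub_eq_zero, PiTensorProduct.lift.tprod,
        MultilinearMap.compLinearMap_apply, funext fun p => hD (e p) (x p) (hx p)]
      refine (MultilinearMap.fromDFinsuppEquiv_single (R := k)
        (κ := fun _ : Fin (n + 2) => ℤ) (M := fun _ j => ℛ j) F e
        (fun p => ⟨x p, hx p⟩)).trans ?_
      rw [← he]
      rfl) x hx
  rwa [Submodule.mem_bot, LinearMap.sub_apply, sub_eq_zero] at h1

/-- The component of degree `t` of a linear map on `𝔹(R)_n`. -/
def homogenize (t : ℤ) {n : ℕ} (u : BarTerm k R n →ₗ[k] T) : BarTerm k R n →ₗ[k] T :=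
  (exists_homogenize ℛ 𝒯 t u).choose

theorem homogenize_apply (t : ℤ) {n : ℕ} (u : BarTerm k R n →ₗ[k] T) {i : ℤ} {x : BarTerm k R n}
    (hx : x ∈ barGrading ℛ n i) :
    homogenize ℛ 𝒯 t u x = GradedRing.proj 𝒯 (i + t) (u x) :=
  (exists_homogenize ℛ 𝒯 t u).choose_spec i x hx

theorem proj_mul_left {i j : ℤ} {a : T} (ha : a ∈ 𝒯 i) (b : T) :
    GradedRing.proj 𝒯 (i + j) (a * b) = a * GradedRing.proj 𝒯 j b :=
  DirectSum.coe_decompose_mul_add_of_left_mem 𝒯 ha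

theorem proj_mul_right {i j : ℤ} {b : T} (hb : b ∈ 𝒯 j) (a : T) :
    GradedRing.proj 𝒯 (i + j) (a * b) = GradedRing.proj 𝒯 i a * b :=
  DirectSum.coe_decompose_mul_add_of_right_mem 𝒯 hb

theorem proj_mem (i : ℤ) (b : T) : GradedRing.proj 𝒯 i b ∈ 𝒯 i := SetLike.coe_mem _

theorem proj_of_mem {i : ℤ} {b : T} (hb : b ∈ 𝒯 i) : GradedRing.proj 𝒯 i b = b :=
  DirectSum.decompose_of_mem_same 𝒯 hb

end Homogeneous

section RelativeCochains

variable {k : Type u} [Field k] {R : Type v} [Ring R] [Algebra k R] {T : Type w} [Ring T]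
  [Algebra k T] {ℛ : ℤ → Submodule k R} [GradedAlgebra ℛ] {𝒯 : ℤ → Submodule k T}
  [GradedAlgebra 𝒯] (φ : ℛ →ₐᵍ[k] 𝒯)

/-- The space `Hom^t_{R^e}(𝔹(R)_n, T)` of Hochschild cochains of `R` with coefficients in `T`. -/
def relCoch (t : ℤ) (n : ℕ) : Submodule k (BarTerm k R n →ₗ[k] T) where
  carrier := {f | (∀ i, ∀ x ∈ barGrading ℛ n i, f x ∈ 𝒯 (i + t)) ∧
    (∀ a x, f (barLeft k R n a x) = signTwist 𝒯 t (φ a) * f x) ∧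
    (∀ a x, f (barRight k R n a x) = f x * φ a)}
  add_mem' := by
    rintro f g ⟨hf, hf', hf''⟩ ⟨hg, hg', hg''⟩
    refine ⟨fun i x hx => add_mem (hf i x hx) (hg i x hx), fun a x => ?_, fun a x => ?_⟩
    · simp [hf', hg', mul_add]
    · simp [hf'', hg'', add_mul]
  zero_mem' := ⟨fun i x _ => zero_mem _, by simp, by simp⟩
  smul_mem' := by
    rintro c f ⟨hf, hf', hf''⟩
    refine ⟨fun i x hx => Submodule.smul_mem _ c (hf i x hx), fun a x => ?_, fun a x => ?_⟩
    · simp [hf']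
    · simp [hf'']

/-- The coboundaries of the complex `Hom^t_{R^e}(𝔹(R), T)`. -/
def relCob (t : ℤ) : ∀ n : ℕ, Submodule k (BarTerm k R n →ₗ[k] T)
  | 0 => ⊥
  | n + 1 => (relCoch φ t n).map (LinearMap.lcomp k T (barD k R n))

variable {φ}

theorem mem_relCob_succ {t : ℤ} {n : ℕ} {f : BarTerm k R (n + 1) →ₗ[k] T} :
    f ∈ relCob φ t (n + 1) ↔ ∃ v ∈ relCoch φ t n, v ∘ₗ barD k R n = f := Iff.rfl

theorem isRelHom_of_mem_relCoch {t : ℤ} {n : ℕ} {f : BarTerm k R n →ₗ[k] T}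
    (hf : f ∈ relCoch φ t n) :
    IsRelHom (N := twistedCoefficients 𝒯 t) (m := 0) φ.toAlgHom f := hf.2

theorem isBimoduleHom_of_mem_Coch {P : BimoduleComplex.{u, w, w₁} 𝒯} {t : ℤ} {n : ℕ}
    {f : P.X n →ₗ[k] T} (hf : f ∈ P.Coch t n) :
    IsBimoduleHom (Q := twistedCoefficients 𝒯 t) (n := 0) f := hf.2

/-- The component of degree `t` of a bimodule homomorphism is a bimodule homomorphism. -/
theorem homogenize_mem_relCoch {t : ℤ} {n : ℕ} {f : BarTerm k R n →ₗ[k] T}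
    (hf : IsRelHom (N := twistedCoefficients 𝒯 t) (m := 0) φ.toAlgHom f) :
    homogenize ℛ 𝒯 t f ∈ relCoch φ t n := by
  have hl : ∀ a x, f (barLeft k R n a x) = signTwist 𝒯 t (φ a) * f x := hf.1
  have hr : ∀ a x, f (barRight k R n a x) = f x * φ a := hf.2
  refine ⟨fun i x hx => ?_, fun a x => ?_, fun a x => ?_⟩
  · rw [homogenize_apply ℛ 𝒯 t f hx]
    exact proj_mem 𝒯 _ _
  · have h : ((barLeft k R n).compr₂ (homogenize ℛ 𝒯 t f)) =
        (LinearMap.mul k T).compl₁₂ (signTwist 𝒯 t ∘ₗ φ.toAlgHom.toLinearMap)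
          (homogenize ℛ 𝒯 t f) :=
      ext_homogeneous ℛ fun i a ha => bar_ext_grading ℛ fun j x hx => by
        change homogenize ℛ 𝒯 t f (barLeft k R n a x) =
          signTwist 𝒯 t (φ a) * homogenize ℛ 𝒯 t f x
        have h2 : φ a ∈ 𝒯 i := φ.map_mem ha
        have h1 : barLeft k R n a x ∈ barGrading ℛ n (i + j) := (bar ℛ).left_mem n i j a ha x hx
        rw [homogenize_apply ℛ 𝒯 t f h1, homogenize_apply ℛ 𝒯 t f hx, hl, add_assoc,
          proj_mul_left 𝒯 (signTwist_mem 𝒯 t h2)]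
    exact LinearMap.congr_fun₂ h a x
  · have h : ((barRight k R n).compr₂ (homogenize ℛ 𝒯 t f)) =
        (LinearMap.mul k T).flip.compl₁₂ φ.toAlgHom.toLinearMap (homogenize ℛ 𝒯 t f) :=
      ext_homogeneous ℛ fun i a ha => bar_ext_grading ℛ fun j x hx => by
        change homogenize ℛ 𝒯 t f (barRight k R n a x) = homogenize ℛ 𝒯 t f x * φ a
        have h2 : φ a ∈ 𝒯 i := φ.map_mem ha
        have h1 : barRight k R n a x ∈ barGrading ℛ n (j + i) := (bar ℛ).right_mem n i j a ha x hx
        rw [homogenize_apply ℛ 𝒯 t f h1, homogenize_apply ℛ 𝒯 t f hx, hr, add_right_comm,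
          proj_mul_right 𝒯 h2]
    exact LinearMap.congr_fun₂ h a x

theorem homogenize_mem_Coch {t : ℤ} {n : ℕ} {f : BarTerm k T n →ₗ[k] T}
    (hf : IsBimoduleHom (P := bar 𝒯) (m := n) (Q := twistedCoefficients 𝒯 t) (n := 0) f) :
    homogenize 𝒯 𝒯 t f ∈ (bar 𝒯).Coch t n :=
  have h := homogenize_mem_relCoch (φ := GradedAlgHom.id k 𝒯) (f := f) ⟨hf.1, hf.2⟩
  ⟨h.1, h.2.1, h.2.2⟩

theorem barD_mem {n : ℕ} {i : ℤ} {x : BarTerm k R (n + 1)} (hx : x ∈ barGrading ℛ (n + 1) i) :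
    barD k R n x ∈ barGrading ℛ n i := (bar ℛ).d_mem n i x hx

/-- The extension of a cocycle to `T ⊗_R 𝔹(R) ⊗_R T` is a cocycle. -/
theorem extend_comp_bcD {t : ℤ} {n : ℕ} {g : BarTerm k R n →ₗ[k] T} (hg : g ∈ relCoch φ t n)
    (hd : g ∘ₗ barD k R n = 0) :
    (isRelHom_of_mem_relCoch hg).extend ∘ₗ (bar ℛ).bcD φ n = 0 :=
  ((isRelHom_of_mem_relCoch hg).extend_isBimoduleHom.comp
      (((bar ℛ).baseChange φ).isBimoduleHom_d n)).bc_ext IsComparison.zero_isBimoduleHom fun x =>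
    ((isRelHom_of_mem_relCoch hg).extend_bcUnit (barD k R n x)).trans (LinearMap.congr_fun hd x)

/-- `exists_cocycle` in degree zero, for cocycles that need not be homogeneous. -/
theorem exists_bimoduleHom_zero (H : IsComparison (etaChainMap φ)) {t : ℤ}
    {g : BarTerm k R 0 →ₗ[k] T} (hg : g ∈ relCoch φ t 0) (hd : g ∘ₗ barD k R 0 = 0) :
    ∃ f : BarTerm k T 0 →ₗ[k] T,
      IsBimoduleHom (P := bar 𝒯) (m := 0) (Q := twistedCoefficients 𝒯 t) (n := 0) f ∧
      (∀ x, f (barD k T 0 x) = 0) ∧ ∀ x, f (barMap φ 0 x) = g x := by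
  obtain ⟨f, hf, hfd, hfg⟩ := H.surjective_zero
    (isRelHom_of_mem_relCoch hg).extend_isBimoduleHom
    (LinearMap.congr_fun (extend_comp_bcD hg hd))
  exact ⟨f, hf, hfd, fun x => (congrArg f (eta_bcUnit φ 0 x)).symm.trans ((hfg _).trans
    ((isRelHom_of_mem_relCoch hg).extend_bcUnit x))⟩

/-- `exists_cocycle` in positive degrees, for cocycles that need not be homogeneous. -/
theorem exists_bimoduleHom_succ (H : IsComparison (etaChainMap φ)) {t : ℤ} {n : ℕ}
    {g : BarTerm k R (n + 1) →ₗ[k] T} (hg : g ∈ relCoch φ t (n + 1))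
    (hd : g ∘ₗ barD k R (n + 1) = 0) :
    ∃ (f : BarTerm k T (n + 1) →ₗ[k] T) (h : BarTerm k R n →ₗ[k] T),
      IsBimoduleHom (P := bar 𝒯) (m := n + 1) (Q := twistedCoefficients 𝒯 t) (n := 0) f ∧
      IsRelHom (N := twistedCoefficients 𝒯 t) (m := 0) φ.toAlgHom h ∧
      (∀ x, f (barD k T (n + 1) x) = 0) ∧
      ∀ x, f (barMap φ (n + 1) x) = g x + h (barD k R n x) := by
  obtain ⟨f, h, hf, hh, hfd, hfg⟩ := H.surjective_succ
    (isRelHom_of_mem_relCoch hg).extend_isBimoduleHom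
    (LinearMap.congr_fun (extend_comp_bcD hg hd))
  refine ⟨f, h ∘ₗ bcUnit φ n, hf, (bcUnit_isRelHom φ n).comp hh, hfd, fun x =>
    (congrArg f (eta_bcUnit φ (n + 1) x)).symm.trans ((hfg _).trans ?_)⟩
  exact congrArg₂ (fun a b : T => a + b) ((isRelHom_of_mem_relCoch hg).extend_bcUnit x) rfl

/-- `mem_coboundaries_of_comp_barMap` in positive degrees, up to the homogeneity of the
cochain `g`. -/
theorem exists_bimoduleHom_of_comp_barMap (H : IsComparison (etaChainMap φ)) {t : ℤ} {n : ℕ}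
    {f : BarTerm k T (n + 1) →ₗ[k] T} (hf : f ∈ (bar 𝒯).cocycles t (n + 1))
    {v : BarTerm k R n →ₗ[k] T} (hv : v ∈ relCoch φ t n)
    (hvf : v ∘ₗ barD k R n = f ∘ₗ barMap φ (n + 1)) :
    ∃ g : BarTerm k T n →ₗ[k] T,
      IsBimoduleHom (P := bar 𝒯) (m := n) (Q := twistedCoefficients 𝒯 t) (n := 0) g ∧
      ∀ x, f x = g (barD k T n x) := by
  have hf' := isBimoduleHom_of_mem_Coch hf.1
  have hv' := isRelHom_of_mem_relCoch hv
  have h1 : f ∘ₗ eta φ (n + 1) = hv'.extend ∘ₗ (bar ℛ).bcD φ n :=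
    (hf'.comp ((etaChainMap φ).isBimoduleHom (n + 1))).bc_ext
      (hv'.extend_isBimoduleHom.comp (((bar ℛ).baseChange φ).isBimoduleHom_d n))
      fun x => ((congrArg f (eta_bcUnit φ (n + 1) x)).trans
        (LinearMap.congr_fun hvf x).symm).trans (hv'.extend_bcUnit _).symm
  exact H.injective_succ hf' hv'.extend_isBimoduleHom (LinearMap.congr_fun hf.2)
    (LinearMap.congr_fun h1)

/-- The component of degree `t` of a cocycle is a cocycle, since the differential of the bar
resolution has degree zero. -/
theorem homogenize_mem_cocycles {t : ℤ} {n : ℕ} {f : BarTerm k T n →ₗ[k] T}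
    (hf : IsBimoduleHom (P := bar 𝒯) (m := n) (Q := twistedCoefficients 𝒯 t) (n := 0) f)
    (hd : ∀ x, f (barD k T n x) = 0) : homogenize 𝒯 𝒯 t f ∈ (bar 𝒯).cocycles t n := by
  refine ⟨homogenize_mem_Coch hf, ?_⟩
  suffices homogenize 𝒯 𝒯 t f ∘ₗ barD k T n = 0 from this
  refine bar_ext_grading 𝒯 fun i x hx => ?_
  rw [LinearMap.comp_apply, homogenize_apply 𝒯 𝒯 t f (barD_mem hx), hd, map_zero,
    LinearMap.zero_apply]

/-- A Hochschild cocycle of `R` with values in `T` is cohomologous to the restriction of a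
Hochschild cocycle of `T`. -/
theorem exists_cocycle (H : IsComparison (etaChainMap φ)) {t : ℤ} {n : ℕ}
    {g : BarTerm k R n →ₗ[k] T} (hg : g ∈ relCoch φ t n) (hd : g ∘ₗ barD k R n = 0) :
    ∃ u : BarTerm k T n →ₗ[k] T, u ∈ (bar 𝒯).cocycles t n ∧
      u ∘ₗ barMap φ n - g ∈ relCob φ t n := by
  cases n with
  | zero =>
    obtain ⟨f, hf, hfd, hfg⟩ := exists_bimoduleHom_zero H hg hd
    refine ⟨homogenize 𝒯 𝒯 t f, homogenize_mem_cocycles hf hfd, ?_⟩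
    refine (Submodule.mem_bot k).2 (sub_eq_zero.2 (bar_ext_grading ℛ fun i x hx => ?_))
    rw [LinearMap.comp_apply, homogenize_apply 𝒯 𝒯 t f (barMap_mem φ 0 i x hx), hfg,
      proj_of_mem 𝒯 (hg.1 i x hx)]
  | succ n =>
    obtain ⟨f, h, hf, hh, hfd, hfg⟩ := exists_bimoduleHom_succ H hg hd
    refine ⟨homogenize 𝒯 𝒯 t f, homogenize_mem_cocycles hf hfd, homogenize ℛ 𝒯 t h,
      homogenize_mem_relCoch hh, bar_ext_grading ℛ fun i x hx => ?_⟩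
    change homogenize ℛ 𝒯 t h (barD k R n x) =
      homogenize 𝒯 𝒯 t f (barMap φ (n + 1) x) - g x
    rw [homogenize_apply 𝒯 𝒯 t f (barMap_mem φ (n + 1) i x hx), hfg, map_add,
      proj_of_mem 𝒯 (hg.1 i x hx), add_sub_cancel_left, homogenize_apply ℛ 𝒯 t h (barD_mem hx)]

/-- A Hochschild cocycle of `T` whose restriction to `R` is a coboundary is a coboundary. -/
theorem mem_coboundaries_of_comp_barMap (H : IsComparison (etaChainMap φ)) {t : ℤ} {n : ℕ}
    {f : BarTerm k T n →ₗ[k] T} (hf : f ∈ (bar 𝒯).cocycles t n)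
    (h : f ∘ₗ barMap φ n ∈ relCob φ t n) : f ∈ (bar 𝒯).coboundaries t n := by
  cases n with
  | zero =>
    have h0 : f ∘ₗ eta φ 0 = 0 := ((isBimoduleHom_of_mem_Coch hf.1).comp
      ((etaChainMap φ).isBimoduleHom 0)).bc_ext IsComparison.zero_isBimoduleHom fun x =>
      (congrArg f (eta_bcUnit φ 0 x)).trans (LinearMap.congr_fun ((Submodule.mem_bot k).1 h) x)
    have h1 : f = 0 := H.injective_zero (N := twistedCoefficients 𝒯 t) (m := 0)
      (LinearMap.congr_fun hf.2) (LinearMap.congr_fun h0)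
    exact h1
  | succ n =>
    obtain ⟨v, hv, hvf⟩ := mem_relCob_succ.1 h
    obtain ⟨g, hg, hfg⟩ := exists_bimoduleHom_of_comp_barMap H hf hv hvf
    refine ⟨homogenize 𝒯 𝒯 t g, homogenize_mem_Coch hg, ?_⟩
    suffices homogenize 𝒯 𝒯 t g ∘ₗ barD k T n = f from this
    refine bar_ext_grading 𝒯 fun i x hx => ?_
    rw [LinearMap.comp_apply, homogenize_apply 𝒯 𝒯 t g (barD_mem hx), ← hfg]
    exact proj_of_mem 𝒯 (hf.1.1 i x hx)

theorem comp_bcUnit_mem_relCoch {t : ℤ} {n : ℕ} {ξ : (bar ℛ).BCTerm φ n →ₗ[k] T}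
    (hξ : ξ ∈ ((bar ℛ).baseChange φ).Coch t n) : ξ ∘ₗ bcUnit φ n ∈ relCoch φ t n :=
  ⟨fun i x hx => hξ.1 i _ ((bar ℛ).bcTmul_mem φ (by rw [zero_add, add_zero])
      SetLike.GradedOne.one_mem hx SetLike.GradedOne.one_mem),
    ((bcUnit_isRelHom φ n).comp (isBimoduleHom_of_mem_Coch hξ)).1,
    ((bcUnit_isRelHom φ n).comp (isBimoduleHom_of_mem_Coch hξ)).2⟩

theorem extend_mem_Coch {t : ℤ} {n : ℕ} {g : BarTerm k R n →ₗ[k] T} (hg : g ∈ relCoch φ t n) :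
    (isRelHom_of_mem_relCoch hg).extend ∈ ((bar ℛ).baseChange φ).Coch t n := by
  refine ⟨fun i => (bar ℛ).bcGrading_map φ _ _ fun p q r hi s hs x hx y hy => ?_,
    (isRelHom_of_mem_relCoch hg).extend_isBimoduleHom.1,
    (isRelHom_of_mem_relCoch hg).extend_isBimoduleHom.2⟩
  change signTwist 𝒯 t s * (g x * y) ∈ 𝒯 (i + t)
  rw [show i + t = p + ((q + t) + r) by omega]
  exact SetLike.GradedMul.mul_mem (signTwist_mem 𝒯 t hs)
    (SetLike.GradedMul.mul_mem (hg.1 q x hx) hy)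

/-- Restriction along `x ↦ 1 ⊗ x ⊗ 1` identifies the coboundaries of `T ⊗_R 𝔹(R) ⊗_R T` with
those of `R` with values in `T`. -/
theorem mem_coboundaries_iff {t : ℤ} {n : ℕ} {ξ : (bar ℛ).BCTerm φ n →ₗ[k] T}
    (hξ : ξ ∈ ((bar ℛ).baseChange φ).Coch t n) :
    ξ ∈ ((bar ℛ).baseChange φ).coboundaries t n ↔ ξ ∘ₗ bcUnit φ n ∈ relCob φ t n := by
  cases n with
  | zero =>
    constructor
    · intro h
      have h0 : ξ = 0 := h
      exact (Submodule.mem_bot k).2 (LinearMap.ext fun x => LinearMap.congr_fun h0 _)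
    · intro h
      have h0 : ξ = 0 := (isBimoduleHom_of_mem_Coch hξ).bc_ext IsComparison.zero_isBimoduleHom
        (LinearMap.congr_fun ((Submodule.mem_bot k).1 h))
      exact h0
  | succ n =>
    constructor
    · rintro ⟨ξ', hξ', rfl⟩
      exact ⟨ξ' ∘ₗ bcUnit φ n, comp_bcUnit_mem_relCoch hξ', rfl⟩
    · rintro ⟨v, hv, h⟩
      refine ⟨_, extend_mem_Coch hv, ?_⟩
      exact ((isRelHom_of_mem_relCoch hv).extend_isBimoduleHom.comp
        (((bar ℛ).baseChange φ).isBimoduleHom_d n)).bc_ext (isBimoduleHom_of_mem_Coch hξ) fun x =>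
        ((isRelHom_of_mem_relCoch hv).extend_bcUnit _).trans (LinearMap.congr_fun h x)

/-- By restriction along `x ↦ 1 ⊗ x ⊗ 1`, the bijectivity of `η^*` is a statement about the
restriction of cochains of `T` to cochains of `R` with values in `T`. -/
theorem etaStar_bijective (H : IsComparison (etaChainMap φ)) (n : ℕ) (t : ℤ) :
    Function.Bijective (etaStar φ n t) := by
  constructor
  · rw [injective_iff_map_eq_zero]
    intro x hx
    obtain ⟨⟨f, hf⟩, rfl⟩ := Subquotient.mk_surjective x
    have h1 : f ∘ₗ eta φ n ∈ ((bar ℛ).baseChange φ).coboundaries t n :=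
      Subquotient.mk_eq_zero.1 hx
    have h2 := (mem_coboundaries_iff (etaCoch φ t n ⟨f, hf.1⟩).2).1 h1
    refine Subquotient.mk_eq_zero.2 (mem_coboundaries_of_comp_barMap H hf ?_)
    have h3 : (f ∘ₗ eta φ n) ∘ₗ bcUnit φ n = f ∘ₗ barMap φ n :=
      LinearMap.ext fun x => congrArg f (eta_bcUnit φ n x)
    exact h3 ▸ h2
  · intro x
    obtain ⟨⟨ξ, hξ⟩, rfl⟩ := Subquotient.mk_surjective x
    obtain ⟨f, hf, h⟩ := exists_cocycle H (comp_bcUnit_mem_relCoch hξ.1)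
      (LinearMap.ext fun x => LinearMap.congr_fun hξ.2 (bcUnit φ (n + 1) x))
    refine ⟨(bar 𝒯).cls n t ⟨f, hf⟩, sub_eq_zero.1 (Subquotient.mk_eq_zero.2 ?_)⟩
    refine (mem_coboundaries_iff (sub_mem (etaCoch φ t n ⟨f, hf.1⟩).2 hξ.1)).2 ?_
    convert h using 1
    exact LinearMap.ext fun x => congrArg (· - ξ (bcUnit φ n x)) (congrArg f (eta_bcUnit φ n x))

/-- The map `Γ` sends the class of `ζ` to the class of `f` if the restriction of `f` to `R` and
`φ ∘ ζ` are cohomologous Hochschild cocycles of `R` with values in `T`. -/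
theorem Gamma_cls (hη : ∀ n l, Function.Bijective (etaStar φ n l)) {n : ℕ} {t : ℤ}
    {ζ : BarTerm k R n →ₗ[k] R} (hζ : ζ ∈ (bar ℛ).cocycles t n)
    {f : BarTerm k T n →ₗ[k] T} (hf : f ∈ (bar 𝒯).cocycles t n)
    (h : f ∘ₗ barMap φ n - φ.toAlgHom.toLinearMap ∘ₗ ζ ∈ relCob φ t n) :
    Gamma φ hη n t ((bar ℛ).cls n t ⟨ζ, hζ⟩) = (bar 𝒯).cls n t ⟨f, hf⟩ := by
  refine (LinearEquiv.symm_apply_eq _).2 (Eq.symm ?_)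
  change etaStar φ n t _ = _
  refine sub_eq_zero.1 (Subquotient.mk_eq_zero.2 ?_)
  refine (mem_coboundaries_iff (sub_mem (etaCoch φ t n ⟨f, hf.1⟩).2
    ((bar ℛ).bcCoch φ t n ⟨ζ, hζ.1⟩).2)).2 ?_
  convert h using 1
  refine LinearMap.ext fun x => ?_
  have h1 : signTwist 𝒯 t 1 * (φ (ζ x) * 1) = φ (ζ x) := by
    rw [signTwist_one, one_mul, mul_one]
  exact congrArg₂ (fun a b : T => a - b) (congrArg f (eta_bcUnit φ n x)) h1

theorem comp_mem_relCoch {t : ℤ} {n : ℕ} {ζ : BarTerm k R n →ₗ[k] R}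
    (hζ : ζ ∈ (bar ℛ).Coch t n) : φ.toAlgHom.toLinearMap ∘ₗ ζ ∈ relCoch φ t n :=
  ⟨fun i x hx => φ.map_mem (hζ.1 i x hx),
    fun a x => by
      change φ (ζ (barLeft k R n a x)) = signTwist 𝒯 t (φ a) * φ (ζ x)
      rw [signTwist_gradedHom, ← map_mul]
      exact congrArg φ (hζ.2.1 a x),
    fun a x => (congrArg φ (hζ.2.2 a x)).trans (map_mul φ _ _)⟩

theorem comp_barMap_mem_relCoch {t : ℤ} {n : ℕ} {f : BarTerm k T n →ₗ[k] T}
    (hf : f ∈ (bar 𝒯).Coch t n) : f ∘ₗ barMap φ n ∈ relCoch φ t n :=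
  ⟨fun i x hx => hf.1 i _ (barMap_mem φ n i x hx),
    fun a x => (congrArg f (barMap_left φ n a x)).trans (hf.2.1 _ _),
    fun a x => (congrArg f (barMap_right φ n a x)).trans (hf.2.2 _ _)⟩

/-- The class `Γ[ζ]` is represented by a cocycle whose restriction to `R` is cohomologous to
`φ ∘ ζ`. -/
theorem exists_Gamma_cls (hη : ∀ n l, Function.Bijective (etaStar φ n l))
    (H : IsComparison (etaChainMap φ)) {n : ℕ} {t : ℤ} {ζ : BarTerm k R n →ₗ[k] R}
    (hζ : ζ ∈ (bar ℛ).cocycles t n) :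
    ∃ (f : BarTerm k T n →ₗ[k] T) (hf : f ∈ (bar 𝒯).cocycles t n),
      f ∘ₗ barMap φ n - φ.toAlgHom.toLinearMap ∘ₗ ζ ∈ relCob φ t n ∧
      Gamma φ hη n t ((bar ℛ).cls n t ⟨ζ, hζ⟩) = (bar 𝒯).cls n t ⟨f, hf⟩ := by
  obtain ⟨f, hf, h⟩ := exists_cocycle H (comp_mem_relCoch hζ.1) (LinearMap.ext fun x =>
    (congrArg φ (LinearMap.congr_fun hζ.2 x)).trans (map_zero φ))
  exact ⟨f, hf, h, Gamma_cls hη hζ hf h⟩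

end RelativeCochains

/-! ### The cup product -/

section RelativeCup

variable {k : Type u} [Field k] {R : Type v} [Ring R] [Algebra k R] {T : Type w} [Ring T]
  [Algebra k T] (ℛ : ℤ → Submodule k R) [GradedAlgebra ℛ] {𝒯 : ℤ → Submodule k T}
  [GradedAlgebra 𝒯] {φ : ℛ →ₐᵍ[k] 𝒯}

/-- The multilinear map underlying the cup product of two cochains of `R` with values in `T`. -/
def relCupMultilinear (j : ℤ) {m n N : ℕ} (h : m + n = N) (f : BarTerm k R m →ₗ[k] T)
    (g : BarTerm k R n →ₗ[k] T) : MultilinearMap k (fun _ : Fin (N + 2) => R) T :=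
  MultilinearMap.mk'
    (fun x => f (PiTensorProduct.tprod k (firstBlock ℛ j m (by omega) x)) *
      g (PiTensorProduct.tprod k (lastBlock m n h x)))
    (fun x q a b => by
      rcases le_or_gt (q : ℕ) m with hq | hq
      · simp only [firstBlock_update_le ℛ j m _ x q hq, lastBlock_update_le m n h x q hq,
          map_add, MultilinearMap.map_update_add, add_mul]
      · simp only [firstBlock_update_gt ℛ j m _ x q hq, lastBlock_update_gt m n h x q hq,
          map_add, MultilinearMap.map_update_add, mul_add])
    (fun x q c a => by
      rcases le_or_gt (q : ℕ) m with hq | hq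
      · simp only [firstBlock_update_le ℛ j m _ x q hq, lastBlock_update_le m n h x q hq,
          map_smul, MultilinearMap.map_update_smul, smul_mul_assoc]
      · simp only [firstBlock_update_gt ℛ j m _ x q hq, lastBlock_update_gt m n h x q hq,
          map_smul, MultilinearMap.map_update_smul, mul_smul_comm])

/-- The cup product of cochains of `R` with values in `T`, defined by the formula of `cupCochain`.
-/
def relCup (j : ℤ) {m n N : ℕ} (h : m + n = N) :
    (BarTerm k R m →ₗ[k] T) →ₗ[k] (BarTerm k R n →ₗ[k] T) →ₗ[k] (BarTerm k R N →ₗ[k] T) :=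
  LinearMap.mk₂ k (fun f g => PiTensorProduct.lift (relCupMultilinear ℛ j h f g))
    (fun f f' g => by ext x; simp [relCupMultilinear, add_mul])
    (fun c f g => by ext x; simp [relCupMultilinear])
    (fun f g g' => by ext x; simp [relCupMultilinear, mul_add])
    (fun c f g => by ext x; simp [relCupMultilinear])

theorem relCup_tprod (j : ℤ) {m n N : ℕ} (h : m + n = N) (f : BarTerm k R m →ₗ[k] T)
    (g : BarTerm k R n →ₗ[k] T) (x : Fin (N + 2) → R) :
    relCup ℛ j h f g (PiTensorProduct.tprod k x) =
      f (PiTensorProduct.tprod k (firstBlock ℛ j m (by omega) x)) *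
      g (PiTensorProduct.tprod k (lastBlock m n h x)) := by
  rw [relCup, LinearMap.mk₂_apply, PiTensorProduct.lift.tprod]
  rfl

theorem relCup_mem {i j : ℤ} {m n N : ℕ} (h : m + n = N) {f : BarTerm k R m →ₗ[k] T}
    (hf : f ∈ relCoch φ i m) {g : BarTerm k R n →ₗ[k] T} (hg : g ∈ relCoch φ j n) :
    relCup ℛ j h f g ∈ relCoch φ (i + j) N := by
  obtain ⟨hf1, hf2, -⟩ := hf
  obtain ⟨hg1, -, hg3⟩ := hg
  refine ⟨fun s => ?_, fun a x => ?_, fun a x => ?_⟩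
  · refine barGrading_map (relCup ℛ j h f g) _ fun e x hx he => ?_
    rw [relCup_tprod]
    have h1 : PiTensorProduct.tprod k (firstBlock ℛ j m (by omega) x) ∈
        barGrading ℛ m (∑ p : Fin (m + 2), if hp : (p : ℕ) ≤ m then e ⟨p, by omega⟩ else 0) := by
      refine tprod_mem_barGrading (fun p => ?_) rfl
      rw [firstBlock]
      split_ifs with hp
      · exact signTwist_mem ℛ j (hx _)
      · exact SetLike.GradedOne.one_mem
    have h2 : PiTensorProduct.tprod k (lastBlock m n h x) ∈
        barGrading ℛ n (∑ p : Fin (n + 2), if (p : ℕ) = 0 then 0 else e ⟨m + p, by omega⟩) := by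
      refine tprod_mem_barGrading (fun p => ?_) rfl
      rw [lastBlock]
      split_ifs with hp
      · exact SetLike.GradedOne.one_mem
      · exact hx _
    have h3 := SetLike.GradedMul.mul_mem (hf1 _ _ h1) (hg1 _ _ h2)
    suffices h7 : s + (i + j) =
        (∑ p : Fin (m + 2), if hp : (p : ℕ) ≤ m then e ⟨p, by omega⟩ else 0) + i +
        ((∑ p : Fin (n + 2), if (p : ℕ) = 0 then 0 else e ⟨m + p, by omega⟩) + j) by
      rw [h7]; exact h3
    subst h
    rw [← he, Fin.sum_univ_castSucc (n := m + 1), Fin.sum_univ_succ (n := n + 1)]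
    have h4 : ∑ p : Fin (m + n + 2), e p =
        (∑ p : Fin (m + 1), e ⟨p, by omega⟩) + ∑ p : Fin (n + 1), e ⟨m + 1 + p, by omega⟩ := by
      rw [← Equiv.sum_comp (finCongr (show (m + 1) + (n + 1) = m + n + 2 by omega)),
        Fin.sum_univ_add]
      rfl
    have h5 : ∀ p : Fin (m + 1), (p : ℕ) ≤ m := fun p => by omega
    simp only [Fin.val_castSucc, h5, dif_pos, Fin.val_last, Fin.val_succ, Fin.val_zero, if_true,
      Nat.add_eq_zero_iff, one_ne_zero, and_false, if_false, zero_add]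
    rw [dif_neg (by omega), h4]
    have h6 : ∀ p : Fin (n + 1), m + 1 + (p : ℕ) = m + ((p : ℕ) + 1) := fun p => by omega
    simp only [h6]
    ring
  · suffices relCup ℛ j h f g ∘ₗ barLeft k R N a =
        LinearMap.mulLeft k (signTwist 𝒯 (i + j) (φ a)) ∘ₗ relCup ℛ j h f g from
      LinearMap.congr_fun this x
    ext x
    simp only [LinearMap.compMultilinearMap_apply, LinearMap.comp_apply, barLeft_tprod,
      relCup_tprod, LinearMap.mulLeft_apply]
    rw [firstBlock_update_le ℛ j m _ x 0 (by simp), lastBlock_update_le m n h x 0 (by simp),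
      ← mul_assoc, signTwist_add, signTwist_gradedHom ℛ j φ]
    congr 1
    refine Eq.trans (congrArg f ?_) (hf2 _ _)
    rw [signTwist_mul]
    exact (barLeft_tprod _ _ _).symm
  · suffices relCup ℛ j h f g ∘ₗ barRight k R N a =
        LinearMap.mulRight k (φ a) ∘ₗ relCup ℛ j h f g from
      LinearMap.congr_fun this x
    ext x
    simp only [LinearMap.compMultilinearMap_apply, LinearMap.comp_apply, barRight_tprod,
      relCup_tprod, LinearMap.mulRight_apply]
    rw [firstBlock_update_gt ℛ j m _ x _ (by simp; omega),
      lastBlock_update_gt m n h x _ (by simp; omega), mul_assoc]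
    congr 1
    refine Eq.trans (congrArg g ?_) (hg3 _ _)
    refine Eq.trans ?_ (barRight_tprod _ _ _).symm
    congr 1
    have h1 : (⟨(Fin.last (N + 1) : ℕ) - m, by simp; omega⟩ : Fin (n + 2)) = Fin.last (n + 1) := by
      ext; simp; omega
    rw [h1]
    congr 2
    rw [lastBlock, if_neg (by simp)]
    congr 1
    ext; simp; omega

/-- The Leibniz rule. The last term of `f ∘ d` in the first summand cancels with the first term of
`g ∘ d` in the second one. -/
theorem relCup_d {i j : ℤ} {m n N : ℕ} (h : m + n = N) {f : BarTerm k R m →ₗ[k] T}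
    (hf : f ∈ relCoch φ i m) {g : BarTerm k R n →ₗ[k] T} (hg : g ∈ relCoch φ j n) :
    relCup ℛ j h f g ∘ₗ barD k R N =
      relCup ℛ j (show m + 1 + n = N + 1 by omega) (f ∘ₗ barD k R m) g +
      (-1 : k) ^ m • relCup ℛ j (show m + (n + 1) = N + 1 by omega) f (g ∘ₗ barD k R n) := by
  obtain ⟨-, -, hf3⟩ := hf
  obtain ⟨-, hg2, -⟩ := hg
  ext x
  simp only [LinearMap.compMultilinearMap_apply, LinearMap.comp_apply, LinearMap.add_apply,
    LinearMap.smul_apply, barD_tprod, relCup_tprod, map_sum, map_smul]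
  have hfirst : ∀ t ∈ Finset.range (m + 1), firstBlock ℛ j m (by omega) (contract t x) =
      contract t (firstBlock ℛ j (m + 1) (by omega) x) := by
    intro t ht
    rw [Finset.mem_range] at ht
    ext ⟨p, hp⟩
    simp only [firstBlock, contract, Fin.val_castSucc, Fin.val_succ]
    split_ifs <;> first | omega | skip
    all_goals first | rfl | (rw [signTwist_mul]; rfl)
  have hlast : ∀ t ∈ Finset.range (m + 1), lastBlock m n h (contract t x) =
      lastBlock (m + 1) n (by omega) x := by
    intro t ht
    rw [Finset.mem_range] at ht
    ext ⟨p, hp⟩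
    simp only [lastBlock, contract]
    split_ifs <;> first | omega | skip
    all_goals first | rfl | exact congrArg x (Fin.ext (by simp; omega))
  have hfirst' : ∀ t ∈ Finset.range (n + 1), firstBlock ℛ j m (by omega)
      (contract (m + 1 + t) x) = firstBlock ℛ j m (by omega) x := by
    intro t ht
    ext ⟨p, hp⟩
    simp only [firstBlock, contract]
    split_ifs <;> first | omega | contradiction | rfl
  have hlast' : ∀ t ∈ Finset.range (n + 1), lastBlock m n h (contract (m + 1 + t) x) =
      contract (t + 1) (lastBlock m (n + 1) (by omega) x) := by
    intro t ht
    ext ⟨p, hp⟩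
    simp only [lastBlock, contract, Fin.val_castSucc, Fin.val_succ]
    split_ifs <;> first | omega | contradiction | rfl
  have hmid1 : contract (m + 1) (firstBlock ℛ j (m + 1) (by omega : m + 1 ≤ N + 1) x) =
      Function.update (firstBlock ℛ j m (by omega : m ≤ N + 1) x) (Fin.last (m + 1))
        (firstBlock ℛ j m (by omega : m ≤ N + 1) x (Fin.last (m + 1)) *
          signTwist ℛ j (x ⟨m + 1, by omega⟩)) := by
    ext ⟨p, hp⟩
    simp only [firstBlock, contract, Fin.val_castSucc, Fin.val_succ, Function.update_apply,
      Fin.ext_iff, Fin.val_last]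
    split_ifs <;> first | omega | skip
    all_goals first | rfl | (subst_vars; simp)
  have hmid2 : contract 0 (lastBlock m (n + 1) (by omega : m + (n + 1) = N + 1) x) =
      Function.update (lastBlock (m + 1) n (by omega : m + 1 + n = N + 1) x) 0
        (x ⟨m + 1, by omega⟩ * lastBlock (m + 1) n (by omega : m + 1 + n = N + 1) x 0) := by
    ext ⟨p, hp⟩
    simp only [lastBlock, contract, Fin.val_castSucc, Fin.val_succ, Function.update_apply,
      Fin.ext_iff, Fin.val_zero]
    split_ifs <;> first | omega | skip
    all_goals first | contradiction | (subst_vars; simp) |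
      exact congrArg x (Fin.ext (by simp; omega))
  have hA : f (PiTensorProduct.tprod k (contract (m + 1)
        (firstBlock ℛ j (m + 1) (by omega : m + 1 ≤ N + 1) x))) =
      f (PiTensorProduct.tprod k (firstBlock ℛ j m (by omega : m ≤ N + 1) x)) *
        φ (signTwist ℛ j (x ⟨m + 1, by omega⟩)) := by
    rw [hmid1, ← barRight_tprod]
    exact hf3 _ _
  have hB : g (PiTensorProduct.tprod k (contract 0
        (lastBlock m (n + 1) (by omega : m + (n + 1) = N + 1) x))) =
      φ (signTwist ℛ j (x ⟨m + 1, by omega⟩)) *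
        g (PiTensorProduct.tprod k (lastBlock (m + 1) n (by omega : m + 1 + n = N + 1) x)) := by
    rw [hmid2, ← barLeft_tprod, ← signTwist_gradedHom]
    exact hg2 _ _
  have hN : ∀ F : ℕ → T, ∑ t ∈ Finset.range (N + 2), F t =
      ∑ t ∈ Finset.range (m + 1), F t + ∑ t ∈ Finset.range (n + 1), F (m + 1 + t) := fun F => by
    rw [← Finset.sum_range_add, show N + 2 = (m + 1) + (n + 1) by omega]
  rw [hN, Finset.sum_range_succ _ (m + 1), Finset.sum_range_succ' _ (n + 1),
    hA, hB]
  rw [Finset.sum_congr rfl fun t ht => by rw [hfirst t ht, hlast t ht],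
    Finset.sum_congr (s₁ := Finset.range (n + 1)) rfl fun t ht => by rw [hfirst' t ht, hlast' t ht]]
  rw [add_mul, mul_add, Finset.sum_mul, Finset.mul_sum, smul_add, Finset.smul_sum]
  simp only [smul_mul_assoc, mul_smul_comm, smul_smul, pow_zero, one_smul, mul_assoc]
  have hpow : ∀ t : ℕ, (-1 : k) ^ m * (-1) ^ (t + 1) = (-1) ^ (m + 1 + t) := fun t => by ring
  simp only [hpow, pow_succ (-1 : k) m]
  simp only [mul_neg, mul_one, neg_smul]
  abel

theorem relCup_comp_left {j : ℤ} {m n N : ℕ} (h : m + n = N) {ζ : BarTerm k R m →ₗ[k] R}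
    {ξ : BarTerm k R n →ₗ[k] R} :
    relCup ℛ j h (φ.toAlgHom.toLinearMap ∘ₗ ζ) (φ.toAlgHom.toLinearMap ∘ₗ ξ) =
      φ.toAlgHom.toLinearMap ∘ₗ cupCochain ℛ j h ζ ξ := by
  ext x
  simp only [LinearMap.compMultilinearMap_apply, LinearMap.comp_apply, relCup_tprod,
    cupCochain_tprod]
  exact (map_mul φ _ _).symm

theorem relCup_comp_barMap {j : ℤ} {m n N : ℕ} (h : m + n = N) {f : BarTerm k T m →ₗ[k] T}
    {g : BarTerm k T n →ₗ[k] T} :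
    relCup ℛ j h (f ∘ₗ barMap φ m) (g ∘ₗ barMap φ n) = cupCochain 𝒯 j h f g ∘ₗ barMap φ N := by
  ext x
  simp only [LinearMap.compMultilinearMap_apply, LinearMap.comp_apply, relCup_tprod,
    cupCochain_tprod, barMap_tprod]
  congr 4
  · ext p
    simp only [firstBlock]
    split_ifs
    · exact (signTwist_gradedHom _ _ _ _).symm
    · exact map_one φ
  · ext p
    simp only [lastBlock]
    split_ifs
    · exact map_one φ
    · rfl

variable {ℛ}

/-- The product of a coboundary with a cocycle is a coboundary. -/
theorem relCup_cob_left {i j : ℤ} {m n N : ℕ} (h : m + n = N) {f : BarTerm k R m →ₗ[k] T}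
    (hf : f ∈ relCob φ i m) {g : BarTerm k R n →ₗ[k] T} (hg : g ∈ relCoch φ j n)
    (hg0 : g ∘ₗ barD k R n = 0) : relCup ℛ j h f g ∈ relCob φ (i + j) N := by
  cases m with
  | zero =>
    rw [(Submodule.mem_bot k).1 hf, LinearMap.map_zero₂]
    exact zero_mem _
  | succ m =>
    obtain ⟨N, rfl⟩ : ∃ N', N = N' + 1 := ⟨m + n, by omega⟩
    obtain ⟨f', hf', rfl⟩ := mem_relCob_succ.1 hf
    have hN : m + n = N := by omega
    refine mem_relCob_succ.2 ⟨relCup ℛ j hN f' g, relCup_mem ℛ hN hf' hg, ?_⟩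
    rw [relCup_d ℛ hN hf' hg, hg0, map_zero, smul_zero, add_zero]

/-- The product of a cocycle with a coboundary is a coboundary. -/
theorem relCup_cob_right {i j : ℤ} {m n N : ℕ} (h : m + n = N) {f : BarTerm k R m →ₗ[k] T}
    (hf : f ∈ relCoch φ i m) (hf0 : f ∘ₗ barD k R m = 0) {g : BarTerm k R n →ₗ[k] T}
    (hg : g ∈ relCob φ j n) : relCup ℛ j h f g ∈ relCob φ (i + j) N := by
  cases n with
  | zero =>
    rw [(Submodule.mem_bot k).1 hg, map_zero]
    exact zero_mem _
  | succ n =>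
    obtain ⟨N, rfl⟩ : ∃ N', N = N' + 1 := ⟨m + n, by omega⟩
    obtain ⟨g', hg', rfl⟩ := mem_relCob_succ.1 hg
    have hN : m + n = N := by omega
    refine mem_relCob_succ.2 ⟨(-1 : k) ^ m • relCup ℛ j hN f g',
      Submodule.smul_mem _ _ (relCup_mem ℛ hN hf hg'), ?_⟩
    rw [LinearMap.smul_comp, relCup_d ℛ hN hf hg', hf0, map_zero, LinearMap.zero_apply, zero_add,
      smul_smul, ← mul_pow]
    simp

theorem comp_barMap_barD {n : ℕ} {f : BarTerm k T n →ₗ[k] T} (hf : f ∘ₗ barD k T n = 0) :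
    (f ∘ₗ barMap φ n) ∘ₗ barD k R n = 0 :=
  LinearMap.ext fun x => (congrArg f (barMap_d φ n x)).trans (LinearMap.congr_fun hf _)

theorem comp_barD {n : ℕ} {ζ : BarTerm k R n →ₗ[k] R} (hζ : ζ ∘ₗ barD k R n = 0) :
    (φ.toAlgHom.toLinearMap ∘ₗ ζ) ∘ₗ barD k R n = 0 :=
  LinearMap.ext fun x => (congrArg φ (LinearMap.congr_fun hζ x)).trans (map_zero φ)

/-- `Γ` is unital, since `φ` is compatible with the multiplications of `R` and `T`. -/
theorem Gamma_one (hη : ∀ n l, Function.Bijective (etaStar φ n l)) :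
    Gamma φ hη 0 0 (HH.one ℛ) = HH.one 𝒯 := by
  refine Gamma_cls hη (mulCochain_mem ℛ) (mulCochain_mem 𝒯) ?_
  have h : mulCochain k T ∘ₗ barMap φ 0 = φ.toAlgHom.toLinearMap ∘ₗ mulCochain k R := by
    ext x
    simp only [LinearMap.compMultilinearMap_apply, LinearMap.comp_apply, barMap_tprod,
      mulCochain_tprod]
    exact (map_mul φ _ _).symm
  rw [h, sub_self]
  exact zero_mem _

/-- Both the restriction of cochains of `T` to `R` and the composition with `φ` are compatible with
the cup product of cochains of `R` with values in `T`. -/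
theorem cup_mem_relCob {i j : ℤ} {m n : ℕ} {ζ : BarTerm k R m →ₗ[k] R}
    (hζ : ζ ∈ (bar ℛ).cocycles i m) {ξ : BarTerm k R n →ₗ[k] R} {f : BarTerm k T m →ₗ[k] T}
    (hf : f ∘ₗ barMap φ m - φ.toAlgHom.toLinearMap ∘ₗ ζ ∈ relCob φ i m)
    {g : BarTerm k T n →ₗ[k] T} (hg : g ∈ (bar 𝒯).cocycles j n)
    (hgξ : g ∘ₗ barMap φ n - φ.toAlgHom.toLinearMap ∘ₗ ξ ∈ relCob φ j n) :
    cupCochain 𝒯 j rfl f g ∘ₗ barMap φ (m + n) -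
      φ.toAlgHom.toLinearMap ∘ₗ cupCochain ℛ j rfl ζ ξ ∈ relCob φ (i + j) (m + n) := by
  have h := add_mem
    (relCup_cob_left rfl hf (comp_barMap_mem_relCoch hg.1) (comp_barMap_barD hg.2))
    (relCup_cob_right rfl (comp_mem_relCoch hζ.1) (comp_barD hζ.2) hgξ)
  rwa [map_sub, LinearMap.sub_apply, map_sub, sub_add_sub_cancel, relCup_comp_left,
    relCup_comp_barMap] at h

theorem Gamma_cup (hη : ∀ n l, Function.Bijective (etaStar φ n l))
    (H : IsComparison (etaChainMap φ)) {m n : ℕ} {i j : ℤ} (x : HH ℛ m i) (y : HH ℛ n j) :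
    Gamma φ hη (m + n) (i + j) (HH.cup ℛ x y) =
      HH.cup 𝒯 (Gamma φ hη m i x) (Gamma φ hη n j y) := by
  obtain ⟨⟨ζ, hζ⟩, rfl⟩ := Subquotient.mk_surjective x
  obtain ⟨⟨ξ, hξ⟩, rfl⟩ := Subquotient.mk_surjective y
  obtain ⟨f, hf, h1, h2⟩ := exists_Gamma_cls hη H hζ
  obtain ⟨g, hg, h3, h4⟩ := exists_Gamma_cls hη H hξ
  refine Eq.trans ?_ (congrArg₂ (fun a b => HH.cup 𝒯 a b) h2 h4).symm
  exact Gamma_cls hη (cupCocycles ℛ i j rfl ⟨ζ, hζ⟩ ⟨ξ, hξ⟩).2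
    (cupCocycles 𝒯 i j rfl ⟨f, hf⟩ ⟨g, hg⟩).2 (cup_mem_relCob hζ h1 hg h3)

end RelativeCup

/-! ### The canonical class -/

section RelativeSecondary

variable {k : Type u} [Field k] {Λ : Type v} [Ring Λ] [Algebra k Λ]
  {ℒ : ℤ → Submodule k Λ} [GradedAlgebra ℒ] {B : Type w} [Ring B] [Algebra k B]
  {ℬ : ℤ → Submodule k B} [GradedAlgebra ℬ]

variable (ℒ) in
theorem signTwist_neg_one_signTwist (x : Λ) :
    signTwist ℒ (-1) (signTwist ℒ (-1) x) = x := by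
  have h := signTwist_add ℒ 1 (-1) x
  rw [signTwist_neg ℒ 1 (signTwist ℒ (-1) x), ← h, add_neg_cancel, signTwist_zero]

/-- The data of `SecondaryData`, taken along a homomorphism `χ : Λ → H^*B` of graded algebras:
cocycles `f₁(x)` which represent `χ(x)`, and homotopies `f₂(x, y)` which make `f₁` multiplicative
up to coboundaries. -/
structure RelSecondaryData (D : DGStructure ℬ) (χ : ℒ →ₐᵍ[k] D.cohGrading) where
  /-- The choice of representing cocycles. -/
  f₁ : Λ →ₗ[k] B
  f₁_mem : ∀ i, ∀ x ∈ ℒ i, f₁ x ∈ ℬ i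
  d_f₁ : ∀ x, D.d (f₁ x) = 0
  toCohomology_f₁ : ∀ x, D.toCohomology ⟨f₁ x, d_f₁ x⟩ = χ x
  /-- The choice of homotopies. -/
  f₂ : Λ →ₗ[k] Λ →ₗ[k] B
  f₂_mem : ∀ i j, ∀ x ∈ ℒ i, ∀ y ∈ ℒ j, f₂ x y ∈ ℬ (i + j - 1)
  d_f₂ : ∀ x y, D.d (f₂ x y) = f₁ (x * y) - f₁ x * f₁ y

namespace RelSecondaryData

variable {D : DGStructure ℬ} {χ : ℒ →ₐᵍ[k] D.cohGrading} (S S' : RelSecondaryData D χ)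

theorem signTwist_f₁ (t : ℤ) (x : Λ) : signTwist ℬ t (S.f₁ x) = S.f₁ (signTwist ℒ t x) := by
  have h := signTwist_map ℒ ℬ t 0 S.f₁ (fun i x hx => by rw [add_zero]; exact S.f₁_mem i x hx) x
  simpa using h

theorem signTwist_f₂ (x y : Λ) : signTwist ℬ (-1) (S.f₂ (signTwist ℒ (-1) x)
    (signTwist ℒ (-1) y)) = - S.f₂ x y := by
  have h : (S.f₂.compl₁₂ (signTwist ℒ (-1)) (signTwist ℒ (-1))).compr₂
      (signTwist ℬ (-1)) = - S.f₂ := by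
    refine ext_homogeneous ℒ fun i x hx => ext_homogeneous ℒ fun j y hy => ?_
    simp only [LinearMap.compr₂_apply, LinearMap.compl₁₂_apply, LinearMap.neg_apply]
    rw [signTwist_of_mem _ _ hx, signTwist_of_mem _ _ hy, map_zsmul S.f₂,
      LinearMap.smul_apply, map_zsmul, map_zsmul, map_zsmul,
      signTwist_of_mem _ _ (S.f₂_mem i j x hx y hy), smul_smul, smul_smul, ← Units.val_mul,
      ← Units.val_mul, ← Int.negOnePow_add, ← Int.negOnePow_add,
      show -1 * i + -1 * j + -1 * (i + j - 1) = 2 * (-(i + j)) + 1 by ring,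
      Int.negOnePow_two_mul_add_one]
    simp
  exact LinearMap.congr_fun₂ h x y

/-- The cocycle of `SecondaryData.Phi`. -/
def Phi (x y z : Λ) : B :=
  S.f₁ (signTwist ℒ (-1) x) * S.f₂ y z - S.f₂ x y * S.f₁ z - S.f₂ (x * y) z + S.f₂ x (y * z)

theorem d_Phi (x y z : Λ) : D.d (S.Phi x y z) = 0 := by
  rw [Phi, map_add, map_sub, map_sub, D.d_mul, D.d_mul, signTwist_f₁, signTwist_neg_one_signTwist,
    S.d_f₁, S.d_f₁, S.d_f₂, S.d_f₂, S.d_f₂, S.d_f₂, mul_assoc]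
  noncomm_ring

/-- The secondary multiplication `Λ × Λ × Λ → H^*B`. -/
def m₃ (x y z : Λ) : D.Cohomology := D.toCohomology ⟨S.Phi x y z, S.d_Phi x y z⟩

/-- Any two choices of representing cocycles differ by the coboundary of a homotopy. -/
theorem exists_homotopy : ∃ h : Λ →ₗ[k] B, (∀ i, ∀ x ∈ ℒ i, h x ∈ ℬ (i - 1)) ∧
    ∀ x, D.d (h x) = S.f₁ x - S'.f₁ x := by
  obtain ⟨H, hH, hH'⟩ := SecondaryData.exists_homotopy D
  have hmem : ∀ i, ∀ x ∈ ℒ i, S.f₁ x - S'.f₁ x ∈ ℬ i := fun i x hx =>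
    sub_mem (S.f₁_mem i x hx) (S'.f₁_mem i x hx)
  refine ⟨H ∘ₗ (S.f₁ - S'.f₁), fun i x hx => hH i _ (hmem i x hx), fun x => ?_⟩
  have h1 : D.d ∘ₗ H ∘ₗ (S.f₁ - S'.f₁) = S.f₁ - S'.f₁ :=
    ext_homogeneous ℒ fun i x hx => hH' i _ (hmem i x hx) (by
      have h2 : D.toCohomology (⟨S.f₁ x, S.d_f₁ x⟩ - ⟨S'.f₁ x, S'.d_f₁ x⟩) = 0 := by
        rw [map_sub, S.toCohomology_f₁, S'.toCohomology_f₁, sub_self]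
      exact D.toCohomology_eq_zero.1 h2)
  exact LinearMap.congr_fun h1 x

section Homotopy

variable (h : Λ →ₗ[k] B)

/-- The difference of two choices of homotopies, corrected by the homotopy `h` between the
representing cocycles so that it takes its values in cocycles. -/
def diff : Λ →ₗ[k] Λ →ₗ[k] B :=
  S.f₂ - S'.f₂ - (LinearMap.mul k Λ).compr₂ h + (LinearMap.mul k B).compl₁₂ h S.f₁ +
    (LinearMap.mul k B).compl₁₂ (S'.f₁ ∘ₗ signTwist ℒ (-1)) h

theorem diff_apply (x y : Λ) : diff S S' h x y =
    S.f₂ x y - S'.f₂ x y - h (x * y) + h x * S.f₁ y + S'.f₁ (signTwist ℒ (-1) x) * h y := rfl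

variable {h}

theorem diff_mem (hh : ∀ i, ∀ x ∈ ℒ i, h x ∈ ℬ (i - 1)) {i j : ℤ} {x y : Λ} (hx : x ∈ ℒ i)
    (hy : y ∈ ℒ j) : diff S S' h x y ∈ ℬ (i + j - 1) := by
  have h1 := SetLike.GradedMul.mul_mem (hh _ _ hx) (S.f₁_mem _ _ hy)
  rw [show i - 1 + j = i + j - 1 by ring] at h1
  have h2 := SetLike.GradedMul.mul_mem (S'.f₁_mem _ _ (signTwist_mem ℒ (-1) hx)) (hh _ _ hy)
  rw [show i + (j - 1) = i + j - 1 by ring] at h2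
  exact add_mem (add_mem (sub_mem (sub_mem (S.f₂_mem _ _ _ hx _ hy) (S'.f₂_mem _ _ _ hx _ hy))
    (hh _ _ (SetLike.GradedMul.mul_mem hx hy))) h1) h2

theorem d_diff (hd : ∀ x, D.d (h x) = S.f₁ x - S'.f₁ x) (x y : Λ) :
    D.d (diff S S' h x y) = 0 := by
  rw [diff_apply, map_add, map_add, map_sub, map_sub, D.d_mul, D.d_mul, signTwist_f₁,
    signTwist_neg_one_signTwist, hd, hd, hd, S.d_f₁, S'.d_f₁, S.d_f₂, S'.d_f₂]
  noncomm_ring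

/-- The difference of the two cocycles is the Hochschild coboundary of `diff` plus the coboundary of
an explicit element of `B`. -/
theorem Phi_sub_Phi (hh : ∀ i, ∀ x ∈ ℒ i, h x ∈ ℬ (i - 1))
    (hd : ∀ x, D.d (h x) = S.f₁ x - S'.f₁ x) (x y z : Λ) :
    S.Phi x y z - S'.Phi x y z =
      (S'.f₁ (signTwist ℒ (-1) x) * diff S S' h y z - diff S S' h x y * S.f₁ z -
        diff S S' h (x * y) z + diff S S' h x (y * z)) +
      D.d (h (signTwist ℒ (-1) x) * S.f₂ y z +
        S'.f₂ (signTwist ℒ (-1) x) (signTwist ℒ (-1) y) * h z) := by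
  have h1 := signTwist_map ℒ ℬ (-1) (-1) h hh (signTwist ℒ (-1) x)
  rw [signTwist_neg_one_signTwist] at h1
  have h2 : signTwist ℬ (-1) (h (signTwist ℒ (-1) x)) = - h x := by
    rw [h1]
    simp
  rw [map_add, D.d_mul, D.d_mul, h2, signTwist_f₂, hd, hd, S.d_f₂, S'.d_f₂, ← signTwist_mul]
  simp only [diff_apply, Phi, signTwist_mul, mul_assoc]
  noncomm_ring

end Homotopy

/-- The secondary multiplications of any two choices differ by the Hochschild coboundary of a
bilinear map of degree `-1`. -/
theorem exists_m₃_sub : ∃ g : Λ →ₗ[k] Λ →ₗ[k] D.Cohomology,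
    (∀ i j, ∀ x ∈ ℒ i, ∀ y ∈ ℒ j, g x y ∈ D.cohGrading (i + j - 1)) ∧
    ∀ x y z, S.m₃ x y z - S'.m₃ x y z = χ (signTwist ℒ (-1) x) * g y z - g x y * χ z -
      g (x * y) z + g x (y * z) := by
  obtain ⟨h, hh, hd⟩ := exists_homotopy S S'
  let g : Λ →ₗ[k] Λ →ₗ[k] D.Cohomology := LinearMap.mk₂ k
    (fun x y => D.toCohomology ⟨diff S S' h x y, d_diff S S' hd x y⟩)
    (fun x x' y => by
      rw [← map_add]
      exact congrArg _ (Subtype.ext (LinearMap.map_add₂ _ _ _ _)))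
    (fun c x y => by
      rw [← map_smul]
      exact congrArg _ (Subtype.ext (LinearMap.map_smul₂ _ _ _ _)))
    (fun x y y' => by
      rw [← map_add]
      exact congrArg _ (Subtype.ext (map_add _ _ _)))
    (fun c x y => by
      rw [← map_smul]
      exact congrArg _ (Subtype.ext (map_smul _ _ _)))
  have hg : ∀ x y, g x y = D.toCohomology ⟨diff S S' h x y, d_diff S S' hd x y⟩ :=
    fun _ _ => rfl
  refine ⟨g, fun i j x hx y hy => ⟨_, diff_mem S S' hh hx hy, rfl⟩, fun x y z => ?_⟩
  rw [hg, hg, hg, hg, ← S'.toCohomology_f₁, ← S.toCohomology_f₁ z, m₃, m₃, ← sub_eq_zero]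
  simp only [← map_mul, ← map_sub, ← map_add]
  exact D.toCohomology_eq_zero.2 ⟨_, (sub_eq_of_eq_add' (Phi_sub_Phi S S' hh hd x y z)).symm⟩

end RelSecondaryData

end RelativeSecondary

section Comparison

variable {k : Type u} [Field k] {A : Type v} [Ring A] [Algebra k A] {B : Type w} [Ring B]
  [Algebra k B] {𝒜 : ℤ → Submodule k A} [GradedAlgebra 𝒜] {ℬ : ℤ → Submodule k B}
  [GradedAlgebra ℬ] {DA : DGStructure 𝒜} {DB : DGStructure ℬ} (ψ : DGHom DA DB)

/-- The composition of the choices made for `A` with `ψ`. -/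
def SecondaryData.push (SA : SecondaryData DA) : RelSecondaryData DB ψ.mapCohomology where
  f₁ := ψ.toGradedAlgHom.toAlgHom.toLinearMap ∘ₗ SA.f₁
  f₁_mem i x hx := ψ.toGradedAlgHom.map_mem (SA.f₁_mem i x hx)
  d_f₁ x := (ψ.map_d _).symm.trans ((congrArg ψ.toGradedAlgHom (SA.d_f₁ x)).trans (map_zero _))
  toCohomology_f₁ x := by
    conv_rhs => rw [← SA.toCohomology_f₁ x]
    rfl
  f₂ := SA.f₂.compr₂ ψ.toGradedAlgHom.toAlgHom.toLinearMap
  f₂_mem i j x hx y hy := ψ.toGradedAlgHom.map_mem (SA.f₂_mem i j x hx y hy)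
  d_f₂ x y := by
    refine (ψ.map_d _).symm.trans ((congrArg ψ.toGradedAlgHom (SA.d_f₂ x y)).trans ?_)
    rw [map_sub, map_mul ψ.toGradedAlgHom]
    rfl

/-- The composition of `H^*ψ` with the choices made for `B`. -/
def SecondaryData.pull (SB : SecondaryData DB) : RelSecondaryData DB ψ.mapCohomology where
  f₁ := SB.f₁ ∘ₗ ψ.mapCohomology.toAlgHom.toLinearMap
  f₁_mem i _ hx := SB.f₁_mem i _ (ψ.mapCohomology.map_mem hx)
  d_f₁ _ := SB.d_f₁ _
  toCohomology_f₁ _ := SB.toCohomology_f₁ _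
  f₂ := SB.f₂.compl₁₂ ψ.mapCohomology.toAlgHom.toLinearMap ψ.mapCohomology.toAlgHom.toLinearMap
  f₂_mem i j _ hx _ hy :=
    SB.f₂_mem i j _ (ψ.mapCohomology.map_mem hx) _ (ψ.mapCohomology.map_mem hy)
  d_f₂ x y := (SB.d_f₂ _ _).trans
    (congrArg (fun v => SB.f₁ v - _) (map_mul ψ.mapCohomology x y).symm)

theorem SecondaryData.push_m₃ (SA : SecondaryData DA) (x y z : DA.Cohomology) :
    (SA.push ψ).m₃ x y z = ψ.mapCohomology (SA.m₃ x y z) := by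
  refine congrArg DB.toCohomology (Subtype.ext (Eq.symm ?_))
  change ψ.toGradedAlgHom (SA.Phi x y z) = (SA.push ψ).Phi x y z
  rw [SecondaryData.Phi, map_add, map_sub, map_sub, map_mul, map_mul]
  rfl

theorem SecondaryData.pull_m₃ (SB : SecondaryData DB) (x y z : DA.Cohomology) :
    (SB.pull ψ).m₃ x y z =
      SB.m₃ (ψ.mapCohomology x) (ψ.mapCohomology y) (ψ.mapCohomology z) := by
  refine congrArg DB.toCohomology (Subtype.ext (Eq.symm ?_))
  change SB.Phi _ _ _ = _
  rw [SecondaryData.Phi, signTwist_gradedHom, ← map_mul, ← map_mul]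
  rfl

section TwoCochain

variable {R : Type v} [Ring R] [Algebra k R] {T : Type w} [Ring T] [Algebra k T]
  {ℛ : ℤ → Submodule k R} [GradedAlgebra ℛ] {𝒯 : ℤ → Submodule k T} [GradedAlgebra 𝒯]
  (φ : ℛ →ₐᵍ[k] 𝒯) (g : R →ₗ[k] R →ₗ[k] T)

/-- The cochain `(x_0, …, x_3) ↦ (-1)^|x_0| φ(x_0) g(x_1, x_2) φ(x_3)`. -/
def twoCochain : BarTerm k R 2 →ₗ[k] T :=
  PiTensorProduct.lift <| MultilinearMap.mk'
    (fun x => φ (signTwist ℛ (-1) (x 0)) * g (x 1) (x 2) * φ (x 3))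
    (fun x q a b => by
      fin_cases q <;>
        simp [Function.update, add_mul, mul_add])
    (fun x q c a => by
      fin_cases q <;>
        simp [Function.update])

theorem twoCochain_tprod (x : Fin 4 → R) : twoCochain φ g (PiTensorProduct.tprod k x) =
    φ (signTwist ℛ (-1) (x 0)) * g (x 1) (x 2) * φ (x 3) :=
  PiTensorProduct.lift.tprod _

variable {g}

theorem twoCochain_mem (hg : ∀ i j, ∀ x ∈ ℛ i, ∀ y ∈ ℛ j, g x y ∈ 𝒯 (i + j - 1)) :
    twoCochain φ g ∈ relCoch φ (-1) 2 := by
  refine ⟨fun i => ?_, fun a x => ?_, fun a x => ?_⟩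
  · refine barGrading_map (twoCochain φ g) _ fun e x hx he => ?_
    rw [twoCochain_tprod]
    have h0 : φ (signTwist ℛ (-1) (x 0)) ∈ 𝒯 (e 0) := φ.map_mem (signTwist_mem ℛ (-1) (hx 0))
    have h3 : φ (x 3) ∈ 𝒯 (e 3) := φ.map_mem (hx 3)
    have h := SetLike.GradedMul.mul_mem (SetLike.GradedMul.mul_mem h0
      (hg _ _ _ (hx 1) _ (hx 2))) h3
    have h1 : e 0 + e 1 + e 2 + e 3 = i := by
      rw [← he]; exact (Fin.sum_univ_four e).symm
    rwa [show e 0 + (e 1 + e 2 - 1) + e 3 = i + -1 by rw [← h1]; ring] at h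
  · suffices twoCochain φ g ∘ₗ barLeft k R 2 a =
        LinearMap.mulLeft k (signTwist 𝒯 (-1) (φ a)) ∘ₗ twoCochain φ g from
      LinearMap.congr_fun this x
    ext x
    simp only [LinearMap.compMultilinearMap_apply, LinearMap.comp_apply, barLeft_tprod,
      LinearMap.mulLeft_apply, twoCochain_tprod, signTwist_gradedHom]
    simp [Function.update, signTwist_mul, mul_assoc]
  · suffices twoCochain φ g ∘ₗ barRight k R 2 a =
        LinearMap.mulRight k (φ a) ∘ₗ twoCochain φ g from LinearMap.congr_fun this x
    ext x
    simp only [LinearMap.compMultilinearMap_apply, LinearMap.comp_apply, barRight_tprod,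
      LinearMap.mulRight_apply, twoCochain_tprod]
    have h : (Fin.last 3 : Fin 4) = 3 := rfl
    simp [h, Function.update, mul_assoc]

/-- The composite of `twoCochain φ g` with the differential, in terms of the Hochschild coboundary
of `g` that occurs in `RelSecondaryData.exists_m₃_sub`. -/
theorem twoCochain_barD (x : Fin 5 → R) :
    twoCochain φ g (barD k R 2 (PiTensorProduct.tprod k x)) =
      φ (signTwist ℛ (-1) (x 0)) * (φ (signTwist ℛ (-1) (x 1)) * g (x 2) (x 3) -
        g (x 1) (x 2) * φ (x 3) - g (x 1 * x 2) (x 3) + g (x 1) (x 2 * x 3)) * φ (x 4) := by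
  simp only [barD_tprod, map_sum, map_smul, twoCochain_tprod]
  simp [Finset.sum_range_succ, contract, signTwist_mul]
  have h3 : (-1 : k) ^ 3 = -1 := by norm_num
  rw [h3, neg_smul, one_smul]
  simp only [mul_add, mul_sub, add_mul, sub_mul, mul_assoc]
  abel

end TwoCochain

/-- Composing the choices for `A` with `ψ` and those for `B` with `H^*ψ` gives two choices of
secondary data along `H^*ψ`, whose secondary multiplications are cohomologous. -/
theorem m₃Cochain_sub_mem_relCob (SA : SecondaryData DA) (SB : SecondaryData DB) :
    SB.m₃Cochain ∘ₗ barMap ψ.mapCohomology 3 -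
      ψ.mapCohomology.toAlgHom.toLinearMap ∘ₗ SA.m₃Cochain ∈
        relCob ψ.mapCohomology (-1) 3 := by
  obtain ⟨g, hg, h⟩ := RelSecondaryData.exists_m₃_sub (SA.push ψ) (SB.pull ψ)
  refine mem_relCob_succ.2 ⟨- twoCochain ψ.mapCohomology g,
    neg_mem (twoCochain_mem ψ.mapCohomology hg), ?_⟩
  ext x
  simp only [LinearMap.compMultilinearMap_apply, LinearMap.comp_apply, LinearMap.neg_apply,
    LinearMap.sub_apply, barMap_tprod, SecondaryData.m₃Cochain_tprod, twoCochain_barD]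
  rw [← h, SecondaryData.push_m₃, SecondaryData.pull_m₃, signTwist_gradedHom]
  change _ = _ - ψ.mapCohomology (_ * _ * _)
  rw [map_mul, map_mul]
  noncomm_ring

theorem Gamma_canonicalClass (hη : ∀ n l, Function.Bijective (etaStar ψ.mapCohomology n l))
    (SA : SecondaryData DA) (SB : SecondaryData DB) :
    Gamma ψ.mapCohomology hη 3 (-1) SA.canonicalClass = SB.canonicalClass :=
  Gamma_cls hη SA.m₃Cochain_mem SB.m₃Cochain_mem (m₃Cochain_sub_mem_relCob ψ SA SB)

end Comparison

end DGHoch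

end

theorem mainTheorem6 {k : Type u} [Field k] {A : Type v} [Ring A] [Algebra k A]
    {B : Type w} [Ring B] [Algebra k B]
    (𝒜 : ℤ → Submodule k A) [GradedAlgebra 𝒜] (ℬ : ℤ → Submodule k B) [GradedAlgebra ℬ]
    (DA : DGStructure 𝒜) (DB : DGStructure ℬ) (ψ : DGHom DA DB)
    (hψ : IsFlatEpi ψ.mapCohomologyAlgHom.toRingHom) :
    ∃ hη : ∀ (n : ℕ) (l : ℤ), Function.Bijective (etaStar ψ.mapCohomology n l),
      Gamma ψ.mapCohomology hη 0 0 (HH.one DA.cohGrading) = HH.one DB.cohGrading ∧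
      (∀ (m n : ℕ) (i j : ℤ) (x : HH DA.cohGrading m i) (y : HH DA.cohGrading n j),
        Gamma ψ.mapCohomology hη (m + n) (i + j) (HH.cup DA.cohGrading x y) =
          HH.cup DB.cohGrading (Gamma ψ.mapCohomology hη m i x)
            (Gamma ψ.mapCohomology hη n j y)) ∧
      ∀ (SA : SecondaryData DA) (SB : SecondaryData DB),
        Gamma ψ.mapCohomology hη 3 (-1) SA.canonicalClass = SB.canonicalClass := by
  have H : IsComparison (etaChainMap ψ.mapCohomology) := eta_isComparison _ hψ.2.1 hψ.1
  exact ⟨fun n l => etaStar_bijective H n l, Gamma_one _, fun m n i j x y => Gamma_cup _ H x y,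
    fun SA SB => Gamma_canonicalClass ψ _ SA SB⟩
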